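/- Let $M$ be a smooth $7$-manifold (Hausdorff, second countable, without boundary) with a closed $G_2$-structure, i.e. a smooth $3$-form $\varphi$ with $d\varphi=0$ such that for every $p\in M$ there is a linear isomorphism $(T_pM,\varphi_p)\cong(\mathbb R^7,\varphi_0)$, where $\varphi_0=e^{123}+e^{145}+e^{167}+e^{246}-e^{257}-e^{347}-e^{356}$. (In particular, $M$ may be any $G_2$ manifold, for which $d\varphi=d{\star}\varphi=0$.) Let $g=\langle\cdot,\cdot\rangle$ be the Riemannian metric determined by $\varphi$, i.e. the Euclidean inner product transported by these isomorphisms, and let $\times$ be the cross product defined by $\varphi(u,v,w)=\langle u,v\times w\rangle$. Let $\iota\colon HL\to M$ be a nonempty, compact, oriented, smoothly embedded $3$-dimensional submanifold (without boundary) that is Harvey–Lawson, i.e. $\iota^*\varphi=0$. Let $\Gamma(N(HL))$ be the space of smooth normal vector fields of $HL$. A deformation of $HL$ with initial velocity $V\in\Gamma(N(HL))$ is a smooth map $(-\varepsilon,\varepsilon)\times HL\to M$, $(t,x)\mapsto f_t(x)$, for some $\varepsilon>0$, with $f_0=\iota$ and $\frac{\partial}{\partial t}f_t|_{t=0}=V$;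 for instance $f_t=\exp_{tV}$. Then every $V\in\Gamma(N(HL))$ is the initial velocity of a deformation, and there is a linear map $D\colon\Gamma(N(HL))\to\Omega^3(HL)$, the linearization at $0$ of the deformation map $F(V)=\exp_V^*\varphi$, such that $\frac{\partial}{\partial t}f_t^*\varphi|_{t=0}=D(V)$ (pointwise on $HL$) for every $V\in\Gamma(N(HL))$ and every deformation $f_t$ with initial velocity $V$. The space $\ker D$ of infinitesimal deformations of $HL$ within the class of Harvey–Lawson submanifolds is infinite-dimensional, and $$\ker D\;\longrightarrow\; C^\infty(HL)\oplus\{\eta\in\Omega^2(HL): d\eta=0\},\qquad V\longmapsto\bigl(\langle V,R\rangle,\ (i_V\varphi)|_{HL}\bigr)$$ is a well-defined isomorphism of real vector spaces. Here $R$ is the normal field $R=-u\times(v\times w)$, for any positively oriented orthonormal basis $u,v,w$ of a tangent space of $HL$ (it does not depend on the choice of the basis), and $((i_V\varphi)|_{HL})(b,c)=\varphi(V,b,c)$ for $b,c$ tangent to $HL$. -/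

import Mathlib

open scoped Manifold ContDiff

noncomputable section

/-! Smooth differential forms on manifolds modelled on `ℝⁿ` (without boundary). -/

/-- A (not necessarily smooth) differential `k`-form on the `n`-manifold `M`: an alternating
`k`-linear form on each tangent space. -/
abbrev FormField (n : ℕ) (M : Type*) [TopologicalSpace M]
    [ChartedSpace (EuclideanSpace ℝ (Fin n)) M] (k : ℕ) : Type _ :=
  ∀ x : M, (TangentSpace (𝓡 n) x) [⋀^Fin k]→L[ℝ] ℝ

/-- The form `θ` read in the chart `e`, that is, the pullback of `θ` by `e.symm`. It is meaningful
on the open set `e.target`. -/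
def FormField.inChart {n : ℕ} {M : Type*} [TopologicalSpace M]
    [ChartedSpace (EuclideanSpace ℝ (Fin n)) M] {k : ℕ} (θ : FormField n M k)
    (e : OpenPartialHomeomorph M (EuclideanSpace ℝ (Fin n))) (y : EuclideanSpace ℝ (Fin n)) :
    (EuclideanSpace ℝ (Fin n)) [⋀^Fin k]→L[ℝ] ℝ :=
  (θ (e.symm y)).compContinuousLinearMap
    (mfderiv 𝓘(ℝ, EuclideanSpace ℝ (Fin n)) (𝓡 n) e.symm y)

/-- `θ` is a smooth form: its expression in every chart of the atlas is smooth. -/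
def FormField.IsSmooth {n : ℕ} {M : Type*} [TopologicalSpace M]
    [ChartedSpace (EuclideanSpace ℝ (Fin n)) M] {k : ℕ} (θ : FormField n M k) : Prop :=
  ∀ e ∈ atlas (EuclideanSpace ℝ (Fin n)) M, ContDiffOn ℝ ∞ (θ.inChart e) e.target

/-- `dθ = 0`: the exterior derivative of `θ` vanishes in every chart of the atlas. -/
def FormField.IsClosed {n : ℕ} {M : Type*} [TopologicalSpace M]
    [ChartedSpace (EuclideanSpace ℝ (Fin n)) M] {k : ℕ} (θ : FormField n M k) : Prop :=
  ∀ e ∈ atlas (EuclideanSpace ℝ (Fin n)) M, ∀ y ∈ e.target, extDeriv (θ.inChart e) y = 0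

theorem FormField.inChart_zero {n : ℕ} {M : Type*} [TopologicalSpace M]
    [ChartedSpace (EuclideanSpace ℝ (Fin n)) M] {k : ℕ}
    (e : OpenPartialHomeomorph M (EuclideanSpace ℝ (Fin n))) :
    (0 : FormField n M k).inChart e = 0 := by
  funext y; ext v; rfl

theorem FormField.inChart_add {n : ℕ} {M : Type*} [TopologicalSpace M]
    [ChartedSpace (EuclideanSpace ℝ (Fin n)) M] {k : ℕ} (θ η : FormField n M k)
    (e : OpenPartialHomeomorph M (EuclideanSpace ℝ (Fin n))) :
    (θ + η).inChart e = θ.inChart e + η.inChart e := by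
  funext y; ext v; rfl

theorem FormField.inChart_smul {n : ℕ} {M : Type*} [TopologicalSpace M]
    [ChartedSpace (EuclideanSpace ℝ (Fin n)) M] {k : ℕ} (c : ℝ) (θ : FormField n M k)
    (e : OpenPartialHomeomorph M (EuclideanSpace ℝ (Fin n))) :
    (c • θ).inChart e = c • θ.inChart e := by
  funext y; ext v; rfl

/-- The real vector space `Ω^k(M)` of smooth `k`-forms on `M`. -/
def smoothForms (n : ℕ) (M : Type*) [TopologicalSpace M]
    [ChartedSpace (EuclideanSpace ℝ (Fin n)) M] (k : ℕ) : Submodule ℝ (FormField n M k) where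
  carrier := {θ | θ.IsSmooth}
  zero_mem' := fun e _ => by
    rw [FormField.inChart_zero]; exact contDiffOn_const
  add_mem' := fun {θ η} hθ hη e he => by
    rw [FormField.inChart_add]; exact (hθ e he).add (hη e he)
  smul_mem' := fun c θ hθ e he => by
    rw [FormField.inChart_smul]; exact (hθ e he).const_smul c

/-- The real vector space of smooth closed `k`-forms on `M`. -/
def closedForms (n : ℕ) (M : Type*) [TopologicalSpace M]
    [ChartedSpace (EuclideanSpace ℝ (Fin n)) M] (k : ℕ) : Submodule ℝ (FormField n M k) where
  carrier := {θ | θ.IsSmooth ∧ θ.IsClosed}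
  zero_mem' := ⟨(smoothForms n M k).zero_mem, fun e _ y _ => by
    rw [FormField.inChart_zero]
    simpa using extDeriv_smul (0 : ℝ)
      (0 : EuclideanSpace ℝ (Fin n) → (EuclideanSpace ℝ (Fin n)) [⋀^Fin k]→L[ℝ] ℝ) (x := y)⟩
  add_mem' := fun {θ η} hθ hη => ⟨(smoothForms n M k).add_mem hθ.1 hη.1, fun e he y hy => by
    have h1 := ((hθ.1 e he).differentiableOn (by simp)).differentiableAt
      (e.open_target.mem_nhds hy)
    have h2 := ((hη.1 e he).differentiableOn (by simp)).differentiableAt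
      (e.open_target.mem_nhds hy)
    rw [FormField.inChart_add, extDeriv_add h1 h2, hθ.2 e he y hy, hη.2 e he y hy, add_zero]⟩
  smul_mem' := fun c θ hθ => ⟨(smoothForms n M k).smul_mem c hθ.1, fun e he y hy => by
    rw [FormField.inChart_smul, extDeriv_smul, hθ.2 e he y hy, smul_zero]⟩

/-! `G₂`-structures. -/

/-- `dxⁱ ∧ dxʲ ∧ dxᵏ` on `ℝ⁷`; the coordinates are numbered from `0` to `6`. -/
def wedge3 (i j k : Fin 7) (u v w : EuclideanSpace ℝ (Fin 7)) : ℝ :=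
  Matrix.det !![u i, v i, w i; u j, v j, w j; u k, v k, w k]

/-- The standard form `φ₀ = e¹²³ + e¹⁴⁵ + e¹⁶⁷ + e²⁴⁶ - e²⁵⁷ - e³⁴⁷ - e³⁵⁶` on `ℝ⁷`. -/
def phi0 (u v w : EuclideanSpace ℝ (Fin 7)) : ℝ :=
  wedge3 0 1 2 u v w + wedge3 0 3 4 u v w + wedge3 0 5 6 u v w + wedge3 1 3 5 u v w
    - wedge3 1 4 6 u v w - wedge3 2 3 6 u v w - wedge3 2 4 5 u v w

/-- A `G₂`-structure on a `7`-manifold: a smooth `3`-form `φ` with `(T_p M, φ_p) ≅ (ℝ⁷, φ₀)` for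
every `p`. -/
structure G2Structure (M : Type*) [TopologicalSpace M]
    [ChartedSpace (EuclideanSpace ℝ (Fin 7)) M] where
  /-- the `3`-form -/
  form : FormField 7 M 3
  isSmooth : form.IsSmooth
  exists_frame : ∀ p : M, ∃ e : TangentSpace (𝓡 7) p ≃ₗ[ℝ] EuclideanSpace ℝ (Fin 7),
    ∀ u v w : TangentSpace (𝓡 7) p, form p ![u, v, w] = phi0 (e u) (e v) (e w)

/-- An isomorphism `(T_p M, φ_p) ≅ (ℝ⁷, φ₀)`. -/
def G2Structure.frame {M : Type*} [TopologicalSpace M]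
    [ChartedSpace (EuclideanSpace ℝ (Fin 7)) M] (φ : G2Structure M) (p : M) :
    TangentSpace (𝓡 7) p ≃ₗ[ℝ] EuclideanSpace ℝ (Fin 7) :=
  Classical.choose (φ.exists_frame p)

/-- The Riemannian metric determined by `φ`: the Euclidean inner product of `ℝ⁷` transported to
`T_p M` by an isomorphism `(T_p M, φ_p) ≅ (ℝ⁷, φ₀)`. Two such isomorphisms differ by an element of
`G₂ ⊆ SO(7)`, so that the metric does not depend on the choice. -/
def G2Structure.metric {M : Type*} [TopologicalSpace M]
    [ChartedSpace (EuclideanSpace ℝ (Fin 7)) M] (φ : G2Structure M) (p : M)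
    (u v : TangentSpace (𝓡 7) p) : ℝ :=
  inner ℝ (φ.frame p u) (φ.frame p v)

/-- The cross product on `T_p M`, determined by `φ(u, v, w) = g(u, v × w)`
(see `G2Structure.metric_cross`). -/
def G2Structure.cross {M : Type*} [TopologicalSpace M]
    [ChartedSpace (EuclideanSpace ℝ (Fin 7)) M] (φ : G2Structure M) (p : M)
    (v w : TangentSpace (𝓡 7) p) : TangentSpace (𝓡 7) p :=
  (φ.frame p).symm (WithLp.toLp 2 fun i =>
    φ.form p ![(φ.frame p).symm (EuclideanSpace.single i 1), v, w])

theorem G2Structure.metric_cross {M : Type*} [TopologicalSpace M]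
    [ChartedSpace (EuclideanSpace ℝ (Fin 7)) M] (φ : G2Structure M) (p : M)
    (u v w : TangentSpace (𝓡 7) p) :
    φ.metric p u (φ.cross p v w) = φ.form p ![u, v, w] := by
  have h : u = ∑ i, (φ.frame p u) i • (φ.frame p).symm (EuclideanSpace.single i 1) := by
    apply (φ.frame p).injective
    rw [map_sum]
    ext j
    simp [Finset.sum_apply, Pi.single_apply]
  have key : ∀ c : Fin 7 → ℝ, φ.form p
      ![∑ i, c i • (φ.frame p).symm (EuclideanSpace.single i 1), v, w]
      = ∑ i, c i * φ.form p ![(φ.frame p).symm (EuclideanSpace.single i 1), v, w] := by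
    intro c
    have := (φ.form p).toContinuousMultilinearMap.toMultilinearMap.map_update_sum
      (Finset.univ : Finset (Fin 7)) (0 : Fin 3)
      (fun i => c i • (φ.frame p).symm (EuclideanSpace.single i 1)) ![0, v, w]
    have h2 : ∀ z : TangentSpace (𝓡 7) p,
        Function.update (![0, v, w] : Fin 3 → TangentSpace (𝓡 7) p) 0 z = ![z, v, w] := by
      intro z; ext i; fin_cases i <;> rfl
    have h3 : ∀ (a : ℝ) (z : TangentSpace (𝓡 7) p),
        φ.form p ![a • z, v, w] = a * φ.form p ![z, v, w] := by
      intro a z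
      have := (φ.form p).toContinuousMultilinearMap.toMultilinearMap.map_update_smul
        ![0, v, w] 0 a z
      simpa [h2] using this
    simp only [h2] at this
    refine this.trans (Finset.sum_congr rfl fun i _ => h3 _ _)
  conv_rhs => rw [h]
  rw [key]
  simp [G2Structure.metric, G2Structure.cross, PiLp.inner_apply, mul_comm]

theorem G2Structure.metric_add_left {M : Type*} [TopologicalSpace M]
    [ChartedSpace (EuclideanSpace ℝ (Fin 7)) M] (φ : G2Structure M) (p : M)
    (u v w : TangentSpace (𝓡 7) p) :
    φ.metric p (u + v) w = φ.metric p u w + φ.metric p v w := by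
  simp [G2Structure.metric, inner_add_left]

theorem G2Structure.metric_smul_left {M : Type*} [TopologicalSpace M]
    [ChartedSpace (EuclideanSpace ℝ (Fin 7)) M] (φ : G2Structure M) (p : M) (c : ℝ)
    (u w : TangentSpace (𝓡 7) p) :
    φ.metric p (c • u) w = c * φ.metric p u w := by
  simp [G2Structure.metric, inner_smul_left]

/-! Vector fields along a map and normal vector fields. -/

/-- The vector field `V` along the map `ι` is smooth. -/
def IsSmoothAlong {M : Type*} [TopologicalSpace M] [ChartedSpace (EuclideanSpace ℝ (Fin 7)) M]
    [IsManifold (𝓡 7) ∞ M] {L : Type*} [TopologicalSpace L] [ChartedSpace (EuclideanSpace ℝ (Fin 3)) L]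
    (ι : L → M) (V : ∀ x : L, TangentSpace (𝓡 7) (ι x)) : Prop :=
  ContMDiff (𝓡 3) (𝓡 7).tangent ∞ (fun x => (⟨ι x, V x⟩ : TangentBundle (𝓡 7) M))

theorem IsSmoothAlong.add {M : Type*} [TopologicalSpace M]
    [ChartedSpace (EuclideanSpace ℝ (Fin 7)) M] [IsManifold (𝓡 7) ∞ M]
    {L : Type*} [TopologicalSpace L] [ChartedSpace (EuclideanSpace ℝ (Fin 3)) L]
    {ι : L → M} {V W : ∀ x : L, TangentSpace (𝓡 7) (ι x)}
    (hV : IsSmoothAlong ι V) (hW : IsSmoothAlong ι W) : IsSmoothAlong ι (V + W) := by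
  intro x₀
  have hV := hV x₀
  have hW := hW x₀
  rw [Bundle.contMDiffAt_totalSpace] at hV hW ⊢
  refine ⟨hV.1, (hV.2.add hW.2).congr_of_eventuallyEq ?_⟩
  set e := trivializationAt (EuclideanSpace ℝ (Fin 7)) (TangentSpace (𝓡 7) : M → Type _) (ι x₀)
  have : ∀ᶠ x in nhds x₀, ι x ∈ e.baseSet :=
    hV.1.continuousAt.eventually (e.open_baseSet.mem_nhds
      (FiberBundle.mem_baseSet_trivializationAt' (ι x₀)))
  filter_upwards [this] with x hx
  exact (e.linear ℝ hx).1 _ _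

theorem IsSmoothAlong.smul {M : Type*} [TopologicalSpace M]
    [ChartedSpace (EuclideanSpace ℝ (Fin 7)) M] [IsManifold (𝓡 7) ∞ M]
    {L : Type*} [TopologicalSpace L] [ChartedSpace (EuclideanSpace ℝ (Fin 3)) L]
    {ι : L → M} {V : ∀ x : L, TangentSpace (𝓡 7) (ι x)} (c : ℝ)
    (hV : IsSmoothAlong ι V) : IsSmoothAlong ι (c • V) := by
  intro x₀
  have hV := hV x₀
  rw [Bundle.contMDiffAt_totalSpace] at hV ⊢
  have hs : ContDiff ℝ ∞ (fun z : EuclideanSpace ℝ (Fin 7) => c • z) := contDiff_const_smul c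
  refine ⟨hV.1, (hs.contMDiff.contMDiffAt.comp x₀ hV.2).congr_of_eventuallyEq ?_⟩
  set e := trivializationAt (EuclideanSpace ℝ (Fin 7)) (TangentSpace (𝓡 7) : M → Type _) (ι x₀)
  have : ∀ᶠ x in nhds x₀, ι x ∈ e.baseSet :=
    hV.1.continuousAt.eventually (e.open_baseSet.mem_nhds
      (FiberBundle.mem_baseSet_trivializationAt' (ι x₀)))
  filter_upwards [this] with x hx
  exact (e.linear ℝ hx).2 _ _

theorem IsSmoothAlong.zero {M : Type*} [TopologicalSpace M]
    [ChartedSpace (EuclideanSpace ℝ (Fin 7)) M] [IsManifold (𝓡 7) ∞ M]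
    {L : Type*} [TopologicalSpace L] [ChartedSpace (EuclideanSpace ℝ (Fin 3)) L]
    {ι : L → M} (hι : ContMDiff (𝓡 3) (𝓡 7) ∞ ι) :
    IsSmoothAlong ι (0 : ∀ x : L, TangentSpace (𝓡 7) (ι x)) := by
  intro x₀
  rw [Bundle.contMDiffAt_totalSpace]
  refine ⟨hι x₀, (contMDiffAt_const (c := (0 : EuclideanSpace ℝ (Fin 7)))).congr_of_eventuallyEq ?_⟩
  set e := trivializationAt (EuclideanSpace ℝ (Fin 7)) (TangentSpace (𝓡 7) : M → Type _) (ι x₀)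
  have : ∀ᶠ x in nhds x₀, ι x ∈ e.baseSet :=
    (hι x₀).continuousAt.eventually (e.open_baseSet.mem_nhds
      (FiberBundle.mem_baseSet_trivializationAt' (ι x₀)))
  filter_upwards [this] with x hx
  exact (e.linear ℝ hx).map_zero

/-- The real vector space `Γ(N(L))` of smooth normal vector fields of the submanifold `ι : L → M`:
smooth vector fields `V` along `ι` such that `V x` is orthogonal to `dι(T_x L)` for every `x`. -/
def normalFields {M : Type*} [TopologicalSpace M] [ChartedSpace (EuclideanSpace ℝ (Fin 7)) M]
    [IsManifold (𝓡 7) ∞ M] {L : Type*} [TopologicalSpace L]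
    [ChartedSpace (EuclideanSpace ℝ (Fin 3)) L] (φ : G2Structure M) (ι : L → M)
    (hι : ContMDiff (𝓡 3) (𝓡 7) ∞ ι) : Submodule ℝ (∀ x : L, TangentSpace (𝓡 7) (ι x)) where
  carrier := {V | IsSmoothAlong ι V ∧
    ∀ (x : L) (a : TangentSpace (𝓡 3) x), φ.metric (ι x) (V x) (mfderiv (𝓡 3) (𝓡 7) ι x a) = 0}
  zero_mem' := ⟨IsSmoothAlong.zero hι, fun x a => by
    simp [G2Structure.metric]⟩
  add_mem' := fun {V W} hV hW => ⟨hV.1.add hW.1, fun x a => by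
    rw [Pi.add_apply, G2Structure.metric_add_left, hV.2 x a, hW.2 x a, add_zero]⟩
  smul_mem' := fun c V hV => ⟨hV.1.smul c, fun x a => by
    rw [Pi.smul_apply, G2Structure.metric_smul_left, hV.2 x a, mul_zero]⟩

/-! Harvey–Lawson submanifolds and their infinitesimal deformations. -/

/-- The pullback of a `k`-form `θ` on `M` by `h : L → M` at the point `x`, evaluated on `a`. -/
def pullbackApply {M : Type*} [TopologicalSpace M] [ChartedSpace (EuclideanSpace ℝ (Fin 7)) M]
    {L : Type*} [TopologicalSpace L] [ChartedSpace (EuclideanSpace ℝ (Fin 3)) L] {k : ℕ}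
    (θ : FormField 7 M k) (h : L → M) (x : L) (a : Fin k → TangentSpace (𝓡 3) x) : ℝ :=
  θ (h x) fun i => mfderiv (𝓡 3) (𝓡 7) h x (a i)

/-- `ι : L → M` is an (embedded) Harvey–Lawson submanifold: a smoothly embedded `3`-manifold on
which `φ` vanishes. -/
structure IsHarveyLawson {M : Type*} [TopologicalSpace M]
    [ChartedSpace (EuclideanSpace ℝ (Fin 7)) M] {L : Type*} [TopologicalSpace L]
    [ChartedSpace (EuclideanSpace ℝ (Fin 3)) L] (φ : G2Structure M) (ι : L → M) : Prop where
  isSmoothEmbedding : Manifold.IsSmoothEmbedding (𝓡 3) (𝓡 7) ∞ ι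
  form_eq_zero : ∀ (x : L) (a : Fin 3 → TangentSpace (𝓡 3) x), pullbackApply φ.form ι x a = 0

/-- `f` is a smooth one-parameter deformation of `ι : L → M` with initial velocity `V`:
`(t, x) ↦ f t x` is smooth on `(-ε, ε) × L` for some `ε > 0`, and for every `x` the curve
`t ↦ f t x` has position `ι x` and velocity `V x` at `t = 0`. For `L` compact, the normal
exponential deformation `f t x = exp_{ι x}(t • V x)` is an example. -/
def IsDeformation {M : Type*} [TopologicalSpace M] [ChartedSpace (EuclideanSpace ℝ (Fin 7)) M]
    {L : Type*} [TopologicalSpace L] [ChartedSpace (EuclideanSpace ℝ (Fin 3)) L]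
    (ι : L → M) (V : ∀ x : L, TangentSpace (𝓡 7) (ι x)) (f : ℝ → L → M) : Prop :=
  (∃ ε : ℝ, 0 < ε ∧ ContMDiffOn (𝓘(ℝ, ℝ).prod (𝓡 3)) (𝓡 7) ∞ (fun q : ℝ × L => f q.1 q.2)
      (Set.Ioo (-ε) ε ×ˢ Set.univ)) ∧
    ∀ x : L, (⟨f 0 x, mfderiv 𝓘(ℝ, ℝ) (𝓡 7) (fun t => f t x) 0 (1 : ℝ)⟩ : TangentBundle (𝓡 7) M) =
      ⟨ι x, V x⟩

/-- `D` is the linearization at `0` of the deformation map `F(V) = exp_V^* φ`, from normal vector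
fields to `3`-forms on `L`. For each normal field `V` there are deformations `f` with initial
velocity `V`, and along each of them (so along `exp_{tV}`) `d/dt f_t^* φ` at `t = 0` is `D V`. -/
def IsLinearizedDeformationMap {M : Type*} [TopologicalSpace M]
    [ChartedSpace (EuclideanSpace ℝ (Fin 7)) M] [IsManifold (𝓡 7) ∞ M] {L : Type*}
    [TopologicalSpace L] [ChartedSpace (EuclideanSpace ℝ (Fin 3)) L] (φ : G2Structure M)
    (ι : L → M) (hι : ContMDiff (𝓡 3) (𝓡 7) ∞ ι)
    (D : normalFields φ ι hι →ₗ[ℝ] smoothForms 3 L 3) : Prop :=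
  ∀ V : normalFields φ ι hι, (∃ f : ℝ → L → M, IsDeformation ι V.1 f) ∧
    ∀ f : ℝ → L → M, IsDeformation ι V.1 f →
      ∀ (x : L) (a : Fin 3 → TangentSpace (𝓡 3) x),
        HasDerivAt (fun t : ℝ => pullbackApply φ.form (f t) x a) ((D V).1 x a) 0

/-- `a` is an orthonormal basis of `T_x L` for the metric induced by `ι`, positively oriented for
the orientation of `L` given by the nowhere vanishing `3`-form `o`. -/
def IsOrientedOrthonormal {M : Type*} [TopologicalSpace M]
    [ChartedSpace (EuclideanSpace ℝ (Fin 7)) M] {L : Type*} [TopologicalSpace L]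
    [ChartedSpace (EuclideanSpace ℝ (Fin 3)) L] (φ : G2Structure M) (ι : L → M)
    (o : smoothForms 3 L 3) (x : L) (a : Fin 3 → TangentSpace (𝓡 3) x) : Prop :=
  (∀ i j, φ.metric (ι x) (mfderiv (𝓡 3) (𝓡 7) ι x (a i)) (mfderiv (𝓡 3) (𝓡 7) ι x (a j)) =
    if i = j then 1 else 0) ∧ 0 < o.1 x a

/-- The normal vector `R = - u × (v × w)` for the frame `u = dι(a₀)`, `v = dι(a₁)`,
`w = dι(a₂)`. -/
def hlNormal {M : Type*} [TopologicalSpace M]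
    [ChartedSpace (EuclideanSpace ℝ (Fin 7)) M] {L : Type*} [TopologicalSpace L]
    [ChartedSpace (EuclideanSpace ℝ (Fin 3)) L] (φ : G2Structure M) (ι : L → M)
    (x : L) (a : Fin 3 → TangentSpace (𝓡 3) x) : TangentSpace (𝓡 7) (ι x) :=
  - φ.cross (ι x) (mfderiv (𝓡 3) (𝓡 7) ι x (a 0))
    (φ.cross (ι x) (mfderiv (𝓡 3) (𝓡 7) ι x (a 1)) (mfderiv (𝓡 3) (𝓡 7) ι x (a 2)))

end

/-! The linearization is given by Cartan's formula. If `f` is a deformation with initial velocity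
`V`, then the derivative of `f_t^*φ` at `t = 0` is `d((i_V φ)|_L) + (i_V dφ)|_L`, and the second
term vanishes because `φ` is closed. So `D V = d((i_V φ)|_L)`, which involves the deformation only
through `V`, and `ker D` consists of the normal fields whose contraction with `φ` restricts to a
closed form. This is `hasDerivAt_pullback_of_extDeriv_eq_zero` in a vector space and
`IsDeformation.hasDerivAt_pullbackApply` on manifolds.

The rest is linear algebra at a point. If `u, v, w` is an orthonormal basis of a tangent space of
`L`, where `φ(u, v, w) = 0`, then `u, v, w, u × v, v × w, w × u, R` is an orthonormal basis of the
ambient tangent space (`orthonormal_harveyLawson_frame`). A normal vector `V` has components `φ(V,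
u, v)`, `φ(V, v, w)`, `φ(V, w, u)` along the three products, which are exactly the components of the
`2`-form `(i_V φ)|_L`. The one remaining component is `⟨V, R⟩`. Hence normal vectors correspond to
pairs of a number and a `2`-form, and elements of `ker D` to pairs of a function and a closed
`2`-form. Since the functions occur without constraint, the kernel is infinite-dimensional.

The delicate point is smoothness. The isomorphisms with `(ℝ⁷, φ₀)` are chosen separately at each
point, without any continuity. The metric is therefore recovered from `φ` by an explicit formula
with determinants and roots (`IsPullbackPhi0.gramOf_eq`, `IsPullbackPhi0.contDiffAt_gramOf`), so
that in charts `⟨V, R⟩` is a smooth expression in smooth data. Conversely, `V` solves an invertible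
`7 × 7` linear system with smooth coefficients
(`isSmoothAlong_of_contractedForm_of_normalComponent`).

Deformations with a given velocity are built without the exponential map, by adding the velocity
chart by chart with a partition of unity (`exists_isDeformation`). -/

/-! The standard cross product on `ℝ⁷`. -/

/-- The cross product on `ℝ⁷` determined by `φ₀(u, v, w) = ⟨u, v × w⟩`. -/
noncomputable def cross0 (v w : EuclideanSpace ℝ (Fin 7)) : EuclideanSpace ℝ (Fin 7) :=
  WithLp.toLp 2 fun i => phi0 (EuclideanSpace.single i 1) v w

theorem phi0_rotate (u v w : EuclideanSpace ℝ (Fin 7)) : phi0 u v w = phi0 v w u := by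
  simp only [phi0, wedge3, Matrix.det_fin_three]; simp; ring

theorem phi0_swap_left (u v w : EuclideanSpace ℝ (Fin 7)) : phi0 u v w = -phi0 v u w := by
  simp only [phi0, wedge3, Matrix.det_fin_three]; simp; ring

theorem phi0_swap_right (u v w : EuclideanSpace ℝ (Fin 7)) : phi0 u v w = -phi0 u w v := by
  simp only [phi0, wedge3, Matrix.det_fin_three]; simp; ring

theorem phi0_add_left (u u' v w : EuclideanSpace ℝ (Fin 7)) :
    phi0 (u + u') v w = phi0 u v w + phi0 u' v w := by
  simp only [phi0, wedge3, Matrix.det_fin_three]; simp; ring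

theorem phi0_smul_left (c : ℝ) (u v w : EuclideanSpace ℝ (Fin 7)) :
    phi0 (c • u) v w = c * phi0 u v w := by
  simp only [phi0, wedge3, Matrix.det_fin_three]; simp; ring

theorem cross0_add_left (u v w : EuclideanSpace ℝ (Fin 7)) :
    cross0 (u + v) w = cross0 u w + cross0 v w := by
  ext i
  simp only [cross0, PiLp.add_apply]
  rw [phi0_rotate, phi0_add_left, ← phi0_rotate, ← phi0_rotate _ v]

theorem cross0_smul_left (c : ℝ) (v w : EuclideanSpace ℝ (Fin 7)) :
    cross0 (c • v) w = c • cross0 v w := by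
  ext i
  simp only [cross0, PiLp.smul_apply, smul_eq_mul]
  rw [phi0_rotate, phi0_smul_left, ← phi0_rotate]

theorem cross0_swap (v w : EuclideanSpace ℝ (Fin 7)) : cross0 w v = -cross0 v w := by
  ext i; simp only [cross0, PiLp.neg_apply]; rw [phi0_swap_right]

theorem cross0_add_right (u v w : EuclideanSpace ℝ (Fin 7)) :
    cross0 u (v + w) = cross0 u v + cross0 u w := by
  rw [cross0_swap, cross0_add_left, cross0_swap u v, cross0_swap u w, neg_add]; simp

theorem cross0_smul_right (c : ℝ) (v w : EuclideanSpace ℝ (Fin 7)) :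
    cross0 v (c • w) = c • cross0 v w := by
  rw [cross0_swap, cross0_smul_left, cross0_swap v w, smul_neg, neg_neg]

theorem cross0_neg_right (v w : EuclideanSpace ℝ (Fin 7)) : cross0 v (-w) = -cross0 v w := by
  rw [← neg_one_smul ℝ w, cross0_smul_right, neg_one_smul]

theorem cross0_self (v : EuclideanSpace ℝ (Fin 7)) : cross0 v v = 0 := by
  have h : (2 : ℝ) • cross0 v v = 0 := by
    rw [two_smul]; nth_rewrite 1 [cross0_swap]; exact neg_add_cancel _
  simpa using h

theorem cross0_apply (v w : EuclideanSpace ℝ (Fin 7)) : cross0 v w =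
    !₂[v 1 * w 2 - v 2 * w 1 + v 3 * w 4 - v 4 * w 3 + v 5 * w 6 - v 6 * w 5,
      v 2 * w 0 - v 0 * w 2 + v 3 * w 5 - v 5 * w 3 - v 4 * w 6 + v 6 * w 4,
      v 0 * w 1 - v 1 * w 0 - v 3 * w 6 + v 6 * w 3 - v 4 * w 5 + v 5 * w 4,
      v 4 * w 0 - v 0 * w 4 + v 5 * w 1 - v 1 * w 5 - v 6 * w 2 + v 2 * w 6,
      v 0 * w 3 - v 3 * w 0 - v 6 * w 1 + v 1 * w 6 - v 5 * w 2 + v 2 * w 5,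
      v 6 * w 0 - v 0 * w 6 + v 1 * w 3 - v 3 * w 1 - v 2 * w 4 + v 4 * w 2,
      v 0 * w 5 - v 5 * w 0 - v 1 * w 4 + v 4 * w 1 - v 2 * w 3 + v 3 * w 2] := by
  ext i
  fin_cases i <;>
  · simp [cross0, phi0, wedge3, Matrix.det_fin_three]
    ring

theorem phi0_eq_inner (u v w : EuclideanSpace ℝ (Fin 7)) :
    phi0 u v w = inner ℝ u (cross0 v w) := by
  simp only [cross0_apply, phi0, wedge3, Matrix.det_fin_three, PiLp.inner_apply,
    Fin.sum_univ_seven]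
  simp
  ring

/-- The alternative law of the octonions for imaginary elements, verified in coordinates. With
`phi0_eq_inner` and the antisymmetry of `φ₀` it yields the later metric identities of the cross
product. -/
theorem cross0_cross0_self (u v : EuclideanSpace ℝ (Fin 7)) :
    cross0 u (cross0 u v) = inner ℝ u v • u - inner ℝ u u • v := by
  rw [cross0_apply u, cross0_apply u v]
  ext i
  simp only [PiLp.sub_apply, PiLp.smul_apply, PiLp.inner_apply, Fin.sum_univ_seven]
  fin_cases i <;>
  · simp
    ring

/-- The alternating `ℝ⁷`-valued form which is `-u × (v × w)` on orthogonal triples. -/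
noncomputable def chi0 :
    EuclideanSpace ℝ (Fin 7) [⋀^Fin 3]→ₗ[ℝ] EuclideanSpace ℝ (Fin 7) where
  toFun m := -cross0 (m 0) (cross0 (m 1) (m 2)) - inner ℝ (m 0) (m 1) • m 2
    + inner ℝ (m 0) (m 2) • m 1
  map_update_add' {inst} m i x y := by
    obtain rfl : inst = instDecidableEqFin 3 := Subsingleton.elim _ _
    fin_cases i
    all_goals
    · simp [cross0_add_left, cross0_add_right, inner_add_left, inner_add_right]
      module
  map_update_smul' {inst} m i c x := by
    obtain rfl : inst = instDecidableEqFin 3 := Subsingleton.elim _ _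
    fin_cases i
    all_goals
    · simp [cross0_smul_left, cross0_smul_right, inner_smul_left, inner_smul_right]
      module
  map_eq_zero_of_eq' m i j hm hij := by
    -- The inner product terms are corrections: by `cross0_cross0_self` they cancel what `-u × (v ×
    -- w)` leaves when the first vector is repeated.
    have h01 : ∀ u w : EuclideanSpace ℝ (Fin 7), -cross0 u (cross0 u w) - inner ℝ u u • w
        + inner ℝ u w • u = 0 := by
      intro u w; rw [cross0_cross0_self]; module
    have h12 : ∀ u w : EuclideanSpace ℝ (Fin 7), -cross0 u (cross0 w w) - inner ℝ u w • w
        + inner ℝ u w • w = 0 := by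
      intro u w; rw [cross0_self, ← zero_smul ℝ (0 : EuclideanSpace ℝ (Fin 7)),
        cross0_smul_right]; simp
    have h02 : ∀ u w : EuclideanSpace ℝ (Fin 7), -cross0 u (cross0 w u) - inner ℝ u w • u
        + inner ℝ u u • w = 0 := by
      intro u w; rw [cross0_swap u w, cross0_neg_right, cross0_cross0_self]; module
    fin_cases i <;> fin_cases j <;> simp_all

theorem chi0_apply (u v w : EuclideanSpace ℝ (Fin 7)) :
    chi0 ![u, v, w] = -cross0 u (cross0 v w) - inner ℝ u v • w + inner ℝ u w • v := rfl

/-! Linear algebra of three-dimensional subspaces on which `φ₀` vanishes. -/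

/-- Multiplication by `u` is skew-adjoint because `φ₀` is alternating, so the left side is `-⟨v, u ×
(u × w)⟩`, and `cross0_cross0_self` applies. -/
theorem inner_cross0_cross0 (u v w : EuclideanSpace ℝ (Fin 7)) :
    inner ℝ (cross0 u v) (cross0 u w) =
      inner ℝ u u * inner ℝ v w - inner ℝ u v * inner ℝ u w := by
  have : inner ℝ (cross0 u v) (cross0 u w) = -inner ℝ v (cross0 u (cross0 u w)) := by
    rw [real_inner_comm, ← phi0_eq_inner, ← phi0_eq_inner, phi0_rotate, phi0_swap_left]
  rw [this, cross0_cross0_self, inner_sub_right, inner_smul_right, inner_smul_right,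
    real_inner_comm u v]
  ring

theorem phi0_self_left (u v : EuclideanSpace ℝ (Fin 7)) : phi0 u u v = 0 := by
  have := phi0_swap_left u u v; linarith

theorem phi0_self_right (u v : EuclideanSpace ℝ (Fin 7)) : phi0 u v v = 0 := by
  rw [phi0_rotate, phi0_self_left]

theorem phi0_self_outer (u v : EuclideanSpace ℝ (Fin 7)) : phi0 u v u = 0 := by
  rw [phi0_rotate, phi0_self_right]

/-- For an orthonormal triple `u, v, w` with `φ₀(u, v, w) = 0`, the vectors
`u, v, w, u × v, v × w, w × u, -u × (v × w)` form an orthonormal basis of `ℝ⁷`. -/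
theorem orthonormal_harveyLawson_frame {a : Fin 3 → EuclideanSpace ℝ (Fin 7)}
    (ha : Orthonormal ℝ a) (h : phi0 (a 0) (a 1) (a 2) = 0) :
    Orthonormal ℝ ![a 0, a 1, a 2, cross0 (a 0) (a 1), cross0 (a 1) (a 2), cross0 (a 2) (a 0),
      chi0 a] := by
  have hg := orthonormal_iff_ite.mp ha
  have e00 := hg 0 0; have e01 := hg 0 1; have e02 := hg 0 2
  have e10 := hg 1 0; have e11 := hg 1 1; have e12 := hg 1 2
  have e20 := hg 2 0; have e21 := hg 2 1; have e22 := hg 2 2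
  simp only [Fin.isValue, ↓reduceIte, Fin.reduceEq] at e00 e01 e02 e10 e11 e12 e20 e21 e22
  have hchi : chi0 a = -cross0 (a 0) (cross0 (a 1) (a 2)) := by
    change -cross0 (a 0) (cross0 (a 1) (a 2)) - inner ℝ (a 0) (a 1) • a 2
      + inner ℝ (a 0) (a 2) • a 1 = _
    rw [e01, e02]; simp
  rw [hchi]
  generalize a 0 = u at *
  generalize a 1 = v at *
  generalize a 2 = w at *
  set x := cross0 u v with hx
  set y := cross0 v w with hy
  set z := cross0 w u with hz
  have hx' : x = -cross0 v u := cross0_swap v u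
  have hy' : y = -cross0 w v := cross0_swap w v
  have hz' : z = -cross0 u w := cross0_swap u w
  have ux : inner ℝ u x = 0 := by rw [← phi0_eq_inner, phi0_self_left]
  have uy : inner ℝ u y = 0 := by rw [← phi0_eq_inner, h]
  have uz : inner ℝ u z = 0 := by rw [← phi0_eq_inner, phi0_self_outer]
  have vx : inner ℝ v x = 0 := by rw [← phi0_eq_inner, phi0_self_outer]
  have vy : inner ℝ v y = 0 := by rw [← phi0_eq_inner, phi0_self_left]
  have vz : inner ℝ v z = 0 := by rw [← phi0_eq_inner, ← phi0_rotate, h]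
  have wx : inner ℝ w x = 0 := by rw [← phi0_eq_inner, phi0_rotate, h]
  have wy : inner ℝ w y = 0 := by rw [← phi0_eq_inner, phi0_self_outer]
  have wz : inner ℝ w z = 0 := by rw [← phi0_eq_inner, phi0_self_left]
  have xx : inner ℝ x x = 1 := by rw [hx, inner_cross0_cross0, e00, e11, e01]; norm_num
  have yy : inner ℝ y y = 1 := by rw [hy, inner_cross0_cross0, e11, e22, e12]; norm_num
  have zz : inner ℝ z z = 1 := by rw [hz, inner_cross0_cross0, e22, e00, e20]; norm_num
  have xy : inner ℝ x y = 0 := by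
    rw [hx', hy, inner_neg_left, inner_cross0_cross0, e02, e10]; norm_num
  have xz : inner ℝ x z = 0 := by
    rw [hz', hx, inner_neg_right, inner_cross0_cross0, e12, e01]; norm_num
  have yz : inner ℝ y z = 0 := by
    rw [hy', hz, inner_neg_left, inner_cross0_cross0, e10, e21]; norm_num
  have ur : inner ℝ u (-cross0 u y) = 0 := by
    rw [inner_neg_right, ← phi0_eq_inner, phi0_self_left, neg_zero]
  -- Exchanging two arguments of `φ₀` replaces `⟨v, u × y⟩` by `-⟨u, v × y⟩`. Since `v × (v × w) =
  -- -w` here, orthogonality of `u` and `w` finishes. The same works for `w`.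
  have vr : inner ℝ v (-cross0 u y) = 0 := by
    rw [inner_neg_right, ← phi0_eq_inner, phi0_swap_left, phi0_eq_inner, hy, cross0_cross0_self,
      e12, e11]
    simp [e02]
  have wr : inner ℝ w (-cross0 u y) = 0 := by
    rw [inner_neg_right, ← phi0_eq_inner, phi0_swap_left, phi0_eq_inner, hy', cross0_neg_right,
      cross0_cross0_self, e21, e22]
    simp [e01]
  have xr : inner ℝ x (-cross0 u y) = 0 := by
    rw [inner_neg_right, hx, inner_cross0_cross0, vy, uy]; norm_num
  have yr : inner ℝ y (-cross0 u y) = 0 := by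
    rw [inner_neg_right, ← phi0_eq_inner, phi0_self_outer, neg_zero]
  have zr : inner ℝ z (-cross0 u y) = 0 := by
    rw [inner_neg_right, hz', inner_neg_left, inner_cross0_cross0, wy, uy]; norm_num
  have rr : inner ℝ (-cross0 u y) (-cross0 u y) = 1 := by
    rw [inner_neg_neg, inner_cross0_cross0, yy, uy, e00]; norm_num
  -- From here on only the table of inner products matters, and the 49 entries are closed by
  -- rewriting with it.
  generalize -cross0 u y = r at *
  clear_value x y z
  rw [orthonormal_iff_ite]
  intro i j
  fin_cases i <;> fin_cases j <;>
  simp only [Fin.zero_eta, Fin.mk_one, Fin.reduceFinMk, Matrix.cons_val, Fin.reduceEq, ↓reduceIte,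
    Fin.isValue, Matrix.cons_val_zero, Matrix.cons_val_one, one_ne_zero, zero_ne_one,
    e00, e01, e02, e10, e11, e12, e20, e21, e22, ux, uy, uz, vx, vy, vz, wx, wy, wz, xx, yy, zz,
    xy, xz, yz, ur, vr, wr, xr, yr, zr, rr, real_inner_comm u x, real_inner_comm u y,
    real_inner_comm u z, real_inner_comm v x, real_inner_comm v y, real_inner_comm v z,
    real_inner_comm w x, real_inner_comm w y, real_inner_comm w z, real_inner_comm x y,
    real_inner_comm x z, real_inner_comm y z, real_inner_comm u r, real_inner_comm v r,
    real_inner_comm w r, real_inner_comm x r, real_inner_comm y r, real_inner_comm z r]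

/-- A vector orthogonal to the orthonormal basis of `orthonormal_harveyLawson_frame` vanishes. -/
theorem eq_zero_of_inner_harveyLawson_frame {a : Fin 3 → EuclideanSpace ℝ (Fin 7)}
    (ha : Orthonormal ℝ a) (h : phi0 (a 0) (a 1) (a 2) = 0) {z : EuclideanSpace ℝ (Fin 7)}
    (h₁ : ∀ i, inner ℝ z (a i) = 0) (h₂ : ∀ i j, phi0 z (a i) (a j) = 0)
    (h₃ : inner ℝ z (chi0 a) = 0) : z = 0 := by
  have ho := orthonormal_harveyLawson_frame ha h
  let b := basisOfOrthonormalOfCardEqFinrank ho (by simp)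
  have hb : ⇑b = _ := coe_basisOfOrthonormalOfCardEqFinrank ho (by simp)
  refine InnerProductSpace.ext_inner_right_basis b fun i => ?_
  rw [hb, inner_zero_left]
  fin_cases i
  · exact h₁ 0
  · exact h₁ 1
  · exact h₁ 2
  · exact (phi0_eq_inner _ _ _).symm.trans (h₂ 0 1)
  · exact (phi0_eq_inner _ _ _).symm.trans (h₂ 1 2)
  · exact (phi0_eq_inner _ _ _).symm.trans (h₂ 2 0)
  · exact h₃

section MetricOfForm

open Matrix

/-! The inner product is a smooth function of a `3`-form equivalent to `φ₀`. -/

theorem dotProduct_eq_inner (u v : EuclideanSpace ℝ (Fin 7)) : u ⬝ᵥ v = inner ℝ u v := by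
  simp [dotProduct, PiLp.inner_apply, mul_comm]

/-- The matrix of the `2`-form `i_w φ₀`. -/
noncomputable def contr0 (w : EuclideanSpace ℝ (Fin 7)) : Matrix (Fin 7) (Fin 7) ℝ :=
  Matrix.of fun i j => phi0 w (EuclideanSpace.single i 1) (EuclideanSpace.single j 1)

theorem contr0_mulVec (w v : EuclideanSpace ℝ (Fin 7)) :
    contr0 w *ᵥ v = (cross0 v w).ofLp := by
  ext i
  have h : ∀ j, contr0 w i j = cross0 w (EuclideanSpace.single i 1) j := fun j => by
    rw [contr0, of_apply, phi0_rotate, phi0_rotate]; rfl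
  change ∑ j, contr0 w i j * v j = phi0 (EuclideanSpace.single i 1) v w
  simp only [h]
  rw [phi0_rotate, phi0_eq_inner, PiLp.inner_apply]
  rfl

theorem contr0_mulVec_self (w : EuclideanSpace ℝ (Fin 7)) : contr0 w *ᵥ w = 0 := by
  rw [contr0_mulVec, cross0_self]; rfl

theorem contr0_transpose (w : EuclideanSpace ℝ (Fin 7)) : (contr0 w)ᵀ = -contr0 w := by
  ext i j
  exact phi0_swap_right _ _ _

/-- The matrix represents `v ↦ v × w`, so this is `cross0_cross0_self` for `w`: the square is
`-|w|²` times the orthogonal projection onto the complement of `w`. -/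
theorem contr0_mul_self (w : EuclideanSpace ℝ (Fin 7)) :
    contr0 w * contr0 w = vecMulVec w w - (w ⬝ᵥ w) • (1 : Matrix (Fin 7) (Fin 7) ℝ) := by
  refine Matrix.ext_of_mulVec_single fun j => ?_
  have e : (Pi.single j 1 : Fin 7 → ℝ) = (EuclideanSpace.single j 1 : EuclideanSpace ℝ (Fin 7)) :=
    by ext; simp [Pi.single_apply]
  rw [e, ← mulVec_mulVec, contr0_mulVec, contr0_mulVec, cross0_swap, cross0_swap w,
    cross0_neg_right, neg_neg, cross0_cross0_self, sub_mulVec, smul_mulVec, one_mulVec,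
    vecMulVec_mulVec, ← dotProduct_eq_inner, ← dotProduct_eq_inner]
  ext i
  simp [mul_comm, Pi.single_apply]

/-- A skew matrix of odd size is singular, and the rank-one term fills the kernel direction `w`. The
product with the transpose is then a rank-one perturbation of `|w|²` times the identity, whose
determinant follows from the matrix determinant lemma. -/
theorem det_contr0_add_smul_sq (w : EuclideanSpace ℝ (Fin 7)) (t : ℝ) (hw : w ≠ 0) :
    (contr0 w + t • vecMulVec w w).det ^ 2 = t ^ 2 * (w ⬝ᵥ w) ^ 8 := by
  have hn : w ⬝ᵥ w ≠ 0 := by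
    simpa [dotProduct_self_eq_zero] using hw
  set n := w ⬝ᵥ w with hn'
  have h1 : w ᵥ* contr0 w = 0 := by
    rw [← mulVec_transpose, contr0_transpose, neg_mulVec, contr0_mulVec_self, neg_zero]
  have h : (contr0 w + t • vecMulVec w w) * (contr0 w + t • vecMulVec w w)ᵀ =
      n • (1 + vecMulVec (((t ^ 2 * n - 1) / n) • w.ofLp) w) := by
    have e1 : contr0 w * vecMulVec w w = 0 := by
      rw [mul_vecMulVec, contr0_mulVec_self]; ext; simp [vecMulVec_apply]
    have e2 : vecMulVec w w * contr0 w = 0 := by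
      rw [vecMulVec_mul, h1]; ext; simp [vecMulVec_apply]
    have e3 : vecMulVec w.ofLp w * vecMulVec w w = n • vecMulVec w w := by
      rw [vecMulVec_mul_vecMulVec]; ext; simp [vecMulVec_apply, ← hn']; ring
    rw [transpose_add, transpose_smul, transpose_vecMulVec, contr0_transpose, add_mul, mul_add,
      mul_add, mul_neg, contr0_mul_self, Matrix.smul_mul, Matrix.mul_smul, Matrix.smul_mul,
      Matrix.mul_smul, mul_neg, e1, e2, e3, ← hn']
    ext i j
    simp [vecMulVec_apply]
    field_simp
    ring
  have h2 := congrArg Matrix.det h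
  rw [det_mul, det_transpose, det_smul, vecMulVec_eq Unit ((_ / n) • _),
    det_one_add_replicateCol_mul_replicateRow, dotProduct_smul, ← hn'] at h2
  rw [pow_two, h2]
  simp
  field_simp
  ring

/-- Reduction to `μ` parallel to `w`. The unimodular shear `Q = 1 + w kᵀ`, with `k` orthogonal to
`w`, does not change `contr0 w` because `w` spans directions it kills, and `k` is chosen so that `w
ᵥ* Q` is a multiple of `μ`. -/
theorem det_contr0_add_sq (w μ : EuclideanSpace ℝ (Fin 7)) (hw : w ≠ 0) (hμ : μ ⬝ᵥ w ≠ 0) :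
    (contr0 w + vecMulVec μ μ).det ^ 2 = (μ ⬝ᵥ w) ^ 4 * (w ⬝ᵥ w) ^ 4 := by
  have hn : w ⬝ᵥ w ≠ 0 := by
    simpa [dotProduct_self_eq_zero] using hw
  set n := w ⬝ᵥ w with hn'
  set m := μ ⬝ᵥ w with hm
  let k : Fin 7 → ℝ := m⁻¹ • μ.ofLp - n⁻¹ • w.ofLp
  have hk : k ⬝ᵥ w = 0 := by
    simp [k, sub_dotProduct, smul_dotProduct, ← hn', ← hm, hn, hμ]
  let Q : Matrix (Fin 7) (Fin 7) ℝ := 1 + vecMulVec w k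
  have hQ : Q.det = 1 := by
    change (1 + vecMulVec w.ofLp k).det = 1
    rw [vecMulVec_eq Unit, det_one_add_replicateCol_mul_replicateRow, hk, add_zero]
  have h1 : w ᵥ* contr0 w = 0 := by
    rw [← mulVec_transpose, contr0_transpose, neg_mulVec, contr0_mulVec_self, neg_zero]
  have e1 : contr0 w * Q = contr0 w := by
    rw [mul_add, mul_vecMulVec, contr0_mulVec_self, mul_one]; ext; simp
  have e2 : Qᵀ * contr0 w = contr0 w := by
    rw [transpose_add, transpose_one, transpose_vecMulVec, add_mul, vecMulVec_mul, h1, one_mul]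
    ext; simp
  have e3 : μ.ofLp = (m / n) • (w ᵥ* Q) := by
    rw [vecMul_add, vecMul_one, vecMul_vecMulVec, ← hn']
    ext i
    simp [k]
    field_simp
    ring
  have e4 : Qᵀ *ᵥ w = w ᵥ* Q := mulVec_transpose _ _
  have h : contr0 w + vecMulVec μ μ = Qᵀ * (contr0 w + (m / n) ^ 2 • vecMulVec w w) * Q := by
    rw [Matrix.mul_add Qᵀ, e2, Matrix.add_mul _ _ Q, e1, Matrix.mul_smul, Matrix.smul_mul, mul_vecMulVec, vecMulVec_mul,
      e3, e4]
    ext i j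
    simp [vecMulVec_apply]
    ring
  rw [h, det_mul, det_mul, det_transpose, hQ, one_mul, mul_one, det_contr0_add_smul_sq w _ hw,
    ← hn']
  field_simp

/-! Recovering the inner product. -/

/-- The matrix of the `2`-form `i_u α`. -/
noncomputable def contrMatrix (α : EuclideanSpace ℝ (Fin 7) [⋀^Fin 3]→L[ℝ] ℝ)
    (u : EuclideanSpace ℝ (Fin 7)) : Matrix (Fin 7) (Fin 7) ℝ :=
  Matrix.of fun i j => α ![u, EuclideanSpace.single i 1, EuclideanSpace.single j 1]

/-- For `α = A^*φ₀` and `u ≠ 0` this is `|det A| ⟨A u, A u⟩`. -/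
noncomputable def densityNormSq (α : EuclideanSpace ℝ (Fin 7) [⋀^Fin 3]→L[ℝ] ℝ)
    (u : EuclideanSpace ℝ (Fin 7)) : ℝ :=
  ((contrMatrix α u + vecMulVec u u).det ^ 2) ^ (1 / 4 : ℝ) / (u ⬝ᵥ u)

/-- The form `α` is the pullback of `φ₀` by `A`. -/
def IsPullbackPhi0 (α : EuclideanSpace ℝ (Fin 7) [⋀^Fin 3]→L[ℝ] ℝ)
    (A : EuclideanSpace ℝ (Fin 7) ≃ₗ[ℝ] EuclideanSpace ℝ (Fin 7)) : Prop :=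
  ∀ u v w, α ![u, v, w] = phi0 (A u) (A v) (A w)

theorem dotProduct_contr0_mulVec (u v w : EuclideanSpace ℝ (Fin 7)) :
    v ⬝ᵥ (contr0 u *ᵥ w) = phi0 u v w := by
  rw [contr0_mulVec, phi0_rotate, phi0_eq_inner, PiLp.inner_apply]
  simp [dotProduct, mul_comm]

/-- The matrix of a linear endomorphism of `ℝ⁷`. -/
noncomputable def matrixOf (A : EuclideanSpace ℝ (Fin 7) ≃ₗ[ℝ] EuclideanSpace ℝ (Fin 7)) :
    Matrix (Fin 7) (Fin 7) ℝ :=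
  Matrix.of fun i j => A (EuclideanSpace.single j 1) i

theorem matrixOf_mulVec (A : EuclideanSpace ℝ (Fin 7) ≃ₗ[ℝ] EuclideanSpace ℝ (Fin 7))
    (v : EuclideanSpace ℝ (Fin 7)) : matrixOf A *ᵥ v = A v := by
  have h : v = ∑ j, v j • EuclideanSpace.single j (1 : ℝ) := by
    ext i; simp [Pi.single_apply]
  ext i
  conv_rhs => rw [h]
  simp [matrixOf, mulVec, dotProduct, mul_comm]

theorem matrixOf_symm_mul (A : EuclideanSpace ℝ (Fin 7) ≃ₗ[ℝ] EuclideanSpace ℝ (Fin 7)) :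
    matrixOf A.symm * matrixOf A = 1 := by
  refine Matrix.ext_of_mulVec_single fun j => ?_
  have e : (Pi.single j 1 : Fin 7 → ℝ) = (EuclideanSpace.single j 1 : EuclideanSpace ℝ (Fin 7)) :=
    by ext; simp [Pi.single_apply]
  rw [e, ← mulVec_mulVec, matrixOf_mulVec, matrixOf_mulVec, one_mulVec, A.symm_apply_apply]

theorem det_matrixOf_ne_zero (A : EuclideanSpace ℝ (Fin 7) ≃ₗ[ℝ] EuclideanSpace ℝ (Fin 7)) :
    (matrixOf A).det ≠ 0 := by
  intro h
  have := congrArg Matrix.det (matrixOf_symm_mul A)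
  simp [h] at this

theorem IsPullbackPhi0.contrMatrix_eq {α : EuclideanSpace ℝ (Fin 7) [⋀^Fin 3]→L[ℝ] ℝ}
    {A : EuclideanSpace ℝ (Fin 7) ≃ₗ[ℝ] EuclideanSpace ℝ (Fin 7)} (h : IsPullbackPhi0 α A)
    (u : EuclideanSpace ℝ (Fin 7)) :
    contrMatrix α u = (matrixOf A)ᵀ * contr0 (A u) * matrixOf A := by
  ext i j
  rw [contrMatrix, of_apply, h, ← dotProduct_contr0_mulVec, Matrix.mul_assoc, Matrix.mul_apply,
    dotProduct]
  rfl

/-- Pulling `A` out on both sides turns the covector `u` into `μ = A⁻ᵀ u`, which pairs with `A u` to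
`u ⬝ᵥ u`. The auxiliary term thus contributes a known factor, and `|A u|²` appears without reference
to `A` on the left. -/
theorem IsPullbackPhi0.det_sq {α : EuclideanSpace ℝ (Fin 7) [⋀^Fin 3]→L[ℝ] ℝ}
    {A : EuclideanSpace ℝ (Fin 7) ≃ₗ[ℝ] EuclideanSpace ℝ (Fin 7)} (h : IsPullbackPhi0 α A)
    {u : EuclideanSpace ℝ (Fin 7)} (hu : u ≠ 0) :
    (contrMatrix α u + vecMulVec u u).det ^ 2 =
      (|(matrixOf A).det| * (u ⬝ᵥ u) * (A u ⬝ᵥ A u)) ^ 4 := by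
  set μ : EuclideanSpace ℝ (Fin 7) := WithLp.toLp 2 (u.ofLp ᵥ* matrixOf A.symm) with hμ
  have e1 : μ ᵥ* matrixOf A = u := by
    rw [hμ, vecMul_vecMul, matrixOf_symm_mul, vecMul_one]
  have e2 : μ ⬝ᵥ A u = u ⬝ᵥ u := by
    rw [← matrixOf_mulVec, dotProduct_mulVec, e1]
  have h0 : u ⬝ᵥ u ≠ 0 := by
    simpa [dotProduct_self_eq_zero] using hu
  have e3 : contrMatrix α u + vecMulVec u u =
      (matrixOf A)ᵀ * (contr0 (A u) + vecMulVec μ μ) * matrixOf A := by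
    rw [h.contrMatrix_eq, Matrix.mul_add, Matrix.add_mul, mul_vecMulVec, vecMulVec_mul,
      mulVec_transpose, e1]
  rw [e3, det_mul, det_mul, det_transpose, mul_pow, mul_pow, det_contr0_add_sq _ _
    (by simpa using hu) (by rwa [e2]), e2, mul_pow, mul_pow, Even.pow_abs (by decide)]
  ring

/-- The base of the fourth power in `IsPullbackPhi0.det_sq` is nonnegative, so the real fourth root
recovers it. -/
theorem IsPullbackPhi0.densityNormSq_eq {α : EuclideanSpace ℝ (Fin 7) [⋀^Fin 3]→L[ℝ] ℝ}
    {A : EuclideanSpace ℝ (Fin 7) ≃ₗ[ℝ] EuclideanSpace ℝ (Fin 7)} (h : IsPullbackPhi0 α A)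
    {u : EuclideanSpace ℝ (Fin 7)} (hu : u ≠ 0) :
    densityNormSq α u = |(matrixOf A).det| * (A u ⬝ᵥ A u) := by
  have h0 : u ⬝ᵥ u ≠ 0 := by
    simpa [dotProduct_self_eq_zero] using hu
  have h1 : 0 ≤ u ⬝ᵥ u := Finset.sum_nonneg fun i _ => mul_self_nonneg _
  have h2 : 0 ≤ A u ⬝ᵥ A u := Finset.sum_nonneg fun i _ => mul_self_nonneg _
  rw [densityNormSq, h.det_sq hu, ← Real.rpow_natCast, ← Real.rpow_mul (by positivity)]
  norm_num
  field_simp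

theorem single_add_single_ne_zero (i j : Fin 7) :
    EuclideanSpace.single i (1 : ℝ) + EuclideanSpace.single j (1 : ℝ) ≠ 0 := fun hij => by
  have := congrArg (fun v : EuclideanSpace ℝ (Fin 7) => v i) hij
  simp only [PiLp.add_apply, PiLp.single_apply, PiLp.zero_apply] at this
  split_ifs at this <;> norm_num at this

/-- Polarization of `densityNormSq` on the standard basis. -/
noncomputable def densityGram (α : EuclideanSpace ℝ (Fin 7) [⋀^Fin 3]→L[ℝ] ℝ) :
    Matrix (Fin 7) (Fin 7) ℝ :=
  Matrix.of fun i j =>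
    (densityNormSq α (EuclideanSpace.single i 1 + EuclideanSpace.single j 1)
      - densityNormSq α (EuclideanSpace.single i 1) - densityNormSq α (EuclideanSpace.single j 1)) / 2

theorem IsPullbackPhi0.densityGram_eq {α : EuclideanSpace ℝ (Fin 7) [⋀^Fin 3]→L[ℝ] ℝ}
    {A : EuclideanSpace ℝ (Fin 7) ≃ₗ[ℝ] EuclideanSpace ℝ (Fin 7)} (h : IsPullbackPhi0 α A) :
    densityGram α = |(matrixOf A).det| • ((matrixOf A)ᵀ * matrixOf A) := by
  have hs : ∀ i : Fin 7, EuclideanSpace.single i (1 : ℝ) ≠ 0 := fun i => by simp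
  have ha := single_add_single_ne_zero
  ext i j
  rw [densityGram, of_apply, h.densityNormSq_eq (ha i j), h.densityNormSq_eq (hs i),
    h.densityNormSq_eq (hs j), map_add, WithLp.ofLp_add, add_dotProduct, dotProduct_add,
    dotProduct_add, dotProduct_comm (A (EuclideanSpace.single j 1)).ofLp
      (A (EuclideanSpace.single i 1)).ofLp, Matrix.smul_apply, Matrix.mul_apply']
  change _ = |(matrixOf A).det| *
    ((A (EuclideanSpace.single i 1)).ofLp ⬝ᵥ (A (EuclideanSpace.single j 1)).ofLp)
  ring

/-- The Gram matrix of the inner product determined by `α`. -/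
noncomputable def gramOf (α : EuclideanSpace ℝ (Fin 7) [⋀^Fin 3]→L[ℝ] ℝ) :
    Matrix (Fin 7) (Fin 7) ℝ :=
  ((densityGram α).det ^ (1 / 9 : ℝ))⁻¹ • densityGram α

/-- Seven factors come from the scalar and two from `Aᵀ A`. This explains the ninth root in
`gramOf`, which removes the unknown density `|det A|`. -/
theorem IsPullbackPhi0.det_densityGram {α : EuclideanSpace ℝ (Fin 7) [⋀^Fin 3]→L[ℝ] ℝ}
    {A : EuclideanSpace ℝ (Fin 7) ≃ₗ[ℝ] EuclideanSpace ℝ (Fin 7)} (h : IsPullbackPhi0 α A) :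
    (densityGram α).det = |(matrixOf A).det| ^ 9 := by
  rw [h.densityGram_eq, det_smul, det_mul, det_transpose, ← abs_mul_abs_self (matrixOf A).det]
  simp only [Fintype.card_fin]
  ring

theorem IsPullbackPhi0.gramOf_eq {α : EuclideanSpace ℝ (Fin 7) [⋀^Fin 3]→L[ℝ] ℝ}
    {A : EuclideanSpace ℝ (Fin 7) ≃ₗ[ℝ] EuclideanSpace ℝ (Fin 7)} (h : IsPullbackPhi0 α A) :
    gramOf α = (matrixOf A)ᵀ * matrixOf A := by
  have h0 : 0 < |(matrixOf A).det| := abs_pos.mpr (det_matrixOf_ne_zero A)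
  rw [gramOf, h.det_densityGram, ← Real.rpow_natCast, ← Real.rpow_mul h0.le, h.densityGram_eq,
    smul_smul]
  norm_num [h0.ne']

/-- The inner product determined by `α`. -/
noncomputable def formMetric (α : EuclideanSpace ℝ (Fin 7) [⋀^Fin 3]→L[ℝ] ℝ)
    (u v : EuclideanSpace ℝ (Fin 7)) : ℝ :=
  u ⬝ᵥ gramOf α *ᵥ v

theorem IsPullbackPhi0.formMetric_eq {α : EuclideanSpace ℝ (Fin 7) [⋀^Fin 3]→L[ℝ] ℝ}
    {A : EuclideanSpace ℝ (Fin 7) ≃ₗ[ℝ] EuclideanSpace ℝ (Fin 7)} (h : IsPullbackPhi0 α A)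
    (u v : EuclideanSpace ℝ (Fin 7)) : formMetric α u v = inner ℝ (A u) (A v) := by
  rw [formMetric, h.gramOf_eq, ← mulVec_mulVec, dotProduct_mulVec, vecMul_transpose,
    matrixOf_mulVec, matrixOf_mulVec, PiLp.inner_apply]
  simp [dotProduct, mul_comm]

theorem ContDiffAt.matrix_det {E : Type*} [NormedAddCommGroup E] [NormedSpace ℝ E] {n : ℕ}
    {k : WithTop ℕ∞} {f : E → Matrix (Fin n) (Fin n) ℝ} {x : E}
    (hf : ∀ i j, ContDiffAt ℝ k (fun y => f y i j) x) : ContDiffAt ℝ k (fun y => (f y).det) x := by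
  simp only [Matrix.det_apply']
  exact ContDiffAt.sum fun σ _ => contDiffAt_const.mul (contDiffAt_prod fun i _ => hf _ _)

theorem contDiff_alternating_apply {E F : Type*} [NormedAddCommGroup E] [NormedSpace ℝ E]
    [NormedAddCommGroup F] [NormedSpace ℝ F] {n : ℕ} {k : WithTop ℕ∞} (v : Fin n → E) :
    ContDiff ℝ k (fun α : E [⋀^Fin n]→L[ℝ] F => α v) :=
  (ContinuousAlternatingMap.apply ℝ E F v).contDiff

theorem IsPullbackPhi0.contDiffAt_densityNormSq {α : EuclideanSpace ℝ (Fin 7) [⋀^Fin 3]→L[ℝ] ℝ}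
    {A : EuclideanSpace ℝ (Fin 7) ≃ₗ[ℝ] EuclideanSpace ℝ (Fin 7)} (h : IsPullbackPhi0 α A)
    {u : EuclideanSpace ℝ (Fin 7)} (hu : u ≠ 0) :
    ContDiffAt ℝ ∞ (fun α => densityNormSq α u) α := by
  have h0 : u ⬝ᵥ u ≠ 0 := by
    simpa [dotProduct_self_eq_zero] using hu
  have h1 : A u ⬝ᵥ A u ≠ 0 := by
    simpa [dotProduct_self_eq_zero] using hu
  refine ContDiffAt.div_const (ContDiffAt.rpow_const_of_ne (ContDiffAt.pow
    (ContDiffAt.matrix_det fun i j => ?_) 2) ?_) _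
  · exact (contDiff_alternating_apply _).contDiffAt.add contDiffAt_const
  · rw [h.det_sq hu]
    exact pow_ne_zero _ (mul_ne_zero (mul_ne_zero (abs_ne_zero.mpr (det_matrixOf_ne_zero A)) h0) h1)

/-- The roots are taken of quantities that do not vanish at a form equivalent to `φ₀`. Hence the
metric varies smoothly with the form, however irregularly the isomorphisms `A` are chosen. -/
theorem IsPullbackPhi0.contDiffAt_gramOf {α : EuclideanSpace ℝ (Fin 7) [⋀^Fin 3]→L[ℝ] ℝ}
    {A : EuclideanSpace ℝ (Fin 7) ≃ₗ[ℝ] EuclideanSpace ℝ (Fin 7)} (h : IsPullbackPhi0 α A)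
    (i j : Fin 7) : ContDiffAt ℝ ∞ (fun α => gramOf α i j) α := by
  have hs : ∀ i : Fin 7, EuclideanSpace.single i (1 : ℝ) ≠ 0 := fun i => by simp
  have ha := single_add_single_ne_zero
  have hd : ∀ i j, ContDiffAt ℝ ∞ (fun α => densityGram α i j) α := fun i j =>
    (((h.contDiffAt_densityNormSq (ha i j)).sub (h.contDiffAt_densityNormSq (hs i))).sub
      (h.contDiffAt_densityNormSq (hs j))).div_const 2
  have h0 : 0 < (densityGram α).det := by
    rw [h.det_densityGram]
    exact pow_pos (abs_pos.mpr (det_matrixOf_ne_zero A)) _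
  have h1 := (ContDiffAt.matrix_det hd).rpow_const_of_ne (p := (1 / 9 : ℝ)) h0.ne'
  exact (h1.inv (Real.rpow_pos_of_pos h0 _).ne').mul (hd i j)

end MetricOfForm

/-! Smooth families of alternating forms. -/

section Calculus

variable {E F X : Type*} [NormedAddCommGroup E] [NormedSpace ℝ E] [NormedAddCommGroup F]
  [NormedSpace ℝ F] [NormedAddCommGroup X] [NormedSpace ℝ X]

theorem ContDiffAt.alternating_curryLeft {n : ℕ} {k : WithTop ℕ∞}
    {α : X → E [⋀^Fin (n + 1)]→L[ℝ] ℝ} {v : X → E} {x : X} (hα : ContDiffAt ℝ k α x)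
    (hv : ContDiffAt ℝ k v x) : ContDiffAt ℝ k (fun y => (α y).curryLeft (v y)) x := by
  have h : ContDiff ℝ k (fun α : E [⋀^Fin (n + 1)]→L[ℝ] ℝ => α.curryLeft) :=
    (IsLinearMap.with_bound ⟨ContinuousAlternatingMap.curryLeft_add,
      ContinuousAlternatingMap.curryLeft_smul⟩ 1 fun α => by
        rw [one_mul]
        exact (ContinuousAlternatingMap.norm_curryLeft α).le).contDiff
  exact ContDiffAt.clm_apply (f := fun y => (α y).curryLeft) (h.contDiffAt.comp x hα) hv

/-- Induction on the degree, feeding in the first vector by currying. -/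
theorem ContDiffAt.alternating_apply {n : ℕ} {k : WithTop ℕ∞}
    {α : X → E [⋀^Fin n]→L[ℝ] ℝ} {v : Fin n → X → E} {x : X} (hα : ContDiffAt ℝ k α x)
    (hv : ∀ i, ContDiffAt ℝ k (v i) x) : ContDiffAt ℝ k (fun y => α y fun i => v i y) x := by
  induction n with
  | zero =>
    have e : ∀ y, (fun i => v i y) = (![] : Fin 0 → E) := fun y => Subsingleton.elim _ _
    simp only [e]
    exact (contDiff_alternating_apply _).contDiffAt.comp x hα
  | succ n ih =>
    have := ih (hα.alternating_curryLeft (hv 0)) fun i => hv i.succ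
    refine this.congr_of_eventuallyEq (.of_forall fun y => ?_)
    simp only [ContinuousAlternatingMap.curryLeft_apply_apply]
    congr 1
    ext i
    refine Fin.cases ?_ (fun j => ?_) i <;> simp

/-- A family of alternating forms on a finite-dimensional space is smooth if its values on all
tuples of vectors are. -/
theorem contDiffAt_alternating_of_apply [FiniteDimensional ℝ E] {n : ℕ} {k : WithTop ℕ∞}
    {α : X → E [⋀^Fin n]→L[ℝ] ℝ} {x : X} (h : ∀ v, ContDiffAt ℝ k (fun y => α y v) x) :
    ContDiffAt ℝ k α x := by
  let b := Module.finBasis ℝ E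
  let T : (E [⋀^Fin n]→L[ℝ] ℝ) →ₗ[ℝ] ((Fin n → Fin (Module.finrank ℝ E)) → ℝ) :=
    { toFun := fun α s => α fun i => b (s i)
      map_add' := fun _ _ => rfl
      map_smul' := fun _ _ => rfl }
  have hT : LinearMap.ker T = ⊥ := by
    rw [LinearMap.ker_eq_bot']
    intro m hm
    apply ContinuousAlternatingMap.toAlternatingMap_injective
    refine b.ext_alternating fun s _ => ?_
    exact congrFun hm s
  -- The values on basis tuples determine the form, and the reconstruction `S` is continuous because
  -- its domain is finite-dimensional.
  obtain ⟨S, hS⟩ := T.exists_leftInverse_of_injective hT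
  have e : α = fun y => S.toContinuousLinearMap (T (α y)) := by
    funext y
    exact (LinearMap.congr_fun hS (α y)).symm
  rw [e]
  refine S.toContinuousLinearMap.contDiff.contDiffAt.comp x (contDiffAt_pi.mpr fun s => h _)

theorem ContDiffAt.alternating_comp [FiniteDimensional ℝ E] {n : ℕ} {k : WithTop ℕ∞}
    {α : X → F [⋀^Fin n]→L[ℝ] ℝ} {A : X → E →L[ℝ] F} {x : X} (hα : ContDiffAt ℝ k α x)
    (hA : ContDiffAt ℝ k A x) :
    ContDiffAt ℝ k (fun y => (α y).compContinuousLinearMap (A y)) x :=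
  contDiffAt_alternating_of_apply fun _ =>
    hα.alternating_apply fun _ => hA.clm_apply contDiffAt_const

theorem ContDiffAt.extDeriv {n : ℕ} {α : E → E [⋀^Fin n]→L[ℝ] ℝ} {x : E}
    (hα : ContDiffAt ℝ ∞ α x) : ContDiffAt ℝ ∞ (extDeriv α) x :=
  (ContinuousAlternatingMap.alternatizeUncurryFinCLM ℝ E ℝ).contDiff.contDiffAt.comp x
    (hα.fderiv_right (by simp))

/-- Cartan's formula for a closed form and a one-parameter family of maps. -/
theorem hasDerivAt_pullback_of_extDeriv_eq_zero [FiniteDimensional ℝ E] {n : ℕ}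
    {α : F → F [⋀^Fin (n + 1)]→L[ℝ] ℝ}
    {f : ℝ × E → F} {y : E} (hf : ContDiffAt ℝ ∞ f (0, y))
    (hα : ContDiffAt ℝ ∞ α (f (0, y))) (hd : _root_.extDeriv α (f (0, y)) = 0)
    (a : Fin (n + 1) → E) :
    HasDerivAt (fun t : ℝ => α (f (t, y)) fun i => fderiv ℝ f (t, y) (0, a i))
      (_root_.extDeriv (fun x => ((α (f (0, x))).curryLeft (fderiv ℝ f (0, x) (1, 0))
        ).compContinuousLinearMap ((fderiv ℝ f (0, x)).comp (.inr ℝ ℝ E))) y a) 0 := by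
  -- `β` is `f^*α` on `ℝ × E`, and `η` is its contraction with `∂_t` restricted to the slice `t =
  -- 0`. The formula is read off from `dβ = 0` at `(0, y)`.
  set β : ℝ × E → (ℝ × E) [⋀^Fin (n + 1)]→L[ℝ] ℝ :=
    fun p => (α (f p)).compContinuousLinearMap (fderiv ℝ f p) with hβ
  set η : E → E [⋀^Fin n]→L[ℝ] ℝ := fun x => ((α (f (0, x))).curryLeft (fderiv ℝ f (0, x) (1, 0))
        ).compContinuousLinearMap ((fderiv ℝ f (0, x)).comp (.inr ℝ ℝ E)) with hη
  have hdf : ContDiffAt ℝ ∞ (fderiv ℝ f) (0, y) := hf.fderiv_right (by simp)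
  have hβd : DifferentiableAt ℝ β (0, y) :=
    ((hα.comp (0, y) hf).alternating_comp hdf).differentiableAt (by simp)
  have hβ0 : _root_.extDeriv β (0, y) = 0 := by
    rw [hβ, extDeriv_pullback (hα.differentiableAt (by simp)) hf
      (r := ∞) (by simpa using WithTop.coe_le_coe.mpr (le_top : (2 : ℕ∞) ≤ ⊤)), hd]
    ext; simp
  have hηβ : ∀ x m, η x m = β (0, x) (Fin.cons (1, 0) fun i => (0, m i)) := by
    intro x m
    simp only [hη, hβ, ContinuousAlternatingMap.compContinuousLinearMap_apply]
    change α _ _ = α _ _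
    congr 1
    ext i
    refine Fin.cases ?_ (fun j => ?_) i <;> simp
  have hi : HasFDerivAt (fun x : E => ((0 : ℝ), x)) (ContinuousLinearMap.inr ℝ ℝ E) y :=
    hasFDerivAt_prodMk_right 0 y
  have hηd : DifferentiableAt ℝ η y := by
    have h1 : ContDiffAt ℝ ∞ (fun x : E => ((0 : ℝ), x)) y := contDiffAt_const.prodMk contDiffAt_id
    have h2 : ContDiffAt ℝ ∞ (fun x : E => fderiv ℝ f (0, x)) y := ContDiffAt.comp y hdf h1
    exact ((ContDiffAt.alternating_curryLeft (ContDiffAt.comp y (hα.comp (0, y) hf) h1)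
      (h2.clm_apply contDiffAt_const)).alternating_comp
      (h2.clm_comp contDiffAt_const)).differentiableAt (by simp)
  have hβm : ∀ m, HasFDerivAt (fun p => β p m) (fderiv ℝ (fun p => β p m) (0, y)) (0, y) :=
    fun m => (((ContinuousAlternatingMap.apply ℝ (ℝ × E) ℝ m).differentiableAt).comp _
      hβd).hasFDerivAt
  -- In `dβ(∂_t, a₀, …, aₙ)` the term omitting `∂_t` is the time derivative. The others add up to
  -- `-dη(a)`, the sign coming from the shift of indices by one.
  have key := congrArg (fun q => q (Fin.cons (1, 0) fun i => (0, a i))) hβ0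
  simp only [extDeriv_apply hβd, Fin.sum_univ_succ (n := n + 1), Fin.cons_zero, Fin.cons_succ] at key
  change _ = (0 : ℝ) at key
  have ht : HasDerivAt (fun t : ℝ => β (t, y) fun i => (0, a i))
      (fderiv ℝ (fun p => β p fun i => (0, a i)) (0, y) (1, 0)) 0 := by
    have h1 : HasDerivAt (fun t : ℝ => (t, y)) ((1 : ℝ), (0 : E)) 0 :=
      (hasDerivAt_id _).prodMk (hasDerivAt_const _ _)
    exact HasFDerivAt.comp_hasDerivAt (0 : ℝ) (hβm _) h1
  change HasDerivAt (fun t : ℝ => β (t, y) fun i => (0, a i)) _ 0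
  convert ht using 1
  rw [extDeriv_apply hηd]
  have hterm : ∀ i : Fin (n + 1), fderiv ℝ (fun x => η x (i.removeNth a)) y (a i) =
      fderiv ℝ (fun p => β p (i.succ.removeNth
        (Fin.cons (1, 0) fun i => (0, a i) : Fin (n + 2) → ℝ × E))) (0, y) (0, a i) := by
    intro i
    have e : (i.succ.removeNth (Fin.cons (1, 0) fun i => (0, a i) : Fin (n + 2) → ℝ × E)) =
        Fin.cons (1, 0) fun j => (0, i.removeNth a j) := by
      ext j <;> refine Fin.cases ?_ (fun j => ?_) j <;> simp [Fin.removeNth]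
    rw [e]
    have h1 := (HasFDerivAt.comp (x := y) (hβm (Fin.cons (1, 0) fun j => (0, i.removeNth a j))) hi)
    simp only [hηβ]
    have h2 := h1.fderiv
    change fderiv ℝ (fun x => β (0, x) _) y = _ at h2
    rw [h2]
    simp
  simp only [hterm]
  simp only [Fin.val_zero, pow_zero, one_smul, Fin.val_succ, pow_succ, mul_neg, mul_one, neg_smul,
    Finset.sum_neg_distrib] at key
  have e0 : (Fin.removeNth 0 (Fin.cons (1, 0) fun i => (0, a i) : Fin (n + 2) → ℝ × E)) =
      fun i => (0, a i) := by
    ext j <;> simp [Fin.removeNth]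
  rw [e0] at key
  linarith

end Calculus

/-! Forms and maps in charts; the exterior derivative on a manifold. -/

section Charts

variable {n m k : ℕ} {M : Type*} [TopologicalSpace M] [ChartedSpace (EuclideanSpace ℝ (Fin n)) M]
  {N : Type*} [TopologicalSpace N] [ChartedSpace (EuclideanSpace ℝ (Fin m)) N]

/-- Every tangent space is the model space by definition, so values at equal points can be compared
without transport. -/
theorem FormField.congr_point (θ : FormField n M k) {p q : M} (h : p = q)
    (v : Fin k → EuclideanSpace ℝ (Fin n)) :
    (θ p : EuclideanSpace ℝ (Fin n) [⋀^Fin k]→L[ℝ] ℝ) v =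
      (θ q : EuclideanSpace ℝ (Fin n) [⋀^Fin k]→L[ℝ] ℝ) v := by
  subst h; rfl

theorem mfderiv_chart_symm_mfderiv [IsManifold (𝓡 n) ∞ M]
    {e : OpenPartialHomeomorph M (EuclideanSpace ℝ (Fin n))}
    (he : e ∈ atlas (EuclideanSpace ℝ (Fin n)) M) {p : M} (hp : p ∈ e.source)
    (v : TangentSpace (𝓡 n) p) :
    mfderiv (𝓡 n) (𝓡 n) e.symm (e p) (mfderiv (𝓡 n) (𝓡 n) e p v) = v := by
  have : IsManifold (𝓡 n) 1 M := IsManifold.of_le (n := ∞) (by simp)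
  exact DFunLike.congr_fun ((mdifferentiable_of_mem_atlas (I := 𝓡 n) he).symm_comp_deriv hp) v

theorem FormField.inChart_mfderiv [IsManifold (𝓡 n) ∞ M] (θ : FormField n M k)
    {e : OpenPartialHomeomorph M (EuclideanSpace ℝ (Fin n))}
    (he : e ∈ atlas (EuclideanSpace ℝ (Fin n)) M) {p : M} (hp : p ∈ e.source)
    (v : Fin k → TangentSpace (𝓡 n) p) :
    θ.inChart e (e p) (fun i => mfderiv (𝓡 n) (𝓡 n) e p (v i)) = θ p v := by
  have h : (fun i => mfderiv (𝓡 n) (𝓡 n) e.symm (e p) (mfderiv (𝓡 n) (𝓡 n) e p (v i))) = v :=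
    funext fun i => mfderiv_chart_symm_mfderiv he hp (v i)
  change θ (e.symm (e p)) (fun i => mfderiv (𝓡 n) (𝓡 n) e.symm (e p)
    (mfderiv (𝓡 n) (𝓡 n) e p (v i))) = _
  exact (congrArg (fun w => θ (e.symm (e p)) w) h).trans
    (θ.congr_point (e.left_inv hp) v)

theorem contDiffAt_chart_comp [IsManifold (𝓡 n) ∞ M] [IsManifold (𝓡 m) ∞ N] {h : M → N}
    {c : OpenPartialHomeomorph M (EuclideanSpace ℝ (Fin n))}
    (hc : c ∈ atlas (EuclideanSpace ℝ (Fin n)) M)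
    {e : OpenPartialHomeomorph N (EuclideanSpace ℝ (Fin m))}
    (he : e ∈ atlas (EuclideanSpace ℝ (Fin m)) N) {y : EuclideanSpace ℝ (Fin n)}
    (hy : y ∈ c.target) (hh : ContMDiffAt (𝓡 n) (𝓡 m) ∞ h (c.symm y))
    (hs : h (c.symm y) ∈ e.source) :
    ContDiffAt ℝ ∞ (fun z => e (h (c.symm z))) y := by
  rw [← contMDiffAt_iff_contDiffAt]
  have h1 : ContMDiffAt (𝓡 n) (𝓡 n) ∞ c.symm y :=
    (contMDiffOn_symm_of_mem_maximalAtlas (IsManifold.subset_maximalAtlas hc)).contMDiffAt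
      (c.open_target.mem_nhds hy)
  have h2 : ContMDiffAt (𝓡 m) (𝓡 m) ∞ e (h (c.symm y)) :=
    (contMDiffOn_of_mem_maximalAtlas (IsManifold.subset_maximalAtlas he)).contMDiffAt
      (e.open_source.mem_nhds hs)
  exact h2.comp y (hh.comp y h1)

theorem fderiv_chart_comp [IsManifold (𝓡 n) ∞ M] [IsManifold (𝓡 m) ∞ N] {h : M → N}
    {c : OpenPartialHomeomorph M (EuclideanSpace ℝ (Fin n))}
    (hc : c ∈ atlas (EuclideanSpace ℝ (Fin n)) M)
    {e : OpenPartialHomeomorph N (EuclideanSpace ℝ (Fin m))}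
    (he : e ∈ atlas (EuclideanSpace ℝ (Fin m)) N) {y : EuclideanSpace ℝ (Fin n)}
    (hy : y ∈ c.target) (hh : MDifferentiableAt (𝓡 n) (𝓡 m) h (c.symm y))
    (hs : h (c.symm y) ∈ e.source) (v : EuclideanSpace ℝ (Fin n)) :
    fderiv ℝ (fun z => e (h (c.symm z))) y v =
      mfderiv (𝓡 m) (𝓡 m) e (h (c.symm y)) (mfderiv (𝓡 n) (𝓡 m) h (c.symm y)
        (mfderiv (𝓡 n) (𝓡 n) c.symm y v)) := by
  have : IsManifold (𝓡 n) 1 M := IsManifold.of_le (n := ∞) (by simp)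
  have : IsManifold (𝓡 m) 1 N := IsManifold.of_le (n := ∞) (by simp)
  have h1 : MDifferentiableAt (𝓡 n) (𝓡 n) c.symm y := mdifferentiableAt_atlas_symm hc hy
  have h2 : MDifferentiableAt (𝓡 m) (𝓡 m) e (h (c.symm y)) := mdifferentiableAt_atlas he hs
  have h3 := (h2.hasMFDerivAt.comp y (hh.hasMFDerivAt.comp y h1.hasMFDerivAt)).mfderiv
  rw [← mfderiv_eq_fderiv]
  exact DFunLike.congr_fun h3 v

theorem FormField.inChart_eq_comp [IsManifold (𝓡 n) ∞ M] (θ : FormField n M k)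
    {c e : OpenPartialHomeomorph M (EuclideanSpace ℝ (Fin n))}
    (hc : c ∈ atlas (EuclideanSpace ℝ (Fin n)) M) (he : e ∈ atlas (EuclideanSpace ℝ (Fin n)) M)
    {y : EuclideanSpace ℝ (Fin n)} (hy : y ∈ c.target) (hs : c.symm y ∈ e.source) :
    θ.inChart c y = (θ.inChart e (e (c.symm y))).compContinuousLinearMap
      (fderiv ℝ (fun z => e (c.symm z)) y) := by
  ext v
  have h := θ.inChart_mfderiv he hs fun i => mfderiv (𝓡 n) (𝓡 n) c.symm y (v i)
  refine h.symm.trans (congrArg (θ.inChart e (e (c.symm y))) (funext fun i => ?_))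
  have h2 := fderiv_chart_comp (h := id) hc he hy mdifferentiableAt_id hs (v i)
  rw [mfderiv_id] at h2
  exact h2.symm

/-- The exterior derivative of a form on a manifold, computed at each point in the preferred
chart. -/
noncomputable def FormField.exteriorDeriv (θ : FormField n M k) : FormField n M (k + 1) := fun x =>
  (extDeriv (θ.inChart (chartAt _ x)) (chartAt (EuclideanSpace ℝ (Fin n)) x x)
    ).compContinuousLinearMap (mfderiv (𝓡 n) (𝓡 n) (chartAt (EuclideanSpace ℝ (Fin n)) x) x)

/-- Naturality of `d` under the transition map to the preferred chart at each point: the choice of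
chart in the definition does not matter. -/
theorem FormField.inChart_exteriorDeriv [IsManifold (𝓡 n) ∞ M] {θ : FormField n M k}
    (hθ : θ.IsSmooth) {c : OpenPartialHomeomorph M (EuclideanSpace ℝ (Fin n))}
    (hc : c ∈ atlas (EuclideanSpace ℝ (Fin n)) M) {y : EuclideanSpace ℝ (Fin n)}
    (hy : y ∈ c.target) : θ.exteriorDeriv.inChart c y = extDeriv (θ.inChart c) y := by
  set x := c.symm y with hx
  set e := chartAt (EuclideanSpace ℝ (Fin n)) x with he
  have hea : e ∈ atlas (EuclideanSpace ℝ (Fin n)) M := chart_mem_atlas _ _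
  have hxs : x ∈ e.source := mem_chart_source _ _
  have h1 : θ.inChart c =ᶠ[nhds y] fun z => (θ.inChart e (e (c.symm z))).compContinuousLinearMap
      (fderiv ℝ (fun z => e (c.symm z)) z) := by
    filter_upwards [c.open_target.mem_nhds hy,
      (c.continuousAt_symm hy).preimage_mem_nhds (e.open_source.mem_nhds hxs)] with z hz hz'
    exact θ.inChart_eq_comp hc hea hz hz'
  have h2 : ContDiffAt ℝ ∞ (θ.inChart e) (e x) :=
    (hθ e hea).contDiffAt (e.open_target.mem_nhds (e.map_source hxs))
  have h3 : ContDiffAt ℝ ∞ (fun z => e (c.symm z)) y :=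
    contDiffAt_chart_comp (h := id) hc hea hy contMDiffAt_id hxs
  rw [h1.extDeriv_eq, extDeriv_pullback (f := fun z => e (c.symm z))
    (show DifferentiableAt ℝ (θ.inChart e) (e (c.symm y)) from h2.differentiableAt (by simp)) h3
    (r := ∞) (by simpa using WithTop.coe_le_coe.mpr (le_top : (2 : ℕ∞) ≤ ⊤))]
  ext v
  refine congrArg (extDeriv (θ.inChart e) (e x)) (funext fun i => ?_)
  have h4 := fderiv_chart_comp (h := id) hc hea hy mdifferentiableAt_id hxs (v i)
  rw [mfderiv_id] at h4
  exact h4.symm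

theorem FormField.IsSmooth.exteriorDeriv [IsManifold (𝓡 n) ∞ M] {θ : FormField n M k}
    (hθ : θ.IsSmooth) : θ.exteriorDeriv.IsSmooth := fun e he => by
  intro y hy
  have h1 : θ.exteriorDeriv.inChart e =ᶠ[nhds y] extDeriv (θ.inChart e) := by
    filter_upwards [e.open_target.mem_nhds hy] with z hz using inChart_exteriorDeriv hθ he hz
  exact (((hθ e he).contDiffAt (e.open_target.mem_nhds hy)).extDeriv.congr_of_eventuallyEq
    h1).contDiffWithinAt

theorem FormField.exteriorDeriv_eq_zero_iff [IsManifold (𝓡 n) ∞ M] {θ : FormField n M k}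
    (hθ : θ.IsSmooth) : θ.exteriorDeriv = 0 ↔ θ.IsClosed := by
  refine ⟨fun h e he y hy => ?_, fun h => ?_⟩
  · rw [← inChart_exteriorDeriv hθ he hy, h, FormField.inChart_zero]; rfl
  · funext x
    have h1 := h _ (chart_mem_atlas _ x) _ (mem_chart_target (EuclideanSpace ℝ (Fin n)) x)
    rw [FormField.exteriorDeriv, h1]
    rfl

/-- The exterior derivative as a linear map on smooth forms. -/
noncomputable def exteriorDerivLinear (n : ℕ) (M : Type*) [TopologicalSpace M]
    [ChartedSpace (EuclideanSpace ℝ (Fin n)) M] [IsManifold (𝓡 n) ∞ M] (k : ℕ) :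
    smoothForms n M k →ₗ[ℝ] smoothForms n M (k + 1) where
  toFun θ := ⟨θ.1.exteriorDeriv, θ.2.exteriorDeriv⟩
  map_add' θ η := by
    ext x v
    have h (ζ : smoothForms n M k) : DifferentiableAt ℝ (ζ.1.inChart
        (chartAt (EuclideanSpace ℝ (Fin n)) x)) (chartAt (EuclideanSpace ℝ (Fin n)) x x) :=
      ((ζ.2 _ (chart_mem_atlas _ x)).differentiableOn (by simp)).differentiableAt
        ((chartAt _ x).open_target.mem_nhds (mem_chart_target (EuclideanSpace ℝ (Fin n)) x))
    change (θ.1 + η.1).exteriorDeriv x v = θ.1.exteriorDeriv x v + η.1.exteriorDeriv x v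
    simp only [FormField.exteriorDeriv]
    rw [FormField.inChart_add, extDeriv_add (h θ) (h η)]
    rfl
  map_smul' r θ := by
    ext x v
    change (r • θ.1).exteriorDeriv x v = r • θ.1.exteriorDeriv x v
    simp only [FormField.exteriorDeriv]
    rw [FormField.inChart_smul, extDeriv_smul]
    rfl

end Charts

/-! Vector fields along a map, contraction with the `3`-form, and the linearization. -/

/-- The coordinates in the chart `e` of a tangent vector at `p`. -/
noncomputable def coordVec {n : ℕ} {M : Type*} [TopologicalSpace M]
    [ChartedSpace (EuclideanSpace ℝ (Fin n)) M]
    (e : OpenPartialHomeomorph M (EuclideanSpace ℝ (Fin n))) (p : M) (v : TangentSpace (𝓡 n) p) :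
    EuclideanSpace ℝ (Fin n) :=
  mfderiv (𝓡 n) (𝓡 n) e p v

/-- The contraction of `α` with `v`, pulled back by `A`. -/
noncomputable def contractPullback {E F : Type*} [NormedAddCommGroup E] [NormedSpace ℝ E]
    [NormedAddCommGroup F] [NormedSpace ℝ F] {k : ℕ} (α : F [⋀^Fin (k + 1)]→L[ℝ] ℝ) (v : F)
    (A : E →L[ℝ] F) : E [⋀^Fin k]→L[ℝ] ℝ :=
  (α.curryLeft v).compContinuousLinearMap A

set_option linter.unusedSectionVars false

section Along

variable {M : Type*} [TopologicalSpace M] [ChartedSpace (EuclideanSpace ℝ (Fin 7)) M]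
  [IsManifold (𝓡 7) ∞ M] {L : Type*} [TopologicalSpace L]
  [ChartedSpace (EuclideanSpace ℝ (Fin 3)) L]

/-- The trivialization of the tangent bundle at `p` is the derivative of the chart at `p`, so
smoothness along `ι` can be tested on chart coordinates. -/
theorem contMDiffAt_along_iff {ι : L → M} {V : ∀ x : L, TangentSpace (𝓡 7) (ι x)} {x : L}
    (p : M) (hx : ι x ∈ (chartAt (EuclideanSpace ℝ (Fin 7)) p).source) :
    ContMDiffAt (𝓡 3) (𝓡 7).tangent ∞ (fun x => (⟨ι x, V x⟩ : TangentBundle (𝓡 7) M)) x ↔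
      ContMDiffAt (𝓡 3) (𝓡 7) ∞ ι x ∧ ContMDiffAt (𝓡 3) (𝓡 7) ∞ 
        (fun x => coordVec (chartAt (EuclideanSpace ℝ (Fin 7)) p) (ι x) (V x)) x := by
  have : IsManifold (𝓡 7) 1 M := IsManifold.of_le (n := ∞) (by simp)
  rw [(trivializationAt (EuclideanSpace ℝ (Fin 7)) (TangentSpace (𝓡 7) : M → Type _)
    p).contMDiffAt_iff (by simpa using hx)]
  refine and_congr_right fun h => Filter.EventuallyEq.contMDiffAt_iff ?_
  filter_upwards [h.continuousAt.preimage_mem_nhds ((chartAt _ p).open_source.mem_nhds hx)]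
    with z hz
  have h1 := TangentBundle.continuousLinearMapAt_trivializationAt (I := 𝓡 7) hz
  have h2 : ι z ∈ (trivializationAt (EuclideanSpace ℝ (Fin 7))
      (TangentSpace (𝓡 7) : M → Type _) p).baseSet := by simpa using hz
  have h3 := DFunLike.congr_fun h1 (V z)
  rw [Bundle.Trivialization.continuousLinearMapAt_apply, Bundle.Trivialization.linearMapAt_apply,
    if_pos h2] at h3
  exact h3

theorem fderiv_chart_comp_mfderiv {n m : ℕ} {M : Type*} [TopologicalSpace M]
    [ChartedSpace (EuclideanSpace ℝ (Fin n)) M]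
    {N : Type*} [TopologicalSpace N] [ChartedSpace (EuclideanSpace ℝ (Fin m)) N]
    [IsManifold (𝓡 n) ∞ M] [IsManifold (𝓡 m) ∞ N] {h : M → N}
    {c : OpenPartialHomeomorph M (EuclideanSpace ℝ (Fin n))}
    (hc : c ∈ atlas (EuclideanSpace ℝ (Fin n)) M)
    {e : OpenPartialHomeomorph N (EuclideanSpace ℝ (Fin m))}
    (he : e ∈ atlas (EuclideanSpace ℝ (Fin m)) N) {x : M}
    (hx : x ∈ c.source) (hh : MDifferentiableAt (𝓡 n) (𝓡 m) h x)
    (hs : h x ∈ e.source) (v : TangentSpace (𝓡 n) x) :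
    fderiv ℝ (fun z => e (h (c.symm z))) (c x) (mfderiv (𝓡 n) (𝓡 n) c x v) =
      mfderiv (𝓡 m) (𝓡 m) e (h x) (mfderiv (𝓡 n) (𝓡 m) h x v) := by
  have : IsManifold (𝓡 n) 1 M := IsManifold.of_le (n := ∞) (by simp)
  have : IsManifold (𝓡 m) 1 N := IsManifold.of_le (n := ∞) (by simp)
  have hxe : c.symm (c x) = x := c.left_inv hx
  have h0 : MDifferentiableAt (𝓡 n) (𝓡 n) c x := mdifferentiableAt_atlas hc hx
  have h1 : MDifferentiableAt (𝓡 n) (𝓡 n) c.symm (c x) :=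
    mdifferentiableAt_atlas_symm hc (c.map_source hx)
  have h2 : MDifferentiableAt (𝓡 m) (𝓡 m) e (h x) := mdifferentiableAt_atlas he hs
  have h3 : MDifferentiableAt (𝓡 n) (𝓡 m) (fun z => e (h (c.symm z))) (c x) :=
    MDifferentiableAt.comp (g := e) (c x) (by rw [hxe]; exact h2)
      (MDifferentiableAt.comp (g := h) (c x) (by rw [hxe]; exact hh) h1)
  have h4 := (h3.hasMFDerivAt.comp x h0.hasMFDerivAt).mfderiv
  have h5 := (h2.hasMFDerivAt.comp x hh.hasMFDerivAt).mfderiv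
  have h6 : ((fun z => e (h (c.symm z))) ∘ c) =ᶠ[nhds x] e ∘ h := by
    filter_upwards [c.open_source.mem_nhds hx] with z hz
    simp [c.left_inv hz]
  have h7 := h4.symm.trans (h6.mfderiv_eq.trans h5)
  rw [mfderiv_eq_fderiv] at h7
  exact DFunLike.congr_fun h7 v

/-- The `2`-form `(i_V φ)|_L`. -/
noncomputable def contractedForm (θ : FormField 7 M 3) (ι : L → M)
    (V : ∀ x : L, TangentSpace (𝓡 7) (ι x)) : FormField 3 L 2 := fun x =>
  contractPullback (E := EuclideanSpace ℝ (Fin 3)) (F := EuclideanSpace ℝ (Fin 7))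
    (θ (ι x)) (V x) (mfderiv (𝓡 3) (𝓡 7) ι x)

theorem contractedForm_apply (θ : FormField 7 M 3) (ι : L → M)
    (V : ∀ x : L, TangentSpace (𝓡 7) (ι x)) (x : L) (b c : TangentSpace (𝓡 3) x) :
    contractedForm θ ι V x ![b, c] =
      θ (ι x) ![V x, mfderiv (𝓡 3) (𝓡 7) ι x b, mfderiv (𝓡 3) (𝓡 7) ι x c] := by
  refine congrArg (θ (ι x)) (funext fun i => ?_)
  fin_cases i <;> rfl

theorem inChart_contractedForm [IsManifold (𝓡 3) ∞ L] (θ : FormField 7 M 3) {ι : L → M}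
    (V : ∀ x : L, TangentSpace (𝓡 7) (ι x))
    {c : OpenPartialHomeomorph L (EuclideanSpace ℝ (Fin 3))}
    (hc : c ∈ atlas (EuclideanSpace ℝ (Fin 3)) L)
    {e : OpenPartialHomeomorph M (EuclideanSpace ℝ (Fin 7))}
    (he : e ∈ atlas (EuclideanSpace ℝ (Fin 7)) M) {y : EuclideanSpace ℝ (Fin 3)}
    (hy : y ∈ c.target) (hι : MDifferentiableAt (𝓡 3) (𝓡 7) ι (c.symm y))
    (hs : ι (c.symm y) ∈ e.source) :
    (contractedForm θ ι V).inChart c y = contractPullback (θ.inChart e (e (ι (c.symm y))))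
      (coordVec e (ι (c.symm y)) (V (c.symm y))) (fderiv ℝ (fun z => e (ι (c.symm z))) y) := by
  ext w
  refine (θ.inChart_mfderiv he hs (Fin.cons (V (c.symm y)) fun i =>
    mfderiv (𝓡 3) (𝓡 7) ι (c.symm y) (mfderiv (𝓡 3) (𝓡 3) c.symm y (w i)))).symm.trans
    (congrArg (θ.inChart e (e (ι (c.symm y)))) (funext fun i => ?_))
  refine Fin.cases rfl (fun j => ?_) i
  exact (fderiv_chart_comp hc he hy hι hs (w j)).symm

theorem IsSmoothAlong.isSmooth_contractedForm [IsManifold (𝓡 3) ∞ L] {θ : FormField 7 M 3}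
    (hθ : θ.IsSmooth) {ι : L → M} {V : ∀ x : L, TangentSpace (𝓡 7) (ι x)}
    (hV : IsSmoothAlong ι V) : (contractedForm θ ι V).IsSmooth := by
  intro c hc y hy
  set p := ι (c.symm y)
  set e := chartAt (EuclideanSpace ℝ (Fin 7)) p
  have he : e ∈ atlas (EuclideanSpace ℝ (Fin 7)) M := chart_mem_atlas _ _
  have hp : p ∈ e.source := mem_chart_source _ _
  obtain ⟨h1, h2⟩ := (contMDiffAt_along_iff p hp).mp (hV (c.symm y))
  have hιs : ∀ z, ContMDiffAt (𝓡 3) (𝓡 7) ∞ ι z := fun z =>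
    ((contMDiffAt_along_iff (ι z) (mem_chart_source _ _)).mp (hV z)).1
  have hG := contDiffAt_chart_comp hc he hy h1 hp
  have hv : ContDiffAt ℝ ∞ (fun z => coordVec e (ι (c.symm z)) (V (c.symm z))) y := by
    rw [← contMDiffAt_iff_contDiffAt]
    exact h2.comp y ((contMDiffOn_symm_of_mem_maximalAtlas
      (IsManifold.subset_maximalAtlas hc)).contMDiffAt (c.open_target.mem_nhds hy))
  have hα : ContDiffAt ℝ ∞ (θ.inChart e) (e p) :=
    (hθ e he).contDiffAt (e.open_target.mem_nhds (e.map_source hp))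
  refine ContDiffAt.contDiffWithinAt ?_
  refine (((ContDiffAt.comp y hα hG).alternating_curryLeft hv).alternating_comp
    (hG.fderiv_right (m := ∞) (by simp))).congr_of_eventuallyEq ?_
  filter_upwards [c.open_target.mem_nhds hy, ((h1.continuousAt.comp (c.continuousAt_symm hy)
    ).preimage_mem_nhds (e.open_source.mem_nhds hp))] with z hz hz'
  exact inChart_contractedForm θ V hc he hz ((hιs _).mdifferentiableAt (by simp)) hz'

end Along

/-! ### Variation of the pulled-back form along a deformation -/

section Deformation

variable {M : Type*} [TopologicalSpace M] [ChartedSpace (EuclideanSpace ℝ (Fin 7)) M]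
  [IsManifold (𝓡 7) ∞ M] {L : Type*} [TopologicalSpace L]
  [ChartedSpace (EuclideanSpace ℝ (Fin 3)) L] [IsManifold (𝓡 3) ∞ L]

theorem IsDeformation.contMDiffAt {ι : L → M} {V : ∀ x : L, TangentSpace (𝓡 7) (ι x)}
    {f : ℝ → L → M} (hf : IsDeformation ι V f) : ∀ᶠ t in nhds (0 : ℝ), ∀ x,
      ContMDiffAt (𝓘(ℝ, ℝ).prod (𝓡 3)) (𝓡 7) ∞ (fun q : ℝ × L => f q.1 q.2) (t, x) := by
  obtain ⟨⟨ε, hε, h⟩, -⟩ := hf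
  filter_upwards [Ioo_mem_nhds (neg_lt_zero.mpr hε) hε] with t ht x
  exact h.contMDiffAt ((isOpen_Ioo.prod isOpen_univ).mem_nhds ⟨ht, trivial⟩)

theorem IsDeformation.eq_zero {ι : L → M} {V : ∀ x : L, TangentSpace (𝓡 7) (ι x)}
    {f : ℝ → L → M} (hf : IsDeformation ι V f) (x : L) : f 0 x = ι x :=
  congrArg Bundle.TotalSpace.proj (hf.2 x)

/-- Reading the equality in the tangent bundle through a chart avoids comparing vectors at `f 0 x`
and `ι x` directly. -/
theorem IsDeformation.coordVec_velocity {ι : L → M} {V : ∀ x : L, TangentSpace (𝓡 7) (ι x)}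
    {f : ℝ → L → M} (hf : IsDeformation ι V f) (x : L)
    (e : OpenPartialHomeomorph M (EuclideanSpace ℝ (Fin 7))) :
    coordVec e (f 0 x) (mfderiv 𝓘(ℝ, ℝ) (𝓡 7) (fun t => f t x) 0 (1 : ℝ)) =
      coordVec e (ι x) (V x) :=
  congrArg (fun p : TangentBundle (𝓡 7) M => coordVec e p.1 p.2) (hf.2 x)

theorem contDiffAt_family_in_charts {f : ℝ → L → M}
    {c : OpenPartialHomeomorph L (EuclideanSpace ℝ (Fin 3))}
    (hc : c ∈ atlas (EuclideanSpace ℝ (Fin 3)) L)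
    {e : OpenPartialHomeomorph M (EuclideanSpace ℝ (Fin 7))}
    (he : e ∈ atlas (EuclideanSpace ℝ (Fin 7)) M) {t : ℝ} {y : EuclideanSpace ℝ (Fin 3)}
    (hy : y ∈ c.target) (hs : f t (c.symm y) ∈ e.source)
    (hf : ContMDiffAt (𝓘(ℝ, ℝ).prod (𝓡 3)) (𝓡 7) ∞ (fun q : ℝ × L => f q.1 q.2)
      (t, c.symm y)) :
    ContDiffAt ℝ ∞ (fun q : ℝ × EuclideanSpace ℝ (Fin 3) => e (f q.1 (c.symm q.2))) (t, y) := by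
  rw [← contMDiffAt_iff_contDiffAt]
  have h1 : ContMDiffAt 𝓘(ℝ, ℝ × EuclideanSpace ℝ (Fin 3)) (𝓘(ℝ, ℝ).prod (𝓡 3)) ∞
      (fun q : ℝ × EuclideanSpace ℝ (Fin 3) => (q.1, c.symm q.2)) (t, y) := by
    refine ContMDiffAt.prodMk contDiffAt_fst.contMDiffAt ?_
    exact ContMDiffAt.comp (I' := 𝓡 3) (t, y)
      ((contMDiffOn_symm_of_mem_maximalAtlas (IsManifold.subset_maximalAtlas hc)).contMDiffAt
        (c.open_target.mem_nhds hy)) contDiffAt_snd.contMDiffAt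
  have h2 : ContMDiffAt (𝓡 7) (𝓡 7) ∞ e (f t (c.symm y)) :=
    (contMDiffOn_of_mem_maximalAtlas (IsManifold.subset_maximalAtlas he)).contMDiffAt
      (e.open_source.mem_nhds hs)
  exact ContMDiffAt.comp (t, y) h2 (hf.comp (t, y) h1)

theorem contMDiffAt_slice {f : ℝ → L → M} {t : ℝ} {x : L}
    (hf : ContMDiffAt (𝓘(ℝ, ℝ).prod (𝓡 3)) (𝓡 7) ∞ (fun q : ℝ × L => f q.1 q.2) (t, x)) :
    ContMDiffAt (𝓡 3) (𝓡 7) ∞ (f t) x :=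
  ContMDiffAt.comp (f := fun x : L => (t, x)) x hf (contMDiffAt_const.prodMk contMDiffAt_id)

theorem contMDiffAt_path {f : ℝ → L → M} {t : ℝ} {x : L}
    (hf : ContMDiffAt (𝓘(ℝ, ℝ).prod (𝓡 3)) (𝓡 7) ∞ (fun q : ℝ × L => f q.1 q.2) (t, x)) :
    ContMDiffAt 𝓘(ℝ, ℝ) (𝓡 7) ∞ (fun s => f s x) t :=
  ContMDiffAt.comp (f := fun s : ℝ => (s, x)) t hf (contMDiffAt_id.prodMk contMDiffAt_const)

theorem fderiv_chart_path {g : ℝ → M} {t : ℝ}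
    {e : OpenPartialHomeomorph M (EuclideanSpace ℝ (Fin 7))}
    (he : e ∈ atlas (EuclideanSpace ℝ (Fin 7)) M) (hg : MDifferentiableAt 𝓘(ℝ, ℝ) (𝓡 7) g t)
    (hs : g t ∈ e.source) : fderiv ℝ (fun s => e (g s)) t 1 =
      coordVec e (g t) (mfderiv 𝓘(ℝ, ℝ) (𝓡 7) g t (1 : ℝ)) := by
  have : IsManifold (𝓡 7) 1 M := IsManifold.of_le (n := ∞) (by simp)
  have h2 : MDifferentiableAt (𝓡 7) (𝓡 7) e (g t) := mdifferentiableAt_atlas he hs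
  have h3 := (h2.hasMFDerivAt.comp t hg.hasMFDerivAt).mfderiv
  rw [← mfderiv_eq_fderiv]
  exact DFunLike.congr_fun h3 (1 : ℝ)

/-- Cartan's formula `hasDerivAt_pullback_of_extDeriv_eq_zero` applied in the charts at `x` and `ι
x`. The result contains `f` only through `ι` and `V`, so it is the same for all deformations with
the same velocity. -/
theorem IsDeformation.hasDerivAt_pullbackApply {θ : FormField 7 M 3} (hθ : θ.IsSmooth)
    (hd : θ.IsClosed) {ι : L → M} {V : ∀ x : L, TangentSpace (𝓡 7) (ι x)}
    {f : ℝ → L → M} (hf : IsDeformation ι V f) (x : L) (a : Fin 3 → TangentSpace (𝓡 3) x) :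
    HasDerivAt (fun t : ℝ => pullbackApply θ (f t) x a)
      ((contractedForm θ ι V).exteriorDeriv x a) 0 := by
  have hf1 := hf.contMDiffAt
  have hf0 := hf1.self_of_nhds
  have hf00 := hf.eq_zero
  have hι : ∀ x, MDifferentiableAt (𝓡 3) (𝓡 7) ι x := fun x =>
    ((contMDiffAt_slice (hf0 x)).congr_of_eventuallyEq
      (.of_forall fun z => (hf00 z).symm)).mdifferentiableAt (by simp)
  set c := chartAt (EuclideanSpace ℝ (Fin 3)) x with hcdef
  have hc : c ∈ atlas (EuclideanSpace ℝ (Fin 3)) L := chart_mem_atlas _ _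
  have hxc : x ∈ c.source := mem_chart_source _ _
  set e := chartAt (EuclideanSpace ℝ (Fin 7)) (ι x)
  have he : e ∈ atlas (EuclideanSpace ℝ (Fin 7)) M := chart_mem_atlas _ _
  have hxe : ι x ∈ e.source := mem_chart_source _ _
  have hcx : c.symm (c x) = x := c.left_inv hxc
  have hct : c x ∈ c.target := c.map_source hxc
  set F : ℝ × EuclideanSpace ℝ (Fin 3) → EuclideanSpace ℝ (Fin 7) :=
    fun q => e (f q.1 (c.symm q.2)) with hF
  have hF0 : F (0, c x) = e (ι x) := by simp [hF, hcx, hf00]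
  have hFs : ∀ {t y}, y ∈ c.target → f t (c.symm y) ∈ e.source →
      ContMDiffAt (𝓘(ℝ, ℝ).prod (𝓡 3)) (𝓡 7) ∞ (fun q : ℝ × L => f q.1 q.2) (t, c.symm y) →
      ContDiffAt ℝ ∞ F (t, y) := fun h1 h2 h3 => contDiffAt_family_in_charts hc he h1 h2 h3
  have hFsnd : ∀ {t y}, ContDiffAt ℝ ∞ F (t, y) → ∀ w,
      fderiv ℝ F (t, y) (0, w) = fderiv ℝ (fun z => F (t, z)) y w := by
    intro t y h w
    have h1 := ((h.differentiableAt (by simp)).hasFDerivAt.comp y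
      (hasFDerivAt_prodMk_right t y)).fderiv
    exact (DFunLike.congr_fun h1 w).symm
  have hFfst : ∀ {t y}, ContDiffAt ℝ ∞ F (t, y) →
      fderiv ℝ F (t, y) (1, 0) = fderiv ℝ (fun s => F (s, y)) t 1 := by
    intro t y h
    have h0 : HasFDerivAt (fun s : ℝ => (s, y))
        (.inl ℝ ℝ (EuclideanSpace ℝ (Fin 3))) t := hasFDerivAt_prodMk_left t y
    have h1 := ((h.differentiableAt (by simp)).hasFDerivAt.comp t h0).fderiv
    exact (DFunLike.congr_fun h1 1).symm
  have hFd := hFs (t := 0) hct (by rw [hcx, hf00]; exact hxe) (hf0 _)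
  have hα : ContDiffAt ℝ ∞ (θ.inChart e) (F (0, c x)) := by
    rw [hF0]; exact (hθ e he).contDiffAt (e.open_target.mem_nhds (e.map_source hxe))
  have hdα : extDeriv (θ.inChart e) (F (0, c x)) = 0 := by
    rw [hF0]; exact hd e he _ (e.map_source hxe)
  have key := hasDerivAt_pullback_of_extDeriv_eq_zero hFd hα hdα
    (fun i => coordVec c x (a i))
  refine (key.congr_of_eventuallyEq ?_).congr_deriv ?_
  · have h1 : ∀ᶠ t in nhds (0 : ℝ), f t x ∈ e.source := by
      have h := (contMDiffAt_path (hf0 x)).continuousAt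
      refine h.preimage_mem_nhds (e.open_source.mem_nhds ?_)
      rw [hf00]; exact hxe
    filter_upwards [hf1, h1] with t ht h1
    have e1 : F (t, c x) = e (f t x) := by simp [hF, hcx]
    rw [e1]
    refine (θ.inChart_mfderiv he h1 _).symm.trans
      (congrArg (θ.inChart e (e (f t x))) (funext fun i => ?_))
    rw [hFsnd (hFs hct (by rwa [hcx]) (ht _))]
    exact (fderiv_chart_comp_mfderiv hc he hxc ((contMDiffAt_slice (ht x)).mdifferentiableAt
      (by simp)) h1 (a i)).symm
  -- Agreement at the point would not do: an exterior derivative is taken, so the two expressions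
  -- must coincide on a neighbourhood.
  · have h1 : (contractedForm θ ι V).inChart c =ᶠ[nhds (c x)] fun y =>
        ((θ.inChart e (F (0, y))).curryLeft (fderiv ℝ F (0, y) (1, 0))
        ).compContinuousLinearMap ((fderiv ℝ F (0, y)).comp
          (.inr ℝ ℝ (EuclideanSpace ℝ (Fin 3)))) := by
      have h2 : ∀ᶠ y in nhds (c x), ι (c.symm y) ∈ e.source := by
        refine ((hι _).continuousAt.comp (c.continuousAt_symm hct)).preimage_mem_nhds
          (e.open_source.mem_nhds ?_)
        simpa [hcx] using hxe
      filter_upwards [c.open_target.mem_nhds hct, h2] with y hy h2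
      have h3 : f 0 (c.symm y) ∈ e.source := by rwa [hf00]
      have h4 := hFs hy h3 (hf0 _)
      have h5 : (fun z => F (0, z)) = fun z => e (ι (c.symm z)) := by
        funext z; simp [hF, hf00]
      rw [inChart_contractedForm θ V hc he hy (hι _) h2]
      have h6 : fderiv ℝ F (0, y) (1, 0) = coordVec e (ι (c.symm y)) (V (c.symm y)) := by
        rw [hFfst h4, ← hf.coordVec_velocity]
        exact fderiv_chart_path (g := fun s => f s (c.symm y)) he
          ((contMDiffAt_path (hf0 _)).mdifferentiableAt (by simp)) h3
      have h7 : (fderiv ℝ F (0, y)).comp (.inr ℝ ℝ (EuclideanSpace ℝ (Fin 3))) =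
          fderiv ℝ (fun z => e (ι (c.symm z))) y := by
        ext1 w
        rw [← h5, ← hFsnd h4]
        rfl
      rw [h6, h7, contractPullback, ← congrFun h5 y]
    rw [← h1.extDeriv_eq]
    rfl

end Deformation

/-! Existence of deformations with a given initial velocity. -/

section Existence

variable {M : Type*} [TopologicalSpace M] [ChartedSpace (EuclideanSpace ℝ (Fin 7)) M]
  [IsManifold (𝓡 7) ∞ M] {L : Type*} [TopologicalSpace L]
  [ChartedSpace (EuclideanSpace ℝ (Fin 3)) L] [IsManifold (𝓡 3) ∞ L]

theorem tangentBundle_ext_coordVec {e : OpenPartialHomeomorph M (EuclideanSpace ℝ (Fin 7))}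
    (he : e ∈ atlas (EuclideanSpace ℝ (Fin 7)) M) {p q : M} (h : p = q) (hp : q ∈ e.source)
    {v : TangentSpace (𝓡 7) p} {w : TangentSpace (𝓡 7) q}
    (hvw : coordVec e p v = coordVec e q w) :
    (⟨p, v⟩ : TangentBundle (𝓡 7) M) = ⟨q, w⟩ := by
  subst h
  have h1 := mfderiv_chart_symm_mfderiv he hp v
  have h2 := mfderiv_chart_symm_mfderiv he hp w
  have h3 : v = w := h1.symm.trans
    ((congrArg (fun z => mfderiv (𝓡 7) (𝓡 7) e.symm (e p) z) hvw).trans h2)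
  rw [h3]

theorem coordVec_add (e : OpenPartialHomeomorph M (EuclideanSpace ℝ (Fin 7))) (p : M)
    (v w : TangentSpace (𝓡 7) p) : coordVec e p (v + w) = coordVec e p v + coordVec e p w :=
  (mfderiv (𝓡 7) (𝓡 7) e p).map_add v w

theorem coordVec_smul (e : OpenPartialHomeomorph M (EuclideanSpace ℝ (Fin 7))) (p : M) (r : ℝ)
    (v : TangentSpace (𝓡 7) p) : coordVec e p (r • v) = r • coordVec e p v :=
  (mfderiv (𝓡 7) (𝓡 7) e p).map_smul r v

/-- The support of `ρ` lands in one chart, where `t ρ V` can be added in coordinates. Off the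
support nothing changes, and the two prescriptions agree where `ρ` vanishes. -/
theorem IsDeformation.exists_add_smul [CompactSpace L] {ι : L → M}
    {V₁ V : ∀ x : L, TangentSpace (𝓡 7) (ι x)} {f : ℝ → L → M} (hf : IsDeformation ι V₁ f)
    (hV : IsSmoothAlong ι V) {ρ : L → ℝ} (hρ : ContMDiff (𝓡 3) 𝓘(ℝ, ℝ) ∞ ρ) (p : M)
    (hs : ∀ x ∈ tsupport ρ, ι x ∈ (chartAt (EuclideanSpace ℝ (Fin 7)) p).source) :
    ∃ f' : ℝ → L → M, IsDeformation ι (fun x => V₁ x + ρ x • V x) f' := by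
  classical
  set e := chartAt (EuclideanSpace ℝ (Fin 7)) p with hedef
  have he : e ∈ atlas (EuclideanSpace ℝ (Fin 7)) M := chart_mem_atlas _ _
  let W : L → EuclideanSpace ℝ (Fin 7) := fun x => ρ x • coordVec e (ι x) (V x)
  have hW0 : ∀ x, x ∉ tsupport ρ → W x = 0 := fun x hx => by
    simp [W, image_eq_zero_of_notMem_tsupport hx]
  have hW : ContMDiff (𝓡 3) (𝓡 7) ∞ W := by
    intro x
    by_cases hx : x ∈ tsupport ρ
    · exact (hρ x).smul ((contMDiffAt_along_iff p (hs x hx)).mp (hV x)).2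
    · refine (contMDiffAt_const (c := (0 : EuclideanSpace ℝ (Fin 7)))).congr_of_eventuallyEq ?_
      filter_upwards [(isClosed_tsupport ρ).isOpen_compl.mem_nhds hx] with z hz using hW0 z hz
  let G : ℝ × L → EuclideanSpace ℝ (Fin 7) := fun q => e (f q.1 q.2) + q.1 • W q.2
  have hG : ∀ q : ℝ × L, f q.1 q.2 ∈ e.source →
      ContMDiffAt (𝓘(ℝ, ℝ).prod (𝓡 3)) (𝓡 7) ∞ (fun q : ℝ × L => f q.1 q.2) q →
      ContMDiffAt (𝓘(ℝ, ℝ).prod (𝓡 3)) (𝓡 7) ∞ G q := fun q hq hfq => by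
    have h1 : ContMDiffAt (𝓡 7) (𝓡 7) ∞ e (f q.1 q.2) :=
      (contMDiffOn_of_mem_maximalAtlas (IsManifold.subset_maximalAtlas he)).contMDiffAt
        (e.open_source.mem_nhds hq)
    exact (ContMDiffAt.comp q h1 hfq).add
      (contMDiffAt_fst.smul (ContMDiffAt.comp (g := W) (f := Prod.snd) q (hW q.2) contMDiffAt_snd))
  let f' : ℝ → L → M := fun t x => if x ∈ tsupport ρ then e.symm (G (t, x)) else f t x
  have hf0 := hf.eq_zero
  have hfs := hf.contMDiffAt
  have hA : ∀ t x, ContMDiffAt (𝓘(ℝ, ℝ).prod (𝓡 3)) (𝓡 7) ∞ (fun q : ℝ × L => f q.1 q.2) (t, x) →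
      (x ∈ tsupport ρ → f t x ∈ e.source ∧ G (t, x) ∈ e.target) →
      ContMDiffAt (𝓘(ℝ, ℝ).prod (𝓡 3)) (𝓡 7) ∞ (fun q : ℝ × L => f' q.1 q.2) (t, x) := by
    intro t x hft hx
    by_cases hxs : x ∈ tsupport ρ
    · obtain ⟨h1, h2⟩ := hx hxs
      have h3 : ContMDiffAt (𝓡 7) (𝓡 7) ∞ e.symm (G (t, x)) :=
        (contMDiffOn_symm_of_mem_maximalAtlas (IsManifold.subset_maximalAtlas he)).contMDiffAt
          (e.open_target.mem_nhds h2)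
      refine (ContMDiffAt.comp (t, x) h3 (hG (t, x) h1 hft)).congr_of_eventuallyEq ?_
      filter_upwards [hft.continuousAt.preimage_mem_nhds (e.open_source.mem_nhds h1)] with q hq
      by_cases hqs : q.2 ∈ tsupport ρ
      · simp [f', hqs]
      · have hq' : f q.1 q.2 ∈ e.source := hq
        simp [f', hqs, G, hW0 _ hqs, e.left_inv hq']
    · refine hft.congr_of_eventuallyEq ?_
      filter_upwards [continuousAt_snd.preimage_mem_nhds
        ((isClosed_tsupport ρ).isOpen_compl.mem_nhds hxs)] with q hq
      have hq' : q.2 ∉ tsupport ρ := hq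
      simp [f', hq']
  have hG0 : ∀ x, G (0, x) = e (ι x) := fun x => by simp [G, hf0]
  -- Compactness of the support gives one time interval on which no point leaves the chart.
  have hB : ∀ᶠ t in nhds (0 : ℝ), ∀ x ∈ tsupport ρ, f t x ∈ e.source ∧ G (t, x) ∈ e.target := by
    refine (isClosed_tsupport ρ).isCompact.eventually_forall_of_forall_eventually fun x hx => ?_
    have hx1 : f 0 x ∈ e.source := by rw [hf0]; exact hs x hx
    have h1 := hfs.self_of_nhds x
    refine Filter.Eventually.and ?_ ?_
    · exact h1.continuousAt.preimage_mem_nhds (e.open_source.mem_nhds hx1)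
    · refine (hG (0, x) hx1 h1).continuousAt.preimage_mem_nhds (e.open_target.mem_nhds ?_)
      rw [hG0]
      exact e.map_source (hs x hx)
  refine ⟨f', ?_, fun x => ?_⟩
  · obtain ⟨ε, hε, h⟩ := Metric.eventually_nhds_iff.mp (hfs.and hB)
    refine ⟨ε, hε, fun q hq => (hA q.1 q.2 ?_ ?_).contMDiffWithinAt⟩
    · exact (h (by simpa [abs_lt] using hq.1)).1 _
    · exact (h (by simpa [abs_lt] using hq.1)).2 _
  · by_cases hx : x ∈ tsupport ρ
    · have hxe := hs x hx
      have hx0 : f' 0 x = ι x := by simp [f', hx, hG0, e.left_inv hxe]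
      have hfx := contMDiffAt_path (hfs.self_of_nhds x)
      have hfx' := contMDiffAt_path (hA 0 x (hfs.self_of_nhds x) (hB.self_of_nhds x))
      refine tangentBundle_ext_coordVec he hx0 hxe ?_
      have h1 := fderiv_chart_path (g := fun t => f' t x) he
        (hfx'.mdifferentiableAt (by simp)) (by rw [hx0]; exact hxe)
      have hfe : f 0 x ∈ e.source := by rw [hf0]; exact hxe
      have h2 := fderiv_chart_path (g := fun t => f t x) he
        (hfx.mdifferentiableAt (by simp)) hfe
      rw [← h1, coordVec_add, coordVec_smul, ← hf.coordVec_velocity, ← h2]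
      have h3 : (fun t => e (f' t x)) =ᶠ[nhds 0] fun t => e (f t x) + t • W x := by
        filter_upwards [hB] with t ht
        simp only [f', hx, if_true]
        exact e.right_inv (ht x hx).2
      have h4 : DifferentiableAt ℝ (fun t => e (f t x)) 0 := by
        have h5 : ContMDiffAt (𝓡 7) (𝓡 7) ∞ e (f 0 x) :=
          (contMDiffOn_of_mem_maximalAtlas (IsManifold.subset_maximalAtlas he)).contMDiffAt
            (e.open_source.mem_nhds hfe)
        exact (contMDiffAt_iff_contDiffAt.mp (ContMDiffAt.comp (0 : ℝ) h5 hfx)).differentiableAt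
          (by simp)
      have h6 : HasDerivAt (fun t : ℝ => e (f t x) + t • W x)
          (deriv (fun t => e (f t x)) 0 + (1 : ℝ) • W x) 0 :=
        h4.hasDerivAt.add ((hasDerivAt_id _).smul_const _)
      rw [h3.fderiv_eq, fderiv_apply_one_eq_deriv, fderiv_apply_one_eq_deriv, h6.deriv,
        one_smul]
    · have h1 : (fun t => f' t x) = fun t => f t x := funext fun t => by simp [f', hx]
      have h2 : V₁ x = V₁ x + ρ x • V x := by
        rw [image_eq_zero_of_notMem_tsupport hx, zero_smul, add_zero]
      exact (congrArg (fun g : ℝ → M => (⟨g 0, mfderiv 𝓘(ℝ, ℝ) (𝓡 7) g 0 (1 : ℝ)⟩ :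
        TangentBundle (𝓡 7) M)) h1).trans ((hf.2 x).trans
          (congrArg (fun v => (⟨ι x, v⟩ : TangentBundle (𝓡 7) M)) h2))

/-- Write `V` as the sum of `ρ i • V` for a finite partition of unity subordinate to charts of `M`,
and add the summands one at a time, starting from the constant deformation. -/
theorem exists_isDeformation [CompactSpace L] [T2Space L] {ι : L → M}
    (hι : ContMDiff (𝓡 3) (𝓡 7) ∞ ι) {V : ∀ x : L, TangentSpace (𝓡 7) (ι x)}
    (hV : IsSmoothAlong ι V) : ∃ f : ℝ → L → M, IsDeformation ι V f := by
  obtain ⟨t, ht⟩ := isCompact_univ.elim_finite_subcover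
    (fun x : L => ι ⁻¹' (chartAt (EuclideanSpace ℝ (Fin 7)) (ι x)).source)
    (fun x => (chartAt _ (ι x)).open_source.preimage hι.continuous)
    (fun x _ => Set.mem_iUnion.mpr ⟨x, mem_chart_source _ (ι x)⟩)
  obtain ⟨ρ, hρ⟩ := SmoothPartitionOfUnity.exists_isSubordinate (𝓡 3) (isClosed_univ (X := L))
    (fun x : t => ι ⁻¹' (chartAt (EuclideanSpace ℝ (Fin 7)) (ι x)).source)
    (fun x => (chartAt _ (ι x)).open_source.preimage hι.continuous)
    (fun x hx => by simpa using ht hx)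
  classical
  have key : ∀ s : Finset t, ∃ f : ℝ → L → M,
      IsDeformation ι (fun x => (∑ i ∈ s, ρ i x) • V x) f := by
    intro s
    induction s using Finset.induction_on with
    | empty =>
      refine ⟨fun _ => ι, ⟨1, one_pos, (hι.comp contMDiff_snd).contMDiffOn⟩, fun x => ?_⟩
      simp only [mfderiv_const, Finset.sum_empty, zero_smul]
      rfl
    | insert i s hi ih =>
      obtain ⟨f, hf⟩ := ih
      obtain ⟨f', hf'⟩ := hf.exists_add_smul hV (ρ i).contMDiff (ι i) (fun x hx => hρ i hx)
      refine ⟨f', ?_⟩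
      have e : (fun x => (∑ j ∈ insert i s, ρ j x) • V x) =
          fun x => (∑ j ∈ s, ρ j x) • V x + ρ i x • V x := by
        funext x
        rw [Finset.sum_insert hi, add_smul, add_comm]
      rw [e]
      exact hf'
  obtain ⟨f, hf⟩ := key Finset.univ
  refine ⟨f, ?_⟩
  have e : (fun x => (∑ i, ρ i x) • V x) = V := by
    funext x
    rw [← finsum_eq_sum_of_fintype, ρ.sum_eq_one (Set.mem_univ x), one_smul]
  rwa [e] at hf

end Existence

/-! Linear algebra of the normal vector `R`. -/

section NormalAlgebra

theorem alternating_three_mul_comm (f g : EuclideanSpace ℝ (Fin 3) [⋀^Fin 3]→ₗ[ℝ] ℝ)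
    (a b : Fin 3 → EuclideanSpace ℝ (Fin 3)) : f a * g b = f b * g a := by
  let e := (EuclideanSpace.basisFun (Fin 3) ℝ).toBasis
  rw [f.eq_smul_basis_det e, g.eq_smul_basis_det e]
  simp only [AlternatingMap.smul_apply, smul_eq_mul]
  ring

theorem linearIndependent_of_orthonormal_comp {n : ℕ} {E : Type*} [AddCommGroup E] [Module ℝ E]
    {J : E →ₗ[ℝ] EuclideanSpace ℝ (Fin n)} {k : ℕ} {a : Fin k → E}
    (ha : Orthonormal ℝ fun i => J (a i)) : LinearIndependent ℝ a :=
  LinearIndependent.of_comp J ha.linearIndependent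

/-- If `B` is the matrix of `b` in the basis `a`, then `o b = det B * o a`, and the Gram matrix is
`Bᵀ B` by orthonormality. -/
theorem alternating_sq_eq_mul_det_gram {J : EuclideanSpace ℝ (Fin 3) →ₗ[ℝ] EuclideanSpace ℝ (Fin 7)}
    {a : Fin 3 → EuclideanSpace ℝ (Fin 3)} (ha : Orthonormal ℝ fun i => J (a i))
    (o : EuclideanSpace ℝ (Fin 3) [⋀^Fin 3]→ₗ[ℝ] ℝ) (b : Fin 3 → EuclideanSpace ℝ (Fin 3)) :
    o b ^ 2 = o a ^ 2 * (Matrix.of fun i j => inner ℝ (J (b i)) (J (b j))).det := by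
  let B := basisOfLinearIndependentOfCardEqFinrank (linearIndependent_of_orthonormal_comp ha)
    (by simp)
  have hB : ⇑B = a := coe_basisOfLinearIndependentOfCardEqFinrank _ _
  have h1 : o b = o a * (B.toMatrix b).det := by
    conv_lhs => rw [o.eq_smul_basis_det B]
    rw [AlternatingMap.smul_apply, smul_eq_mul, hB, Module.Basis.det_apply]
  have h2 : (Matrix.of fun i j => inner ℝ (J (b i)) (J (b j))) =
      (B.toMatrix b).transpose * B.toMatrix b := by
    have h3 : ∀ i, J (b i) = ∑ k, B.toMatrix b k i • J (a k) := fun i => by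
      conv_lhs => rw [← B.sum_repr (b i)]
      rw [map_sum]
      simp [hB, Module.Basis.toMatrix_apply]
    ext i j
    rw [Matrix.of_apply, h3, h3, ha.inner_sum, Matrix.mul_apply]
    simp
  rw [h2, Matrix.det_mul, Matrix.det_transpose, h1]
  ring

/-- Lift an orthonormal basis of the image of `J`. A nonzero top-degree form cannot vanish on it,
and swapping two vectors corrects the sign. -/
theorem exists_orthonormal_pos {J : EuclideanSpace ℝ (Fin 3) →ₗ[ℝ] EuclideanSpace ℝ (Fin 7)}
    (hJ : Function.Injective J) {o : EuclideanSpace ℝ (Fin 3) [⋀^Fin 3]→ₗ[ℝ] ℝ} (ho : o ≠ 0) :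
    ∃ a : Fin 3 → EuclideanSpace ℝ (Fin 3), Orthonormal ℝ (fun i => J (a i)) ∧ 0 < o a := by
  have hr : Module.finrank ℝ (LinearMap.range J) = 3 := by
    rw [LinearMap.finrank_range_of_inj hJ]; simp
  let b := (stdOrthonormalBasis ℝ (LinearMap.range J)).reindex (finCongr hr)
  have hb : ∀ i, ∃ a, J a = b i := fun i => (b i).2
  choose a ha using hb
  have h1 : Orthonormal ℝ (fun i => J (a i)) := by
    simp only [ha]
    exact b.orthonormal.comp_linearIsometry (LinearMap.range J).subtypeₗᵢ
  have h2 : o a ≠ 0 := by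
    intro h
    let B := basisOfLinearIndependentOfCardEqFinrank (linearIndependent_of_orthonormal_comp h1)
      (by simp)
    have hB : ⇑B = a := coe_basisOfLinearIndependentOfCardEqFinrank _ _
    apply ho
    rw [o.eq_smul_basis_det B, hB, h, zero_smul]
  rcases h2.lt_or_gt with h | h
  · refine ⟨a ∘ Equiv.swap 0 1, h1.comp _ (Equiv.swap 0 1).injective, ?_⟩
    rw [o.map_swap a (by decide)]
    linarith
  · exact ⟨a, h1, h⟩

/-- The standard basis of `ℝ³`. -/
noncomputable def stdVec (i : Fin 3) : EuclideanSpace ℝ (Fin 3) := EuclideanSpace.single i 1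

theorem alternating_stdVec_ne_zero {o : EuclideanSpace ℝ (Fin 3) [⋀^Fin 3]→ₗ[ℝ] ℝ} (ho : o ≠ 0) :
    o stdVec ≠ 0 := by
  let e := (EuclideanSpace.basisFun (Fin 3) ℝ).toBasis
  have he : ⇑e = stdVec := by ext i; simp [e, stdVec]
  intro h
  apply ho
  rw [o.eq_smul_basis_det e, he, h, zero_smul]

/-- The Gram determinant of the images of the standard basis. -/
noncomputable def gramDet (J : EuclideanSpace ℝ (Fin 3) →ₗ[ℝ] EuclideanSpace ℝ (Fin 7)) : ℝ :=
  (Matrix.of fun i j => inner ℝ (J (stdVec i)) (J (stdVec j))).det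

/-- The value of `o` on a positively oriented basis orthonormal for `J`, divided by the value of
`o` on the standard basis. -/
noncomputable def orientedFactor (J : EuclideanSpace ℝ (Fin 3) →ₗ[ℝ] EuclideanSpace ℝ (Fin 7))
    (o : EuclideanSpace ℝ (Fin 3) [⋀^Fin 3]→ₗ[ℝ] ℝ) : ℝ :=
  |o stdVec| / (o stdVec * √(gramDet J))

/-- The inner product of `z` with the unit vector `-u × (v × w)` for a positively oriented
orthonormal basis of the image of `J`. -/
noncomputable def normalPairing (J : EuclideanSpace ℝ (Fin 3) →ₗ[ℝ] EuclideanSpace ℝ (Fin 7))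
    (o : EuclideanSpace ℝ (Fin 3) [⋀^Fin 3]→ₗ[ℝ] ℝ) (z : EuclideanSpace ℝ (Fin 7)) : ℝ :=
  orientedFactor J o * inner ℝ z (chi0 fun i => J (stdVec i))

/-- The alternating form `a ↦ ⟨z, χ(J a)⟩`. -/
noncomputable def chiForm (J : EuclideanSpace ℝ (Fin 3) →ₗ[ℝ] EuclideanSpace ℝ (Fin 7))
    (z : EuclideanSpace ℝ (Fin 7)) : EuclideanSpace ℝ (Fin 3) [⋀^Fin 3]→ₗ[ℝ] ℝ :=
  (innerₗ (EuclideanSpace ℝ (Fin 7)) z).compAlternatingMap (chi0.compLinearMap J)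

theorem chiForm_apply (J : EuclideanSpace ℝ (Fin 3) →ₗ[ℝ] EuclideanSpace ℝ (Fin 7))
    (z : EuclideanSpace ℝ (Fin 7)) (a : Fin 3 → EuclideanSpace ℝ (Fin 3)) :
    chiForm J z a = inner ℝ z (chi0 fun i => J (a i)) := rfl

theorem gramDet_pos {J : EuclideanSpace ℝ (Fin 3) →ₗ[ℝ] EuclideanSpace ℝ (Fin 7)}
    (hJ : Function.Injective J) {o : EuclideanSpace ℝ (Fin 3) [⋀^Fin 3]→ₗ[ℝ] ℝ} (ho : o ≠ 0) :
    0 < gramDet J := by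
  obtain ⟨a, ha, hp⟩ := exists_orthonormal_pos hJ ho
  have h := alternating_sq_eq_mul_det_gram ha o stdVec
  have h1 := alternating_stdVec_ne_zero ho
  have h2 : 0 < o stdVec ^ 2 := by positivity
  rw [h] at h2
  exact (mul_pos_iff_of_pos_left (by positivity)).mp h2

/-- The form `chiForm J z` has top degree and is therefore proportional to `o`, which moves its
value from `a` to the standard basis. The ratio of the values of `o` is computed by the Gram
determinant. As the right side does not mention `a`, this proves that `R` is independent of the
basis. -/
theorem inner_chi0_eq_normalPairing
    {J : EuclideanSpace ℝ (Fin 3) →ₗ[ℝ] EuclideanSpace ℝ (Fin 7)} (hJ : Function.Injective J)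
    {o : EuclideanSpace ℝ (Fin 3) [⋀^Fin 3]→ₗ[ℝ] ℝ} {a : Fin 3 → EuclideanSpace ℝ (Fin 3)}
    (ha : Orthonormal ℝ fun i => J (a i)) (hp : 0 < o a) (z : EuclideanSpace ℝ (Fin 7)) :
    inner ℝ z (chi0 fun i => J (a i)) = normalPairing J o z := by
  have ho : o ≠ 0 := fun h => by simp [h] at hp
  have h0 := alternating_stdVec_ne_zero ho
  have hg := gramDet_pos hJ ho
  have h1 := alternating_three_mul_comm (chiForm J z) o a stdVec
  have h2 : o stdVec ^ 2 = o a ^ 2 * gramDet J := alternating_sq_eq_mul_det_gram ha o stdVec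
  have h3 : |o stdVec| = o a * √(gramDet J) := by
    rw [← Real.sqrt_sq_eq_abs, h2, Real.sqrt_mul (by positivity), Real.sqrt_sq hp.le]
  have h4 : 0 < √(gramDet J) := Real.sqrt_pos.mpr hg
  rw [chiForm_apply, chiForm_apply] at h1
  rw [normalPairing, orientedFactor, h3]
  field_simp
  linarith

/-- Both sides equal the pairing with `χ` of one oriented orthonormal basis of the image. It allows
passing between a tangent space of `L` and its chart coordinates. -/
theorem normalPairing_comp_equiv {J : EuclideanSpace ℝ (Fin 3) →ₗ[ℝ] EuclideanSpace ℝ (Fin 7)}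
    (hJ : Function.Injective J) {o : EuclideanSpace ℝ (Fin 3) [⋀^Fin 3]→ₗ[ℝ] ℝ} (ho : o ≠ 0)
    (S : EuclideanSpace ℝ (Fin 3) ≃ₗ[ℝ] EuclideanSpace ℝ (Fin 3)) (z : EuclideanSpace ℝ (Fin 7)) :
    normalPairing (J ∘ₗ S.toLinearMap) (o.compLinearMap S.toLinearMap) z = normalPairing J o z := by
  obtain ⟨a, ha, hp⟩ := exists_orthonormal_pos hJ ho
  rw [← inner_chi0_eq_normalPairing hJ ha hp,
    ← inner_chi0_eq_normalPairing (J := J ∘ₗ S.toLinearMap) (o := o.compLinearMap S.toLinearMap)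
      (a := fun i => S.symm (a i)) (hJ.comp S.injective) (by simpa using ha)
      (by simpa [Function.comp_def] using hp)]
  simp

/-- A vector normal to the image of `J` is determined by its contraction with `φ₀` and its
`R`-component. -/
theorem eq_zero_of_normalPairing_eq_zero
    {J : EuclideanSpace ℝ (Fin 3) →ₗ[ℝ] EuclideanSpace ℝ (Fin 7)} (hJ : Function.Injective J)
    {o : EuclideanSpace ℝ (Fin 3) [⋀^Fin 3]→ₗ[ℝ] ℝ} (ho : o ≠ 0)
    (h0 : ∀ a b c, phi0 (J a) (J b) (J c) = 0) {z : EuclideanSpace ℝ (Fin 7)}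
    (h1 : ∀ a, inner ℝ z (J a) = 0) (h2 : ∀ a b, phi0 z (J a) (J b) = 0)
    (h3 : normalPairing J o z = 0) : z = 0 := by
  obtain ⟨a, ha, hp⟩ := exists_orthonormal_pos hJ ho
  refine eq_zero_of_inner_harveyLawson_frame ha (h0 _ _ _) (fun i => h1 _) (fun i j => h2 _ _) ?_
  rw [inner_chi0_eq_normalPairing hJ ha hp, h3]

end NormalAlgebra

/-! The normal vector `R` in coordinates and its smooth dependence on the data. -/

section Coordinates

/-- Seven vectors, a basis of `ℝ⁷` if `J` is injective and `φ₀` vanishes on its image. -/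
noncomputable def adaptedVec (J : EuclideanSpace ℝ (Fin 3) →ₗ[ℝ] EuclideanSpace ℝ (Fin 7)) :
    Fin 7 → EuclideanSpace ℝ (Fin 7) :=
  ![J (stdVec 0), J (stdVec 1), J (stdVec 2), cross0 (J (stdVec 0)) (J (stdVec 1)),
    cross0 (J (stdVec 1)) (J (stdVec 2)), cross0 (J (stdVec 2)) (J (stdVec 0)),
    chi0 fun i => J (stdVec i)]

theorem linear_eq_zero_of_stdVec {E : Type*} [AddCommGroup E] [Module ℝ E]
    {f : EuclideanSpace ℝ (Fin 3) →ₗ[ℝ] E} (h : ∀ i, f (stdVec i) = 0) : f = 0 :=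
  (EuclideanSpace.basisFun (Fin 3) ℝ).toBasis.ext fun i => by simpa [stdVec] using h i

/-- The alternating form `(a, b) ↦ φ₀(z, J a, J b)`. -/
noncomputable def contrForm (J : EuclideanSpace ℝ (Fin 3) →ₗ[ℝ] EuclideanSpace ℝ (Fin 7))
    (z : EuclideanSpace ℝ (Fin 7)) : EuclideanSpace ℝ (Fin 3) [⋀^Fin 2]→ₗ[ℝ] ℝ where
  toFun m := phi0 z (J (m 0)) (J (m 1))
  map_update_add' {inst} m i x y := by
    obtain rfl : inst = instDecidableEqFin 2 := Subsingleton.elim _ _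
    fin_cases i <;> simp [phi0_eq_inner, cross0_add_left, cross0_add_right, inner_add_right]
  map_update_smul' {inst} m i c x := by
    obtain rfl : inst = instDecidableEqFin 2 := Subsingleton.elim _ _
    fin_cases i <;> simp [phi0_eq_inner, cross0_smul_left, cross0_smul_right, inner_smul_right]
  map_eq_zero_of_eq' m i j hm hij := by
    have h : m 0 = m 1 := by
      fin_cases i <;> fin_cases j <;> simp_all
    rw [h, phi0_self_right]

/-- The cyclic order of the pairs matches the products `u × v`, `v × w`, `w × u` in `adaptedVec`. -/
theorem alternating_two_ext {f g : EuclideanSpace ℝ (Fin 3) [⋀^Fin 2]→ₗ[ℝ] ℝ}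
    (h01 : f ![stdVec 0, stdVec 1] = g ![stdVec 0, stdVec 1])
    (h12 : f ![stdVec 1, stdVec 2] = g ![stdVec 1, stdVec 2])
    (h20 : f ![stdVec 2, stdVec 0] = g ![stdVec 2, stdVec 0]) : f = g := by
  have hsw : ∀ (f : EuclideanSpace ℝ (Fin 3) [⋀^Fin 2]→ₗ[ℝ] ℝ) a b, f ![a, b] = -f ![b, a] := by
    intro f a b
    have := f.map_swap ![b, a] (i := 0) (j := 1) (by decide)
    rw [← this]
    congr 1
    ext i; fin_cases i <;> rfl
  refine (EuclideanSpace.basisFun (Fin 3) ℝ).toBasis.ext_alternating fun v hv => ?_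
  have e : (fun i => (EuclideanSpace.basisFun (Fin 3) ℝ).toBasis (v i)) =
      ![stdVec (v 0), stdVec (v 1)] := by
    ext i; fin_cases i <;> simp [stdVec]
  rw [e]
  have hne : v 0 ≠ v 1 := fun h => absurd (hv h) (by decide)
  generalize v 0 = a at *
  generalize v 1 = b at *
  fin_cases a <;> fin_cases b <;> first
    | exact absurd rfl hne
    | exact h01
    | exact h12
    | exact h20
    | (rw [hsw f, hsw g]; first | exact congrArg _ h01 | exact congrArg _ h12 | exact congrArg _ h20)

theorem eq_zero_of_inner_adaptedVec
    {J : EuclideanSpace ℝ (Fin 3) →ₗ[ℝ] EuclideanSpace ℝ (Fin 7)} (hJ : Function.Injective J)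
    {o : EuclideanSpace ℝ (Fin 3) [⋀^Fin 3]→ₗ[ℝ] ℝ} (ho : o ≠ 0)
    (h0 : ∀ a b c, phi0 (J a) (J b) (J c) = 0) {z : EuclideanSpace ℝ (Fin 7)}
    (h : ∀ k, inner ℝ z (adaptedVec J k) = 0) : z = 0 := by
  refine eq_zero_of_normalPairing_eq_zero hJ ho h0 (fun a => ?_) (fun a b => ?_) ?_
  · have h1 : (innerₗ (EuclideanSpace ℝ (Fin 7)) z) ∘ₗ J = 0 :=
      linear_eq_zero_of_stdVec fun i => by
        fin_cases i
        exacts [h 0, h 1, h 2]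
    exact LinearMap.congr_fun h1 a
  · have h1 : contrForm J z = 0 := alternating_two_ext
      ((phi0_eq_inner _ _ _).trans (h 3)) ((phi0_eq_inner _ _ _).trans (h 4))
      ((phi0_eq_inner _ _ _).trans (h 5))
    exact congrArg (fun f => f ![a, b]) h1
  · rw [normalPairing]
    exact mul_eq_zero_of_right _ (h 6)

/-- The seven pairings define an injective endomorphism in dimension seven, hence a surjective one.
-/
theorem exists_inner_adaptedVec_eq
    {J : EuclideanSpace ℝ (Fin 3) →ₗ[ℝ] EuclideanSpace ℝ (Fin 7)} (hJ : Function.Injective J)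
    {o : EuclideanSpace ℝ (Fin 3) [⋀^Fin 3]→ₗ[ℝ] ℝ} (ho : o ≠ 0)
    (h0 : ∀ a b c, phi0 (J a) (J b) (J c) = 0) (r : Fin 7 → ℝ) :
    ∃ z, ∀ k, inner ℝ z (adaptedVec J k) = r k := by
  let T : EuclideanSpace ℝ (Fin 7) →ₗ[ℝ] (Fin 7 → ℝ) :=
    LinearMap.pi fun k => (innerₗ (EuclideanSpace ℝ (Fin 7))).flip (adaptedVec J k)
  have hT : Function.Injective T := by
    rw [← LinearMap.ker_eq_bot, LinearMap.ker_eq_bot']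
    intro z hz
    exact eq_zero_of_inner_adaptedVec hJ ho h0 fun k => congrFun hz k
  obtain ⟨z, hz⟩ := (LinearMap.injective_iff_surjective_of_finrank_eq_finrank (by simp)).mp hT r
  exact ⟨z, fun k => congrFun hz k⟩

/-- The coordinates of the cross product of `u` and `v` for the form `α`. -/
noncomputable def crossCoord (α : EuclideanSpace ℝ (Fin 7) [⋀^Fin 3]→L[ℝ] ℝ)
    (u v : EuclideanSpace ℝ (Fin 7)) : EuclideanSpace ℝ (Fin 7) :=
  WithLp.toLp 2 (Matrix.mulVec (gramOf α)⁻¹ fun i => α ![EuclideanSpace.single i 1, u, v])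

/-- `⟨v, χ(u₀, u₁, u₂)⟩` for the form `α`. -/
noncomputable def chiCoord (α : EuclideanSpace ℝ (Fin 7) [⋀^Fin 3]→L[ℝ] ℝ)
    (v u₀ u₁ u₂ : EuclideanSpace ℝ (Fin 7)) : ℝ :=
  -α ![v, u₀, crossCoord α u₁ u₂] - formMetric α u₀ u₁ * formMetric α v u₂
    + formMetric α u₀ u₂ * formMetric α v u₁

theorem IsPullbackPhi0.isUnit_det_gramOf {α : EuclideanSpace ℝ (Fin 7) [⋀^Fin 3]→L[ℝ] ℝ}
    {A : EuclideanSpace ℝ (Fin 7) ≃ₗ[ℝ] EuclideanSpace ℝ (Fin 7)} (h : IsPullbackPhi0 α A) :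
    IsUnit (gramOf α).det := by
  rw [h.gramOf_eq, Matrix.det_mul, Matrix.det_transpose]
  exact (mul_ne_zero (det_matrixOf_ne_zero A) (det_matrixOf_ne_zero A)).isUnit

/-- Inverting the Gram matrix raises the index of the covector `α(·, u, v)`. Both sides then have
the same inner products with the image under `A` of the standard basis. -/
theorem IsPullbackPhi0.map_crossCoord {α : EuclideanSpace ℝ (Fin 7) [⋀^Fin 3]→L[ℝ] ℝ}
    {A : EuclideanSpace ℝ (Fin 7) ≃ₗ[ℝ] EuclideanSpace ℝ (Fin 7)} (h : IsPullbackPhi0 α A)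
    (u v : EuclideanSpace ℝ (Fin 7)) : A (crossCoord α u v) = cross0 (A u) (A v) := by
  let b := ((EuclideanSpace.basisFun (Fin 7) ℝ).toBasis.map A)
  refine InnerProductSpace.ext_inner_left_basis b fun i => ?_
  have hb : b i = A (EuclideanSpace.single i 1) := by simp [b]
  rw [hb, ← h.formMetric_eq, ← phi0_eq_inner, ← h, formMetric, crossCoord]
  simp only [Matrix.mulVec_mulVec, Matrix.mul_nonsing_inv _ h.isUnit_det_gramOf, Matrix.one_mulVec]
  simp

theorem IsPullbackPhi0.chiCoord_eq {α : EuclideanSpace ℝ (Fin 7) [⋀^Fin 3]→L[ℝ] ℝ}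
    {A : EuclideanSpace ℝ (Fin 7) ≃ₗ[ℝ] EuclideanSpace ℝ (Fin 7)} (h : IsPullbackPhi0 α A)
    (v u₀ u₁ u₂ : EuclideanSpace ℝ (Fin 7)) :
    chiCoord α v u₀ u₁ u₂ = inner ℝ (A v) (chi0 ![A u₀, A u₁, A u₂]) := by
  rw [chiCoord, h, h.map_crossCoord, h.formMetric_eq, h.formMetric_eq, h.formMetric_eq,
    h.formMetric_eq, chi0_apply, inner_add_right, inner_sub_right, inner_neg_right,
    inner_smul_right, inner_smul_right, phi0_eq_inner]

/-- The inner products of `v` with `adaptedVec`, in terms of the form `α` and the vectors `u`. -/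
noncomputable def adaptedCoord (α : EuclideanSpace ℝ (Fin 7) [⋀^Fin 3]→L[ℝ] ℝ)
    (u : Fin 3 → EuclideanSpace ℝ (Fin 7)) (v : EuclideanSpace ℝ (Fin 7)) : Fin 7 → ℝ :=
  ![formMetric α v (u 0), formMetric α v (u 1), formMetric α v (u 2), α ![v, u 0, u 1],
    α ![v, u 1, u 2], α ![v, u 2, u 0], chiCoord α v (u 0) (u 1) (u 2)]

theorem IsPullbackPhi0.adaptedCoord_eq {α : EuclideanSpace ℝ (Fin 7) [⋀^Fin 3]→L[ℝ] ℝ}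
    {A : EuclideanSpace ℝ (Fin 7) ≃ₗ[ℝ] EuclideanSpace ℝ (Fin 7)} (h : IsPullbackPhi0 α A)
    {J : EuclideanSpace ℝ (Fin 3) →ₗ[ℝ] EuclideanSpace ℝ (Fin 7)}
    {u : Fin 3 → EuclideanSpace ℝ (Fin 7)} (hu : ∀ i, A (u i) = J (stdVec i))
    (v : EuclideanSpace ℝ (Fin 7)) (k : Fin 7) :
    adaptedCoord α u v k = inner ℝ (A v) (adaptedVec J k) := by
  have e : (fun i => J (stdVec i)) = ![A (u 0), A (u 1), A (u 2)] := by
    ext i : 1; fin_cases i <;> exact (hu _).symm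
  fin_cases k
  · exact (h.formMetric_eq _ _).trans (by rw [hu]; rfl)
  · exact (h.formMetric_eq _ _).trans (by rw [hu]; rfl)
  · exact (h.formMetric_eq _ _).trans (by rw [hu]; rfl)
  · exact (h _ _ _).trans (by rw [phi0_eq_inner, hu, hu]; rfl)
  · exact (h _ _ _).trans (by rw [phi0_eq_inner, hu, hu]; rfl)
  · exact (h _ _ _).trans (by rw [phi0_eq_inner, hu, hu]; rfl)
  · refine (h.chiCoord_eq _ _ _ _).trans ?_
    rw [← e]
    rfl

/-- The matrix of `adaptedCoord`. -/
noncomputable def adaptedMatrix (α : EuclideanSpace ℝ (Fin 7) [⋀^Fin 3]→L[ℝ] ℝ)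
    (u : Fin 3 → EuclideanSpace ℝ (Fin 7)) : Matrix (Fin 7) (Fin 7) ℝ :=
  Matrix.of fun k j => adaptedCoord α u (EuclideanSpace.single j 1) k

theorem IsPullbackPhi0.adaptedMatrix_mulVec {α : EuclideanSpace ℝ (Fin 7) [⋀^Fin 3]→L[ℝ] ℝ}
    {A : EuclideanSpace ℝ (Fin 7) ≃ₗ[ℝ] EuclideanSpace ℝ (Fin 7)} (h : IsPullbackPhi0 α A)
    {J : EuclideanSpace ℝ (Fin 3) →ₗ[ℝ] EuclideanSpace ℝ (Fin 7)}
    {u : Fin 3 → EuclideanSpace ℝ (Fin 7)} (hu : ∀ i, A (u i) = J (stdVec i))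
    (v : EuclideanSpace ℝ (Fin 7)) :
    Matrix.mulVec (adaptedMatrix α u) v = adaptedCoord α u v := by
  ext k
  have hv : v = ∑ j, v j • EuclideanSpace.single j (1 : ℝ) := by
    ext i; simp [Pi.single_apply]
  rw [h.adaptedCoord_eq hu]
  conv_rhs => rw [hv]
  rw [map_sum A, sum_inner]
  change ∑ j, adaptedMatrix α u k j * v j = _
  refine Finset.sum_congr rfl fun j _ => ?_
  rw [adaptedMatrix, Matrix.of_apply, h.adaptedCoord_eq hu, map_smul, inner_smul_left, mul_comm]
  rfl

/-- `A` carries a vector in the kernel to one orthogonal to all of `adaptedVec`, which is zero. -/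
theorem IsPullbackPhi0.det_adaptedMatrix_ne_zero
    {α : EuclideanSpace ℝ (Fin 7) [⋀^Fin 3]→L[ℝ] ℝ}
    {A : EuclideanSpace ℝ (Fin 7) ≃ₗ[ℝ] EuclideanSpace ℝ (Fin 7)} (h : IsPullbackPhi0 α A)
    {J : EuclideanSpace ℝ (Fin 3) →ₗ[ℝ] EuclideanSpace ℝ (Fin 7)}
    {u : Fin 3 → EuclideanSpace ℝ (Fin 7)} (hu : ∀ i, A (u i) = J (stdVec i))
    (hJ : Function.Injective J)
    {o : EuclideanSpace ℝ (Fin 3) [⋀^Fin 3]→ₗ[ℝ] ℝ} (ho : o ≠ 0)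
    (h0 : ∀ a b c, phi0 (J a) (J b) (J c) = 0) : (adaptedMatrix α u).det ≠ 0 := by
  intro hd
  obtain ⟨v, hv, hv0⟩ := Matrix.exists_mulVec_eq_zero_iff.mpr hd
  have h1 := h.adaptedMatrix_mulVec hu (WithLp.toLp 2 v)
  have h2 : A (WithLp.toLp 2 v) = 0 := eq_zero_of_inner_adaptedVec hJ ho h0 fun k => by
    rw [← h.adaptedCoord_eq hu, ← h1]
    exact congrFun hv0 k
  apply hv
  have h3 : WithLp.toLp 2 v = (0 : EuclideanSpace ℝ (Fin 7)) := by simpa using h2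
  exact congrArg WithLp.ofLp h3

end Coordinates

/-! Smooth dependence of the coordinate expressions on the data. -/

section SmoothCoordinates

variable {X : Type*} [NormedAddCommGroup X] [NormedSpace ℝ X]

/-- Cramer's rule expresses the inverse by determinants. -/
theorem ContDiffAt.matrix_inv {n : ℕ} {k : WithTop ℕ∞} {f : X → Matrix (Fin n) (Fin n) ℝ} {x : X}
    (hf : ∀ i j, ContDiffAt ℝ k (fun y => f y i j) x) (h0 : (f x).det ≠ 0) (i j : Fin n) :
    ContDiffAt ℝ k (fun y => (f y)⁻¹ i j) x := by
  simp only [Matrix.inv_def, Ring.inverse_eq_inv', Matrix.smul_apply, smul_eq_mul,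
    Matrix.adjugate_apply]
  refine ((ContDiffAt.matrix_det hf).inv h0).mul (ContDiffAt.matrix_det fun a b => ?_)
  by_cases h : a = j
  · subst h
    simpa using contDiffAt_const
  · simpa [Matrix.updateRow_ne h] using hf a b

theorem ContDiffAt.matrix_mulVec {n : ℕ} {k : WithTop ℕ∞} {f : X → Matrix (Fin n) (Fin n) ℝ}
    {v : X → Fin n → ℝ} {x : X} (hf : ∀ i j, ContDiffAt ℝ k (fun y => f y i j) x)
    (hv : ∀ i, ContDiffAt ℝ k (fun y => v y i) x) (i : Fin n) :
    ContDiffAt ℝ k (fun y => Matrix.mulVec (f y) (v y) i) x := by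
  simp only [Matrix.mulVec, dotProduct]
  exact ContDiffAt.sum fun j _ => (hf i j).mul (hv j)

theorem ContDiffAt.alternating_two_apply {k : WithTop ℕ∞} {n : ℕ}
    {α : X → EuclideanSpace ℝ (Fin n) [⋀^Fin 2]→L[ℝ] ℝ} {u v : X → EuclideanSpace ℝ (Fin n)}
    {x : X} (hα : ContDiffAt ℝ k α x) (hu : ContDiffAt ℝ k u x) (hv : ContDiffAt ℝ k v x) :
    ContDiffAt ℝ k (fun y => α y ![u y, v y]) x := by
  have h := hα.alternating_apply (v := ![u, v]) (fun i => by fin_cases i <;> assumption)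
  refine h.congr_of_eventuallyEq (Filter.Eventually.of_forall fun y => ?_)
  refine congrArg (α y) (funext fun i => ?_)
  fin_cases i <;> rfl

theorem ContDiffAt.alternating_three_apply {k : WithTop ℕ∞} {n : ℕ}
    {α : X → EuclideanSpace ℝ (Fin n) [⋀^Fin 3]→L[ℝ] ℝ} {u v w : X → EuclideanSpace ℝ (Fin n)}
    {x : X} (hα : ContDiffAt ℝ k α x) (hu : ContDiffAt ℝ k u x) (hv : ContDiffAt ℝ k v x)
    (hw : ContDiffAt ℝ k w x) : ContDiffAt ℝ k (fun y => α y ![u y, v y, w y]) x := by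
  have h := hα.alternating_apply (v := ![u, v, w]) (fun i => by fin_cases i <;> assumption)
  refine h.congr_of_eventuallyEq (Filter.Eventually.of_forall fun y => ?_)
  refine congrArg (α y) (funext fun i => ?_)
  fin_cases i <;> rfl

variable {α : X → EuclideanSpace ℝ (Fin 7) [⋀^Fin 3]→L[ℝ] ℝ} {x : X}
  {A : EuclideanSpace ℝ (Fin 7) ≃ₗ[ℝ] EuclideanSpace ℝ (Fin 7)}

theorem ContDiffAt.gramOf (hα : ContDiffAt ℝ ∞ α x) (h : IsPullbackPhi0 (α x) A) (i j : Fin 7) :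
    ContDiffAt ℝ ∞ (fun y => gramOf (α y) i j) x :=
  (h.contDiffAt_gramOf i j).comp x hα

theorem ContDiffAt.formMetric (hα : ContDiffAt ℝ ∞ α x) (h : IsPullbackPhi0 (α x) A)
    {u v : X → EuclideanSpace ℝ (Fin 7)} (hu : ContDiffAt ℝ ∞ u x) (hv : ContDiffAt ℝ ∞ v x) :
    ContDiffAt ℝ ∞ (fun y => formMetric (α y) (u y) (v y)) x := by
  rw [contDiffAt_piLp] at hu hv
  simp only [_root_.formMetric, dotProduct]
  exact ContDiffAt.sum fun i _ =>
    (hu i).mul (ContDiffAt.matrix_mulVec (fun i j => hα.gramOf h i j) hv i)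

theorem ContDiffAt.crossCoord (hα : ContDiffAt ℝ ∞ α x) (h : IsPullbackPhi0 (α x) A)
    {u v : X → EuclideanSpace ℝ (Fin 7)} (hu : ContDiffAt ℝ ∞ u x) (hv : ContDiffAt ℝ ∞ v x) :
    ContDiffAt ℝ ∞ (fun y => crossCoord (α y) (u y) (v y)) x := by
  rw [contDiffAt_piLp]
  intro i
  simp only [_root_.crossCoord]
  exact ContDiffAt.matrix_mulVec
    (ContDiffAt.matrix_inv (fun i j => hα.gramOf h i j) h.isUnit_det_gramOf.ne_zero)
    (fun i => hα.alternating_three_apply contDiffAt_const hu hv) i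

theorem ContDiffAt.chiCoord (hα : ContDiffAt ℝ ∞ α x) (h : IsPullbackPhi0 (α x) A)
    {v u₀ u₁ u₂ : X → EuclideanSpace ℝ (Fin 7)} (hv : ContDiffAt ℝ ∞ v x)
    (h₀ : ContDiffAt ℝ ∞ u₀ x) (h₁ : ContDiffAt ℝ ∞ u₁ x) (h₂ : ContDiffAt ℝ ∞ u₂ x) :
    ContDiffAt ℝ ∞ (fun y => chiCoord (α y) (v y) (u₀ y) (u₁ y) (u₂ y)) x :=
  ((hα.alternating_three_apply hv h₀ (hα.crossCoord h h₁ h₂)).neg.sub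
    ((hα.formMetric h h₀ h₁).mul (hα.formMetric h hv h₂))).add
    ((hα.formMetric h h₀ h₂).mul (hα.formMetric h hv h₁))

theorem ContDiffAt.adaptedCoord (hα : ContDiffAt ℝ ∞ α x) (h : IsPullbackPhi0 (α x) A)
    {u : X → Fin 3 → EuclideanSpace ℝ (Fin 7)} {v : X → EuclideanSpace ℝ (Fin 7)}
    (hu : ∀ i, ContDiffAt ℝ ∞ (fun y => u y i) x) (hv : ContDiffAt ℝ ∞ v x) (k : Fin 7) :
    ContDiffAt ℝ ∞ (fun y => adaptedCoord (α y) (u y) (v y) k) x := by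
  fin_cases k
  exacts [hα.formMetric h hv (hu 0), hα.formMetric h hv (hu 1), hα.formMetric h hv (hu 2),
    hα.alternating_three_apply hv (hu 0) (hu 1), hα.alternating_three_apply hv (hu 1) (hu 2),
    hα.alternating_three_apply hv (hu 2) (hu 0), hα.chiCoord h hv (hu 0) (hu 1) (hu 2)]

/-- The matrix stays invertible near `x`, so there `v` is the inverse matrix applied to `r`. An
isomorphism with `φ₀` is needed only at `x` itself. -/
theorem contDiffAt_of_adaptedMatrix_mulVec_eq (hα : ContDiffAt ℝ ∞ α x)
    (h : IsPullbackPhi0 (α x) A) {u : X → Fin 3 → EuclideanSpace ℝ (Fin 7)}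
    {v : X → EuclideanSpace ℝ (Fin 7)} {r : X → Fin 7 → ℝ}
    (hu : ∀ i, ContDiffAt ℝ ∞ (fun y => u y i) x) (hr : ∀ k, ContDiffAt ℝ ∞ (fun y => r y k) x)
    (hd : (adaptedMatrix (α x) (u x)).det ≠ 0)
    (hv : ∀ᶠ y in nhds x, Matrix.mulVec (adaptedMatrix (α y) (u y)) (v y) = r y) :
    ContDiffAt ℝ ∞ v x := by
  have hm : ∀ i j, ContDiffAt ℝ ∞ (fun y => adaptedMatrix (α y) (u y) i j) x := fun i j =>
    hα.adaptedCoord h hu contDiffAt_const i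
  have h1 : ∀ᶠ y in nhds x, (adaptedMatrix (α y) (u y)).det ≠ 0 :=
    (ContDiffAt.matrix_det hm).continuousAt.eventually_ne hd
  rw [contDiffAt_piLp]
  intro i
  refine (ContDiffAt.matrix_mulVec (ContDiffAt.matrix_inv hm hd) hr i).congr_of_eventuallyEq ?_
  filter_upwards [hv, h1] with y hy hy1
  rw [← hy, Matrix.mulVec_mulVec, Matrix.nonsing_inv_mul _ hy1.isUnit, Matrix.one_mulVec]

/-- The function `orientedFactor` in terms of the form `α`. -/
noncomputable def formFactor (α : EuclideanSpace ℝ (Fin 7) [⋀^Fin 3]→L[ℝ] ℝ)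
    (u : Fin 3 → EuclideanSpace ℝ (Fin 7)) (s : ℝ) : ℝ :=
  |s| / (s * √(Matrix.of fun i j => formMetric α (u i) (u j)).det)

theorem IsPullbackPhi0.det_formMetric_eq_gramDet
    {α : EuclideanSpace ℝ (Fin 7) [⋀^Fin 3]→L[ℝ] ℝ}
    (h : IsPullbackPhi0 α A) {J : EuclideanSpace ℝ (Fin 3) →ₗ[ℝ] EuclideanSpace ℝ (Fin 7)}
    {u : Fin 3 → EuclideanSpace ℝ (Fin 7)} (hu : ∀ i, A (u i) = J (stdVec i)) :
    (Matrix.of fun i j => formMetric α (u i) (u j)).det = gramDet J := by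
  simp only [h.formMetric_eq, hu]
  rfl

theorem IsPullbackPhi0.formFactor_eq {α : EuclideanSpace ℝ (Fin 7) [⋀^Fin 3]→L[ℝ] ℝ}
    (h : IsPullbackPhi0 α A) {J : EuclideanSpace ℝ (Fin 3) →ₗ[ℝ] EuclideanSpace ℝ (Fin 7)}
    {u : Fin 3 → EuclideanSpace ℝ (Fin 7)} (hu : ∀ i, A (u i) = J (stdVec i))
    (o : EuclideanSpace ℝ (Fin 3) [⋀^Fin 3]→ₗ[ℝ] ℝ) :
    formFactor α u (o stdVec) = orientedFactor J o := by
  rw [formFactor, h.det_formMetric_eq_gramDet hu, orientedFactor]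

theorem IsPullbackPhi0.normalPairing_eq {α : EuclideanSpace ℝ (Fin 7) [⋀^Fin 3]→L[ℝ] ℝ}
    (h : IsPullbackPhi0 α A) {J : EuclideanSpace ℝ (Fin 3) →ₗ[ℝ] EuclideanSpace ℝ (Fin 7)}
    {u : Fin 3 → EuclideanSpace ℝ (Fin 7)} (hu : ∀ i, A (u i) = J (stdVec i))
    (o : EuclideanSpace ℝ (Fin 3) [⋀^Fin 3]→ₗ[ℝ] ℝ) (v : EuclideanSpace ℝ (Fin 7)) :
    normalPairing J o (A v) = formFactor α u (o stdVec) * adaptedCoord α u v 6 := by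
  rw [h.formFactor_eq hu, h.adaptedCoord_eq hu, normalPairing]
  rfl

theorem ContDiffAt.formFactor (hα : ContDiffAt ℝ ∞ α x) (h : IsPullbackPhi0 (α x) A)
    {u : X → Fin 3 → EuclideanSpace ℝ (Fin 7)} {s : X → ℝ}
    (hu : ∀ i, ContDiffAt ℝ ∞ (fun y => u y i) x) (hs : ContDiffAt ℝ ∞ s x) (hs0 : s x ≠ 0)
    (hg : 0 < (Matrix.of fun i j => _root_.formMetric (α x) (u x i) (u x j)).det) :
    ContDiffAt ℝ ∞ (fun y => formFactor (α y) (u y) (s y)) x := by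
  have h1 : ContDiffAt ℝ ∞
      (fun y => (Matrix.of fun i j => _root_.formMetric (α y) (u y i) (u y j)).det) x :=
    ContDiffAt.matrix_det fun i j => hα.formMetric h (hu i) (hu j)
  exact (hs.abs hs0).div (hs.mul (h1.sqrt hg.ne')) (mul_ne_zero hs0 (Real.sqrt_pos.mpr hg).ne')

theorem orientedFactor_ne_zero {J : EuclideanSpace ℝ (Fin 3) →ₗ[ℝ] EuclideanSpace ℝ (Fin 7)}
    (hJ : Function.Injective J) {o : EuclideanSpace ℝ (Fin 3) [⋀^Fin 3]→ₗ[ℝ] ℝ} (ho : o ≠ 0) :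
    orientedFactor J o ≠ 0 := by
  have h0 := alternating_stdVec_ne_zero ho
  exact div_ne_zero (abs_ne_zero.mpr h0)
    (mul_ne_zero h0 (Real.sqrt_pos.mpr (gramDet_pos hJ ho)).ne')

end SmoothCoordinates

/-! Pointwise geometry of a Harvey–Lawson submanifold. -/

section Immersion

/-- In suitable charts an immersion is the inclusion of a factor followed by a linear equivalence;
differentiate this local form. -/
theorem mfderiv_injective_of_isImmersionAt {n m : ℕ} {M : Type*} [TopologicalSpace M]
    [ChartedSpace (EuclideanSpace ℝ (Fin n)) M] [IsManifold (𝓡 n) ∞ M]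
    {N : Type*} [TopologicalSpace N] [ChartedSpace (EuclideanSpace ℝ (Fin m)) N]
    [IsManifold (𝓡 m) ∞ N] {f : M → N} {x : M}
    (h : Manifold.IsImmersionAt (𝓡 n) (𝓡 m) ∞ f x) :
    Function.Injective (mfderiv (𝓡 n) (𝓡 m) f x) := by
  have : IsManifold (𝓡 n) 1 M := IsManifold.of_le (n := ∞) (by simp)
  have : IsManifold (𝓡 m) 1 N := IsManifold.of_le (n := ∞) (by simp)
  set c := h.domChart
  set e := h.codChart
  have hc : c ∈ IsManifold.maximalAtlas (𝓡 n) 1 M :=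
    IsManifold.maximalAtlas_subset_of_le (n := ∞) (by simp) h.domChart_mem_maximalAtlas
  have he : e ∈ IsManifold.maximalAtlas (𝓡 m) 1 N :=
    IsManifold.maximalAtlas_subset_of_le (n := ∞) (by simp) h.codChart_mem_maximalAtlas
  have hx : x ∈ c.source := h.mem_domChart_source
  have hc' : c.MDifferentiable (𝓡 n) (𝓡 n) :=
    ⟨fun z hz => (mdifferentiableAt_of_mem_maximalAtlas hc hz).mdifferentiableWithinAt,
      fun z hz => (mdifferentiableAt_symm_of_mem_maximalAtlas hc hz).mdifferentiableWithinAt⟩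
  have h1 := mdifferentiableAt_of_mem_maximalAtlas hc hx
  have h2 := mdifferentiableAt_of_mem_maximalAtlas he h.mem_codChart_source
  have hf : MDifferentiableAt (𝓡 n) (𝓡 m) f x := h.contMDiffAt.mdifferentiableAt (by simp)
  let T : EuclideanSpace ℝ (Fin n) →L[ℝ] EuclideanSpace ℝ (Fin m) :=
    h.equiv.toContinuousLinearMap ∘L ContinuousLinearMap.inl ℝ _ _
  have hT : Function.Injective T := h.equiv.injective.comp fun a b hab => congrArg Prod.fst hab
  have h3 : (e ∘ f) =ᶠ[nhds x] T ∘ c := by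
    filter_upwards [c.open_source.mem_nhds hx] with z hz
    have h4 := h.writtenInCharts
      ((c.extend (𝓡 n)).map_source (x := z) (by rwa [c.extend_source]))
    simpa [OpenPartialHomeomorph.extend, c, T, c.left_inv hz] using h4
  have hTd : HasMFDerivAt (𝓡 n) (𝓡 m) T (c x) T := T.hasMFDerivAt
  have h5 := (h2.hasMFDerivAt.comp x hf.hasMFDerivAt).mfderiv.symm.trans
    (h3.mfderiv_eq.trans (hTd.comp x h1.hasMFDerivAt).mfderiv)
  have h6 : Function.Injective
      ((mfderiv (𝓡 m) (𝓡 m) e (f x)).comp (mfderiv (𝓡 n) (𝓡 m) f x)) := by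
    rw [h5]
    exact hT.comp (hc'.mfderiv_injective hx)
  exact Function.Injective.of_comp h6

end Immersion

/-! ### Pointwise frames, the normal `R` and the function `⟨V, R⟩` -/

section Frames

variable {M : Type*} [TopologicalSpace M] [ChartedSpace (EuclideanSpace ℝ (Fin 7)) M]
  (φ : G2Structure M)

theorem G2Structure.form_eq_phi0 (p : M) (u v w : TangentSpace (𝓡 7) p) :
    φ.form p ![u, v, w] = phi0 (φ.frame p u) (φ.frame p v) (φ.frame p w) :=
  Classical.choose_spec (φ.exists_frame p) u v w

theorem G2Structure.frame_cross (p : M) (v w : TangentSpace (𝓡 7) p) :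
    φ.frame p (φ.cross p v w) = cross0 (φ.frame p v) (φ.frame p w) := by
  refine ext_inner_left ℝ fun z => ?_
  obtain ⟨u, rfl⟩ := (φ.frame p).surjective z
  rw [← phi0_eq_inner, ← φ.form_eq_phi0, ← φ.metric_cross]
  rfl

/-- The isomorphism is `φ.frame` precomposed with the inverse of the chart derivative. It connects
the chosen frames with the coordinate formulas. -/
theorem G2Structure.exists_isPullbackPhi0 [IsManifold (𝓡 7) ∞ M]
    {e : OpenPartialHomeomorph M (EuclideanSpace ℝ (Fin 7))}
    (he : e ∈ atlas (EuclideanSpace ℝ (Fin 7)) M) {q : M} (hq : q ∈ e.source) :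
    ∃ A : EuclideanSpace ℝ (Fin 7) ≃ₗ[ℝ] EuclideanSpace ℝ (Fin 7),
      IsPullbackPhi0 (φ.form.inChart e (e q)) A ∧
        ∀ v : TangentSpace (𝓡 7) q, A (coordVec e q v) = φ.frame q v := by
  have : IsManifold (𝓡 7) 1 M := IsManifold.of_le (n := ∞) (by simp)
  let S : TangentSpace (𝓡 7) q ≃ₗ[ℝ] EuclideanSpace ℝ (Fin 7) :=
    LinearEquiv.ofBijective (mfderiv (𝓡 7) (𝓡 7) e q).toLinearMap
      ((mdifferentiable_of_mem_atlas (I := 𝓡 7) he).mfderiv_bijective hq)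
  have hS : ∀ v, S v = coordVec e q v := fun v => rfl
  refine ⟨S.symm.trans (φ.frame q), fun u v w => ?_, fun v => ?_⟩
  · obtain ⟨u, rfl⟩ := S.surjective u
    obtain ⟨v, rfl⟩ := S.surjective v
    obtain ⟨w, rfl⟩ := S.surjective w
    simp only [LinearEquiv.trans_apply, LinearEquiv.symm_apply_apply]
    rw [← φ.form_eq_phi0]
    refine Eq.trans ?_ (φ.form.inChart_mfderiv he hq ![u, v, w])
    refine congrArg (φ.form.inChart e (e q)) (funext fun i => ?_)
    fin_cases i <;> rfl
  · rw [LinearEquiv.trans_apply, ← hS, S.symm_apply_apply]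

variable {L : Type*} [TopologicalSpace L] [ChartedSpace (EuclideanSpace ℝ (Fin 3)) L]
  (ι : L → M)

/-- The differential of `ι` at `x`, followed by `φ.frame`. -/
noncomputable def frameDeriv (x : L) : EuclideanSpace ℝ (Fin 3) →ₗ[ℝ] EuclideanSpace ℝ (Fin 7) :=
  (φ.frame (ι x)).toLinearMap ∘ₗ (mfderiv (𝓡 3) (𝓡 7) ι x).toLinearMap

theorem frameDeriv_apply (x : L) (a : TangentSpace (𝓡 3) x) :
    frameDeriv φ ι x a = φ.frame (ι x) (mfderiv (𝓡 3) (𝓡 7) ι x a) := rfl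

theorem frame_hlNormal (x : L) (a : Fin 3 → TangentSpace (𝓡 3) x)
    (ha : Orthonormal ℝ fun i => frameDeriv φ ι x (a i)) :
    φ.frame (ι x) (hlNormal φ ι x a) = chi0 fun i => frameDeriv φ ι x (a i) := by
  have e : (fun i => frameDeriv φ ι x (a i)) = ![frameDeriv φ ι x (a 0), frameDeriv φ ι x (a 1),
      frameDeriv φ ι x (a 2)] := by
    ext i : 1; fin_cases i <;> rfl
  have h1 : inner ℝ (frameDeriv φ ι x (a 0)) (frameDeriv φ ι x (a 1)) = 0 :=
    ha.inner_eq_zero (by decide)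
  have h2 : inner ℝ (frameDeriv φ ι x (a 0)) (frameDeriv φ ι x (a 2)) = 0 :=
    ha.inner_eq_zero (by decide)
  rw [e, chi0_apply, h1, h2, hlNormal, map_neg, φ.frame_cross, φ.frame_cross]
  simp [frameDeriv_apply]

variable {φ ι}

theorem IsOrientedOrthonormal.orthonormal {o : smoothForms 3 L 3} {x : L}
    {a : Fin 3 → TangentSpace (𝓡 3) x} (ha : IsOrientedOrthonormal φ ι o x a) :
    Orthonormal ℝ fun i => frameDeriv φ ι x (a i) := by
  rw [orthonormal_iff_ite]
  exact ha.1

theorem IsHarveyLawson.injective_frameDeriv [IsManifold (𝓡 7) ∞ M] [IsManifold (𝓡 3) ∞ L]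
    (hι : IsHarveyLawson φ ι) (x : L) : Function.Injective (frameDeriv φ ι x) :=
  (φ.frame (ι x)).injective.comp
    (mfderiv_injective_of_isImmersionAt (hι.isSmoothEmbedding.isImmersion.isImmersionAt x))

theorem IsHarveyLawson.phi0_frameDeriv (hι : IsHarveyLawson φ ι) (x : L)
    (a b c : EuclideanSpace ℝ (Fin 3)) :
    phi0 (frameDeriv φ ι x a) (frameDeriv φ ι x b) (frameDeriv φ ι x c) = 0 := by
  have h := hι.form_eq_zero x ![a, b, c]
  rw [← h, pullbackApply]
  refine (φ.form_eq_phi0 _ _ _ _).symm.trans (congrArg (φ.form (ι x)) (funext fun i => ?_))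
  fin_cases i <;> rfl

/-- The function `⟨V, R⟩`. -/
noncomputable def normalComponent (φ : G2Structure M) (ι : L → M) (o : FormField 3 L 3)
    (V : ∀ x : L, TangentSpace (𝓡 7) (ι x)) (x : L) : ℝ :=
  normalPairing (frameDeriv φ ι x) (o x).toAlternatingMap (φ.frame (ι x) (V x))

theorem IsOrientedOrthonormal.metric_hlNormal [IsManifold (𝓡 7) ∞ M] [IsManifold (𝓡 3) ∞ L]
    (hι : IsHarveyLawson φ ι) {o : smoothForms 3 L 3} {x : L}
    {a : Fin 3 → TangentSpace (𝓡 3) x} (ha : IsOrientedOrthonormal φ ι o x a)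
    (V : ∀ x : L, TangentSpace (𝓡 7) (ι x)) :
    φ.metric (ι x) (V x) (hlNormal φ ι x a) = normalComponent φ ι o.1 V x := by
  rw [G2Structure.metric, frame_hlNormal φ ι x a ha.orthonormal]
  exact inner_chi0_eq_normalPairing (hι.injective_frameDeriv x) ha.orthonormal ha.2 _

end Frames

/-! ### The normal vector with prescribed contraction and `R`-component -/

section Inverse

theorem exists_normal_vector {J : EuclideanSpace ℝ (Fin 3) →ₗ[ℝ] EuclideanSpace ℝ (Fin 7)}
    (hJ : Function.Injective J) {o : EuclideanSpace ℝ (Fin 3) [⋀^Fin 3]→ₗ[ℝ] ℝ} (ho : o ≠ 0)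
    (h0 : ∀ a b c, phi0 (J a) (J b) (J c) = 0) (β : EuclideanSpace ℝ (Fin 3) [⋀^Fin 2]→ₗ[ℝ] ℝ)
    (t : ℝ) : ∃ z, (∀ a, inner ℝ z (J a) = 0) ∧ (∀ a b, phi0 z (J a) (J b) = β ![a, b]) ∧
      normalPairing J o z = t := by
  obtain ⟨z, hz⟩ := exists_inner_adaptedVec_eq hJ ho h0
    ![0, 0, 0, β ![stdVec 0, stdVec 1], β ![stdVec 1, stdVec 2], β ![stdVec 2, stdVec 0],
      t / orientedFactor J o]
  refine ⟨z, fun a => ?_, fun a b => ?_, ?_⟩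
  · have h1 : (innerₗ (EuclideanSpace ℝ (Fin 7)) z) ∘ₗ J = 0 :=
      linear_eq_zero_of_stdVec fun i => by
        fin_cases i
        exacts [hz 0, hz 1, hz 2]
    exact LinearMap.congr_fun h1 a
  · have h1 : contrForm J z = β := alternating_two_ext
      ((phi0_eq_inner _ _ _).trans (hz 3)) ((phi0_eq_inner _ _ _).trans (hz 4))
      ((phi0_eq_inner _ _ _).trans (hz 5))
    exact congrArg (fun f => f ![a, b]) h1
  · rw [normalPairing, show inner ℝ z (chi0 fun i => J (stdVec i)) = t / orientedFactor J o from
      hz 6]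
    field_simp [orientedFactor_ne_zero hJ ho]

theorem inner_adaptedVec_eq {J : EuclideanSpace ℝ (Fin 3) →ₗ[ℝ] EuclideanSpace ℝ (Fin 7)}
    (hJ : Function.Injective J) {o : EuclideanSpace ℝ (Fin 3) [⋀^Fin 3]→ₗ[ℝ] ℝ} (ho : o ≠ 0)
    {β : EuclideanSpace ℝ (Fin 3) [⋀^Fin 2]→ₗ[ℝ] ℝ} {t : ℝ} {z : EuclideanSpace ℝ (Fin 7)}
    (h1 : ∀ a, inner ℝ z (J a) = 0) (h2 : ∀ a b, phi0 z (J a) (J b) = β ![a, b])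
    (h3 : normalPairing J o z = t) (k : Fin 7) : inner ℝ z (adaptedVec J k) =
      (![0, 0, 0, β ![stdVec 0, stdVec 1], β ![stdVec 1, stdVec 2], β ![stdVec 2, stdVec 0],
        t / orientedFactor J o] : Fin 7 → ℝ) k := by
  have h4 : inner ℝ z (chi0 fun i => J (stdVec i)) = t / orientedFactor J o := by
    rw [← h3, normalPairing]
    field_simp [orientedFactor_ne_zero hJ ho]
  fin_cases k
  exacts [h1 _, h1 _, h1 _, (phi0_eq_inner _ _ _).symm.trans (h2 _ _),
    (phi0_eq_inner _ _ _).symm.trans (h2 _ _), (phi0_eq_inner _ _ _).symm.trans (h2 _ _), h4]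

end Inverse

/-! The isomorphism between normal fields and pairs of functions and `2`-forms. -/

section NormalFields

variable {M : Type*} [TopologicalSpace M] [ChartedSpace (EuclideanSpace ℝ (Fin 7)) M]
  [IsManifold (𝓡 7) ∞ M] {L : Type*} [TopologicalSpace L]
  [ChartedSpace (EuclideanSpace ℝ (Fin 3)) L] [IsManifold (𝓡 3) ∞ L] {φ : G2Structure M}
  {ι : L → M}

theorem contMDiffAt_of_contDiffAt_comp_chart_symm {F : Type*}
    [NormedAddCommGroup F] [NormedSpace ℝ F] {f : L → F} {x : L}
    (hf : ContDiffAt ℝ ∞ (fun y => f ((chartAt (EuclideanSpace ℝ (Fin 3)) x).symm y))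
      (chartAt (EuclideanSpace ℝ (Fin 3)) x x)) : ContMDiffAt (𝓡 3) 𝓘(ℝ, F) ∞ f x := by
  have h1 : ContMDiffAt (𝓡 3) (𝓡 3) ∞ (chartAt (EuclideanSpace ℝ (Fin 3)) x) x :=
    (contMDiffOn_of_mem_maximalAtlas (IsManifold.chart_mem_maximalAtlas x)).contMDiffAt
      ((chartAt (EuclideanSpace ℝ (Fin 3)) x).open_source.mem_nhds (mem_chart_source _ x))
  refine (hf.contMDiffAt.comp x h1).congr_of_eventuallyEq ?_
  filter_upwards [(chartAt (EuclideanSpace ℝ (Fin 3)) x).open_source.mem_nhds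
    (mem_chart_source _ x)] with z hz
  simp [(chartAt (EuclideanSpace ℝ (Fin 3)) x).left_inv hz]

theorem ContMDiffAt.contDiffAt_comp_chart_symm {F : Type*}
    [NormedAddCommGroup F] [NormedSpace ℝ F] {f : L → F} {x : L}
    (hf : ContMDiffAt (𝓡 3) 𝓘(ℝ, F) ∞ f x) :
    ContDiffAt ℝ ∞ (fun y => f ((chartAt (EuclideanSpace ℝ (Fin 3)) x).symm y))
      (chartAt (EuclideanSpace ℝ (Fin 3)) x x) := by
  rw [← contMDiffAt_iff_contDiffAt]
  refine ContMDiffAt.comp (I' := 𝓡 3) (g := f) _ ?_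
    ((contMDiffOn_symm_of_mem_maximalAtlas (IsManifold.chart_mem_maximalAtlas x)).contMDiffAt
      ((chartAt (EuclideanSpace ℝ (Fin 3)) x).open_target.mem_nhds (mem_chart_target _ x)))
  rwa [(chartAt (EuclideanSpace ℝ (Fin 3)) x).left_inv (mem_chart_source _ x)]

variable (φ ι) in
/-- The differential of `ι` read in a chart of `L`, followed by `φ.frame`. -/
noncomputable def chartFrameDeriv (c : OpenPartialHomeomorph L (EuclideanSpace ℝ (Fin 3)))
    (y : EuclideanSpace ℝ (Fin 3)) : EuclideanSpace ℝ (Fin 3) →ₗ[ℝ] EuclideanSpace ℝ (Fin 7) :=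
  frameDeriv φ ι (c.symm y) ∘ₗ (mfderiv (𝓡 3) (𝓡 3) c.symm y).toLinearMap

theorem mfderiv_chart_symm_bijective {c : OpenPartialHomeomorph L (EuclideanSpace ℝ (Fin 3))}
    (hc : c ∈ atlas (EuclideanSpace ℝ (Fin 3)) L) {y : EuclideanSpace ℝ (Fin 3)}
    (hy : y ∈ c.target) : Function.Bijective (mfderiv (𝓡 3) (𝓡 3) c.symm y) := by
  have : IsManifold (𝓡 3) 1 L := IsManifold.of_le (n := ∞) (by simp)
  exact (mdifferentiable_of_mem_atlas (I := 𝓡 3) hc).symm.mfderiv_bijective hy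

theorem IsHarveyLawson.injective_chartFrameDeriv (hι : IsHarveyLawson φ ι)
    {c : OpenPartialHomeomorph L (EuclideanSpace ℝ (Fin 3))}
    (hc : c ∈ atlas (EuclideanSpace ℝ (Fin 3)) L) {y : EuclideanSpace ℝ (Fin 3)}
    (hy : y ∈ c.target) : Function.Injective (chartFrameDeriv φ ι c y) :=
  (hι.injective_frameDeriv _).comp (mfderiv_chart_symm_bijective hc hy).1

theorem inChart_toAlternatingMap_ne_zero {o : FormField 3 L 3} (ho : ∀ x, o x ≠ 0)
    {c : OpenPartialHomeomorph L (EuclideanSpace ℝ (Fin 3))}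
    (hc : c ∈ atlas (EuclideanSpace ℝ (Fin 3)) L) {y : EuclideanSpace ℝ (Fin 3)}
    (hy : y ∈ c.target) : (o.inChart c y).toAlternatingMap ≠ 0 := by
  intro h
  refine ho (c.symm y) ?_
  ext v
  choose w hw using fun i => (mfderiv_chart_symm_bijective hc hy).2 (v i)
  have h1 := congrArg (fun f => f w) h
  rw [← funext hw]
  exact h1

theorem normalPairing_chartFrameDeriv (hι : IsHarveyLawson φ ι) {o : FormField 3 L 3}
    (ho : ∀ x, o x ≠ 0) {c : OpenPartialHomeomorph L (EuclideanSpace ℝ (Fin 3))}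
    (hc : c ∈ atlas (EuclideanSpace ℝ (Fin 3)) L) {y : EuclideanSpace ℝ (Fin 3)}
    (hy : y ∈ c.target) (z : EuclideanSpace ℝ (Fin 7)) :
    normalPairing (chartFrameDeriv φ ι c y) (o.inChart c y).toAlternatingMap z =
      normalPairing (frameDeriv φ ι (c.symm y)) (o (c.symm y)).toAlternatingMap z := by
  let S : EuclideanSpace ℝ (Fin 3) ≃ₗ[ℝ] EuclideanSpace ℝ (Fin 3) :=
    LinearEquiv.ofBijective (mfderiv (𝓡 3) (𝓡 3) c.symm y).toLinearMap
      (mfderiv_chart_symm_bijective hc hy)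
  refine normalPairing_comp_equiv (J := frameDeriv φ ι (c.symm y))
    (o := (o (c.symm y)).toAlternatingMap) (hι.injective_frameDeriv _)
    (fun h => ho (c.symm y) ?_) S z
  ext v
  exact congrArg (fun f => f v) h

/-- An isomorphism of the form read in a chart of `M` with `φ₀` that intertwines the differential
of `ι` read in charts with `chartFrameDeriv`. -/
theorem exists_isPullbackPhi0_chart (hι : ContMDiff (𝓡 3) (𝓡 7) ∞ ι)
    {c : OpenPartialHomeomorph L (EuclideanSpace ℝ (Fin 3))}
    (hc : c ∈ atlas (EuclideanSpace ℝ (Fin 3)) L)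
    {e : OpenPartialHomeomorph M (EuclideanSpace ℝ (Fin 7))}
    (he : e ∈ atlas (EuclideanSpace ℝ (Fin 7)) M) {y : EuclideanSpace ℝ (Fin 3)}
    (hy : y ∈ c.target) (hs : ι (c.symm y) ∈ e.source) :
    ∃ A : EuclideanSpace ℝ (Fin 7) ≃ₗ[ℝ] EuclideanSpace ℝ (Fin 7),
      IsPullbackPhi0 (φ.form.inChart e (e (ι (c.symm y)))) A ∧
      (∀ v, A (coordVec e (ι (c.symm y)) v) = φ.frame (ι (c.symm y)) v) ∧
      ∀ i, A (fderiv ℝ (fun z => e (ι (c.symm z))) y (stdVec i)) =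
        chartFrameDeriv φ ι c y (stdVec i) := by
  obtain ⟨A, hA, hv⟩ := φ.exists_isPullbackPhi0 he hs
  refine ⟨A, hA, hv, fun i => ?_⟩
  rw [fderiv_chart_comp hc he hy ((hι _).mdifferentiableAt (by simp)) hs]
  exact hv _

theorem eventually_mem_charts
    {M : Type*} [TopologicalSpace M] {L : Type*} [TopologicalSpace L] {ι : L → M}
    {c : OpenPartialHomeomorph L (EuclideanSpace ℝ (Fin 3))}
    {e : OpenPartialHomeomorph M (EuclideanSpace ℝ (Fin 7))} {y : EuclideanSpace ℝ (Fin 3)}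
    (hy : y ∈ c.target)
    (hι : Continuous ι) (hs : ι (c.symm y) ∈ e.source) :
    ∀ᶠ z in nhds y, z ∈ c.target ∧ ι (c.symm z) ∈ e.source :=
  Filter.Eventually.and (c.open_target.mem_nhds hy)
    ((hι.continuousAt.comp (c.continuousAt_symm hy)).preimage_mem_nhds (e.open_source.mem_nhds hs))

theorem contDiffAt_form_chart
    {c : OpenPartialHomeomorph L (EuclideanSpace ℝ (Fin 3))}
    (hc : c ∈ atlas (EuclideanSpace ℝ (Fin 3)) L)
    {e : OpenPartialHomeomorph M (EuclideanSpace ℝ (Fin 7))}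
    (he : e ∈ atlas (EuclideanSpace ℝ (Fin 7)) M) {y : EuclideanSpace ℝ (Fin 3)}
    (hy : y ∈ c.target)
    (hι : ContMDiff (𝓡 3) (𝓡 7) ∞ ι) (hs : ι (c.symm y) ∈ e.source) :
    ContDiffAt ℝ ∞ (fun z => φ.form.inChart e (e (ι (c.symm z)))) y :=
  ContDiffAt.comp y ((φ.isSmooth e he).contDiffAt (e.open_target.mem_nhds (e.map_source hs)))
    (contDiffAt_chart_comp hc he hy (hι _) hs)

theorem contDiffAt_fderiv_chart
    {c : OpenPartialHomeomorph L (EuclideanSpace ℝ (Fin 3))}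
    (hc : c ∈ atlas (EuclideanSpace ℝ (Fin 3)) L)
    {e : OpenPartialHomeomorph M (EuclideanSpace ℝ (Fin 7))}
    (he : e ∈ atlas (EuclideanSpace ℝ (Fin 7)) M) {y : EuclideanSpace ℝ (Fin 3)}
    (hy : y ∈ c.target)
    (hι : ContMDiff (𝓡 3) (𝓡 7) ∞ ι) (hs : ι (c.symm y) ∈ e.source)
    (v : EuclideanSpace ℝ (Fin 3)) :
    ContDiffAt ℝ ∞ (fun z => fderiv ℝ (fun z => e (ι (c.symm z))) z v) y :=
  ((contDiffAt_chart_comp hc he hy (hι _) hs).fderiv_right (m := ∞) (by simp)).clm_apply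
    contDiffAt_const

theorem contDiffAt_formFactor_chart
    {c : OpenPartialHomeomorph L (EuclideanSpace ℝ (Fin 3))}
    (hc : c ∈ atlas (EuclideanSpace ℝ (Fin 3)) L)
    {e : OpenPartialHomeomorph M (EuclideanSpace ℝ (Fin 7))}
    (he : e ∈ atlas (EuclideanSpace ℝ (Fin 7)) M) {y : EuclideanSpace ℝ (Fin 3)}
    (hy : y ∈ c.target)
    (hι : IsHarveyLawson φ ι) (hs : ι (c.symm y) ∈ e.source)
    {o : FormField 3 L 3} (ho : ∀ x, o x ≠ 0) (hos : o.IsSmooth) :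
    ContDiffAt ℝ ∞ (fun z => formFactor (φ.form.inChart e (e (ι (c.symm z))))
      (fun i => fderiv ℝ (fun z => e (ι (c.symm z))) z (stdVec i)) (o.inChart c z stdVec)) y := by
  have hιs := hι.isSmoothEmbedding.contMDiff
  obtain ⟨A, hA, -, hu⟩ := exists_isPullbackPhi0_chart (φ := φ) hιs hc he hy hs
  have ho' := inChart_toAlternatingMap_ne_zero ho hc hy
  refine (contDiffAt_form_chart hc he hy hιs hs).formFactor hA
    (fun i => contDiffAt_fderiv_chart hc he hy hιs hs _)
    ((contDiff_alternating_apply stdVec).contDiffAt.comp y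
      ((hos c hc).contDiffAt (c.open_target.mem_nhds hy)))
    (alternating_stdVec_ne_zero ho') ?_
  rw [hA.det_formMetric_eq_gramDet hu]
  exact gramDet_pos (hι.injective_chartFrameDeriv hc hy) ho'

theorem normalComponent_chart
    {c : OpenPartialHomeomorph L (EuclideanSpace ℝ (Fin 3))}
    (hc : c ∈ atlas (EuclideanSpace ℝ (Fin 3)) L)
    {e : OpenPartialHomeomorph M (EuclideanSpace ℝ (Fin 7))}
    (he : e ∈ atlas (EuclideanSpace ℝ (Fin 7)) M) {y : EuclideanSpace ℝ (Fin 3)}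
    (hy : y ∈ c.target)
    (hι : IsHarveyLawson φ ι) (hs : ι (c.symm y) ∈ e.source)
    {o : FormField 3 L 3} (ho : ∀ x, o x ≠ 0) (V : ∀ x : L, TangentSpace (𝓡 7) (ι x)) :
    normalComponent φ ι o V (c.symm y) = formFactor (φ.form.inChart e (e (ι (c.symm y))))
      (fun i => fderiv ℝ (fun z => e (ι (c.symm z))) y (stdVec i)) (o.inChart c y stdVec) *
      adaptedCoord (φ.form.inChart e (e (ι (c.symm y))))
        (fun i => fderiv ℝ (fun z => e (ι (c.symm z))) y (stdVec i))
        (coordVec e (ι (c.symm y)) (V (c.symm y))) 6 := by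
  obtain ⟨A, hA, hv, hu⟩ := exists_isPullbackPhi0_chart (φ := φ)
    hι.isSmoothEmbedding.contMDiff hc he hy hs
  rw [normalComponent, ← normalPairing_chartFrameDeriv hι ho hc hy, ← hv,
    hA.normalPairing_eq hu]
  rfl

/-- By `normalComponent_chart` the function is expressed near each point by `φ`, `ι`, `o` and `V` in
fixed charts; the chosen frames have disappeared. -/
theorem contMDiff_normalComponent (hι : IsHarveyLawson φ ι) {o : FormField 3 L 3}
    (ho : ∀ x, o x ≠ 0) (hos : o.IsSmooth) {V : ∀ x : L, TangentSpace (𝓡 7) (ι x)}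
    (hV : IsSmoothAlong ι V) : ContMDiff (𝓡 3) 𝓘(ℝ, ℝ) ∞ (normalComponent φ ι o V) := by
  intro x
  have hιs := hι.isSmoothEmbedding.contMDiff
  refine contMDiffAt_of_contDiffAt_comp_chart_symm ?_
  have hx := mem_chart_source (EuclideanSpace ℝ (Fin 3)) x
  have hc := chart_mem_atlas (EuclideanSpace ℝ (Fin 3)) x
  have hv := ((contMDiffAt_along_iff (ι x) (mem_chart_source _ _)).mp
    (hV x)).2.contDiffAt_comp_chart_symm
  have he := chart_mem_atlas (EuclideanSpace ℝ (Fin 7)) (ι x)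
  have hs := mem_chart_source (EuclideanSpace ℝ (Fin 7)) (ι x)
  have hy := mem_chart_target (EuclideanSpace ℝ (Fin 3)) x
  set c := chartAt (EuclideanSpace ℝ (Fin 3)) x
  set e := chartAt (EuclideanSpace ℝ (Fin 7)) (ι x)
  have hs' : ι (c.symm (c x)) ∈ e.source := by rwa [c.left_inv hx]
  obtain ⟨A, hA, -, -⟩ := exists_isPullbackPhi0_chart (φ := φ) hιs hc he hy hs'
  refine ((contDiffAt_formFactor_chart hc he hy hι hs' ho hos).mul
    ((contDiffAt_form_chart hc he hy hιs hs').adaptedCoord hA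
      (fun i => contDiffAt_fderiv_chart hc he hy hιs hs' (stdVec i)) hv 6)).congr_of_eventuallyEq ?_
  filter_upwards [eventually_mem_charts hy hιs.continuous hs'] with z hz
  exact normalComponent_chart hc he hz.1 hι hz.2 ho V

/-- In charts the three hypotheses are a linear system for the coordinates of `V`, with smooth
coefficients, smooth right side and invertible matrix. -/
theorem isSmoothAlong_of_contractedForm_of_normalComponent (hι : IsHarveyLawson φ ι)
    {o : FormField 3 L 3} (ho : ∀ x, o x ≠ 0) (hos : o.IsSmooth)
    {V : ∀ x : L, TangentSpace (𝓡 7) (ι x)}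
    (h1 : ∀ (x : L) (a : TangentSpace (𝓡 3) x),
      φ.metric (ι x) (V x) (mfderiv (𝓡 3) (𝓡 7) ι x a) = 0)
    (h2 : (contractedForm φ.form ι V).IsSmooth)
    (h3 : ContMDiff (𝓡 3) 𝓘(ℝ, ℝ) ∞ (normalComponent φ ι o V)) : IsSmoothAlong ι V := by
  intro x
  have hιs := hι.isSmoothEmbedding.contMDiff
  refine (contMDiffAt_along_iff (ι x) (mem_chart_source _ _)).mpr ⟨hιs x, ?_⟩
  refine contMDiffAt_of_contDiffAt_comp_chart_symm ?_
  have h3' := (h3 x).contDiffAt_comp_chart_symm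
  have hx := mem_chart_source (EuclideanSpace ℝ (Fin 3)) x
  have hc := chart_mem_atlas (EuclideanSpace ℝ (Fin 3)) x
  have he := chart_mem_atlas (EuclideanSpace ℝ (Fin 7)) (ι x)
  have hs := mem_chart_source (EuclideanSpace ℝ (Fin 7)) (ι x)
  have hy := mem_chart_target (EuclideanSpace ℝ (Fin 3)) x
  set c := chartAt (EuclideanSpace ℝ (Fin 3)) x
  set e := chartAt (EuclideanSpace ℝ (Fin 7)) (ι x)
  have hs' : ι (c.symm (c x)) ∈ e.source := by rwa [c.left_inv hx]
  obtain ⟨A, hA, hv, hu⟩ := exists_isPullbackPhi0_chart (φ := φ) hιs hc he hy hs'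
  have hJ := hι.injective_chartFrameDeriv hc hy
  have ho' := inChart_toAlternatingMap_ne_zero ho hc hy
  have hfs := contDiffAt_formFactor_chart hc he hy hι hs' ho hos
  have hf0 := (hA.formFactor_eq hu (o.inChart c (c x)).toAlternatingMap).trans_ne
    (orientedFactor_ne_zero hJ ho')
  have hη : ∀ i j, ContDiffAt ℝ ∞
      (fun z => (contractedForm φ.form ι V).inChart c z ![stdVec i, stdVec j]) (c x) :=
    fun i j => ((h2 c hc).contDiffAt (c.open_target.mem_nhds hy)).alternating_two_apply
      contDiffAt_const contDiffAt_const
  -- The zeros express normality. The last entry is divided by `formFactor` because the system pairs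
  -- `V` with `χ` of the coordinate basis instead of the unit normal `R`.
  refine contDiffAt_of_adaptedMatrix_mulVec_eq
    (r := fun z => ![0, 0, 0, (contractedForm φ.form ι V).inChart c z ![stdVec 0, stdVec 1],
      (contractedForm φ.form ι V).inChart c z ![stdVec 1, stdVec 2],
      (contractedForm φ.form ι V).inChart c z ![stdVec 2, stdVec 0],
      normalComponent φ ι o V (c.symm z) / formFactor (φ.form.inChart e (e (ι (c.symm z))))
        (fun i => fderiv ℝ (fun z => e (ι (c.symm z))) z (stdVec i)) (o.inChart c z stdVec)])
    (contDiffAt_form_chart hc he hy hιs hs') hA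
    (fun i => contDiffAt_fderiv_chart hc he hy hιs hs' (stdVec i)) (fun k => ?_)
    (hA.det_adaptedMatrix_ne_zero hu hJ ho' fun a b c => hι.phi0_frameDeriv _ _ _ _) ?_
  · fin_cases k
    exacts [contDiffAt_const, contDiffAt_const, contDiffAt_const, hη 0 1, hη 1 2, hη 2 0,
      h3'.div hfs hf0]
  · filter_upwards [eventually_mem_charts hy hιs.continuous hs'] with z hz
    -- A new isomorphism at each `z`: it only verifies the system, whose terms do not contain it.
    obtain ⟨A, hA, hv, hu⟩ := exists_isPullbackPhi0_chart (φ := φ) hιs hc he hz.1 hz.2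
    rw [hA.adaptedMatrix_mulVec hu]
    ext k
    rw [hA.adaptedCoord_eq hu, hv]
    have hff := hA.formFactor_eq hu (o.inChart c z).toAlternatingMap
    refine (inner_adaptedVec_eq (hι.injective_chartFrameDeriv hc hz.1)
      (inChart_toAlternatingMap_ne_zero ho hc hz.1)
      (β := ((contractedForm φ.form ι V).inChart c z).toAlternatingMap)
      (fun a => h1 _ _) (fun a b => ?_)
      (normalPairing_chartFrameDeriv hι ho hc hz.1 _) k).trans ?_
    · refine (φ.form_eq_phi0 _ _ _ _).symm.trans ?_
      refine congrArg (φ.form (ι (c.symm z))) (funext fun i => ?_)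
      fin_cases i <;> rfl
    · rw [← hff]
      rfl

/-- Normal fields with prescribed contraction and `R`-component. -/
theorem exists_normalField (hι : IsHarveyLawson φ ι) {o : FormField 3 L 3} (ho : ∀ x, o x ≠ 0)
    (hos : o.IsSmooth) {h : L → ℝ} (hh : ContMDiff (𝓡 3) 𝓘(ℝ, ℝ) ∞ h) {η : FormField 3 L 2}
    (hη : η.IsSmooth) : ∃ V ∈ normalFields φ ι hι.isSmoothEmbedding.contMDiff,
      normalComponent φ ι o V = h ∧ contractedForm φ.form ι V = η := by
  have hJ := fun x => exists_normal_vector (hι.injective_frameDeriv x)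
    (o := (o x).toAlternatingMap) (fun h0 => ho x (by ext v; exact congrArg (fun f => f v) h0))
    (hι.phi0_frameDeriv x) (η x).toAlternatingMap (h x)
  choose z hz1 hz2 hz3 using hJ
  let V : ∀ x : L, TangentSpace (𝓡 7) (ι x) := fun x => (φ.frame (ι x)).symm (z x)
  have hVz : ∀ x, φ.frame (ι x) (V x) = z x := fun x => LinearEquiv.apply_symm_apply _ _
  have e1 : normalComponent φ ι o V = h := funext fun x => by
    rw [normalComponent, hVz, hz3]
  have e2 : contractedForm φ.form ι V = η := funext fun x => by
    ext v
    have hv : v = ![v 0, v 1] := by ext i : 1; fin_cases i <;> rfl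
    rw [hv, contractedForm_apply, φ.form_eq_phi0, hVz]
    exact hz2 x _ _
  have h1 : ∀ (x : L) (a : TangentSpace (𝓡 3) x),
      φ.metric (ι x) (V x) (mfderiv (𝓡 3) (𝓡 7) ι x a) = 0 := fun x a => by
    rw [G2Structure.metric, hVz]
    exact hz1 x a
  exact ⟨V, ⟨isSmoothAlong_of_contractedForm_of_normalComponent hι ho hos h1 (by rwa [e2])
    (by rwa [e1]), h1⟩, e1, e2⟩

theorem ext_of_contractedForm_of_normalComponent (hι : IsHarveyLawson φ ι)
    {o : FormField 3 L 3} (ho : ∀ x, o x ≠ 0) {V W : ∀ x : L, TangentSpace (𝓡 7) (ι x)}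
    (hV : ∀ (x : L) (a : TangentSpace (𝓡 3) x),
      φ.metric (ι x) (V x) (mfderiv (𝓡 3) (𝓡 7) ι x a) = 0)
    (hW : ∀ (x : L) (a : TangentSpace (𝓡 3) x),
      φ.metric (ι x) (W x) (mfderiv (𝓡 3) (𝓡 7) ι x a) = 0)
    (h2 : contractedForm φ.form ι V = contractedForm φ.form ι W)
    (h3 : normalComponent φ ι o V = normalComponent φ ι o W) : V = W := by
  funext x
  have hf : ∀ (V : ∀ x : L, TangentSpace (𝓡 7) (ι x)) a b,
      phi0 (φ.frame (ι x) (V x)) (frameDeriv φ ι x a) (frameDeriv φ ι x b) =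
        contractedForm φ.form ι V x ![a, b] := fun V a b =>
    (φ.form_eq_phi0 _ _ _ _).symm.trans (contractedForm_apply φ.form ι V x a b).symm
  have h := eq_zero_of_normalPairing_eq_zero (hι.injective_frameDeriv x)
    (o := (o x).toAlternatingMap) (fun h0 => ho x (by ext v; exact congrArg (fun f => f v) h0))
    (hι.phi0_frameDeriv x) (z := φ.frame (ι x) (V x) - φ.frame (ι x) (W x)) (fun a => ?_)
    (fun a b => ?_) ?_
  · exact (φ.frame (ι x)).injective (sub_eq_zero.mp h)
  · rw [inner_sub_left]
    exact sub_eq_zero.mpr ((hV x a).trans (hW x a).symm)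
  · rw [phi0_eq_inner, inner_sub_left, ← phi0_eq_inner, ← phi0_eq_inner, hf, hf, h2, sub_self]
  · simp only [normalPairing, inner_sub_left, mul_sub]
    exact sub_eq_zero.mpr (congrFun h3 x)

end NormalFields

/-! ### The space of smooth functions is infinite-dimensional -/

section SmoothFunctions

theorem infinite_of_chartedSpace (L : Type*) [TopologicalSpace L] [Nonempty L]
    [ChartedSpace (EuclideanSpace ℝ (Fin 3)) L] : Infinite L := by
  obtain ⟨x⟩ := ‹Nonempty L›
  set c := chartAt (EuclideanSpace ℝ (Fin 3)) x
  have h : c.target.Infinite := infinite_of_mem_nhds (c x)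
    (c.open_target.mem_nhds (mem_chart_target _ x))
  by_contra hL
  rw [not_infinite_iff_finite] at hL
  refine h ((Set.finite_range c).subset fun y hy => ⟨c.symm y, c.right_inv hy⟩)

/-- Bump functions make evaluation at any finitely many distinct points surjective; one point more
than the supposed dimension gives a contradiction. -/
theorem not_finiteDimensional_contMDiffMap (L : Type*) [TopologicalSpace L] [CompactSpace L]
    [T2Space L] [Nonempty L] [ChartedSpace (EuclideanSpace ℝ (Fin 3)) L] [IsManifold (𝓡 3) ∞ L] :
    ¬ FiniteDimensional ℝ C^∞⟮𝓡 3, L; 𝓘(ℝ, ℝ), ℝ⟯ := by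
  intro hfin
  have := infinite_of_chartedSpace L
  let d := Module.finrank ℝ C^∞⟮𝓡 3, L; 𝓘(ℝ, ℝ), ℝ⟯ + 1
  let p : Fin d → L := fun i => Infinite.natEmbedding L i
  have hp : Function.Injective p := (Infinite.natEmbedding L).injective.comp Fin.val_injective
  let T : C^∞⟮𝓡 3, L; 𝓘(ℝ, ℝ), ℝ⟯ →ₗ[ℝ] (Fin d → ℝ) :=
    { toFun := fun f i => f (p i)
      map_add' := fun _ _ => rfl
      map_smul' := fun _ _ => rfl }
  have hb : ∀ i, ∃ f : C^∞⟮𝓡 3, L; 𝓘(ℝ, ℝ), ℝ⟯, T f = Pi.single i 1 := fun i => by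
    obtain ⟨f, h0, h1, -⟩ := exists_contMDiffMap_zero_one_of_isClosed (n := ⊤) (𝓡 3)
      (s := p '' {i}ᶜ) (t := {p i}) (Set.toFinite _).isClosed isClosed_singleton
      (by
        rw [Set.disjoint_singleton_right]
        rintro ⟨j, hj, hji⟩
        exact hj (hp hji))
    refine ⟨f, funext fun j => ?_⟩
    change f (p j) = _
    by_cases hj : j = i
    · subst hj
      simpa using h1 rfl
    · simpa [hj] using h0 ⟨j, hj, rfl⟩
  have hT : Function.Surjective T := fun r => by
    choose f hf using hb
    refine ⟨∑ i, r i • f i, ?_⟩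
    rw [map_sum]
    ext j
    simp [hf, Pi.single_apply]
  have := LinearMap.finrank_le_finrank_of_surjective hT
  simp [d] at this

end SmoothFunctions

/-! ### The linearized deformation map and its kernel -/

section Linearization

variable {M : Type*} [TopologicalSpace M] [ChartedSpace (EuclideanSpace ℝ (Fin 7)) M]
  [IsManifold (𝓡 7) ∞ M] {L : Type*} [TopologicalSpace L]
  [ChartedSpace (EuclideanSpace ℝ (Fin 3)) L] [IsManifold (𝓡 3) ∞ L] {φ : G2Structure M}
  {ι : L → M}

variable (φ) in
/-- The linear map `V ↦ (i_V φ)|_L` on normal fields. -/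
noncomputable def contractedFormLinear (hι : ContMDiff (𝓡 3) (𝓡 7) ∞ ι) :
    normalFields φ ι hι →ₗ[ℝ] smoothForms 3 L 2 where
  toFun V := ⟨contractedForm φ.form ι V.1, V.2.1.isSmooth_contractedForm φ.isSmooth⟩
  map_add' V W := by
    refine Subtype.ext (funext fun x => ?_)
    ext v
    have hv : v = ![v 0, v 1] := by ext i : 1; fin_cases i <;> rfl
    change contractedForm φ.form ι (V.1 + W.1) x v =
      contractedForm φ.form ι V.1 x v + contractedForm φ.form ι W.1 x v
    rw [hv, contractedForm_apply, contractedForm_apply, contractedForm_apply, φ.form_eq_phi0,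
      φ.form_eq_phi0, φ.form_eq_phi0, Pi.add_apply, map_add]
    simp only [phi0_eq_inner, inner_add_left]
  map_smul' r V := by
    refine Subtype.ext (funext fun x => ?_)
    ext v
    have hv : v = ![v 0, v 1] := by ext i : 1; fin_cases i <;> rfl
    change contractedForm φ.form ι (r • V.1) x v = r * contractedForm φ.form ι V.1 x v
    rw [hv, contractedForm_apply, contractedForm_apply, φ.form_eq_phi0,
      φ.form_eq_phi0, Pi.smul_apply, map_smul]
    simp only [phi0_eq_inner, inner_smul_left]
    rfl

/-- The linear map `V ↦ ⟨V, R⟩` on normal fields. -/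
noncomputable def normalComponentLinear (hι : IsHarveyLawson φ ι) (o : smoothForms 3 L 3)
    (ho : ∀ x : L, o.1 x ≠ 0) : normalFields φ ι hι.isSmoothEmbedding.contMDiff →ₗ[ℝ]
      C^∞⟮𝓡 3, L; 𝓘(ℝ, ℝ), ℝ⟯ where
  toFun V := ⟨normalComponent φ ι o.1 V.1, contMDiff_normalComponent hι ho o.2 V.2.1⟩
  map_add' V W := by
    ext x
    change normalPairing _ _ (φ.frame (ι x) (V.1 x + W.1 x)) =
      normalPairing _ _ (φ.frame (ι x) (V.1 x)) + normalPairing _ _ (φ.frame (ι x) (W.1 x))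
    rw [map_add]
    simp only [normalPairing, inner_add_left, mul_add]
  map_smul' r V := by
    ext x
    change normalPairing _ _ (φ.frame (ι x) (r • V.1 x)) =
      r * normalPairing _ _ (φ.frame (ι x) (V.1 x))
    rw [map_smul]
    simp only [normalPairing, inner_smul_left, mul_left_comm]
    rfl

variable (φ) in
/-- The linearized deformation map `V ↦ d (i_V φ)|_L`. -/
noncomputable def linearizedDeformation (hι : ContMDiff (𝓡 3) (𝓡 7) ∞ ι) :
    normalFields φ ι hι →ₗ[ℝ] smoothForms 3 L 3 :=
  exteriorDerivLinear 3 L 2 ∘ₗ contractedFormLinear φ hι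

theorem isClosed_contractedForm_of_mem_ker {hι : ContMDiff (𝓡 3) (𝓡 7) ∞ ι}
    {V : normalFields φ ι hι} (hV : V ∈ LinearMap.ker (linearizedDeformation φ hι)) :
    (contractedForm φ.form ι V.1).IsClosed :=
  (FormField.exteriorDeriv_eq_zero_iff (V.2.1.isSmooth_contractedForm φ.isSmooth)).mp
    (congrArg Subtype.val (LinearMap.mem_ker.mp hV))

theorem isLinearizedDeformationMap_linearizedDeformation [CompactSpace L] [T2Space L]
    (hφ : φ.form.IsClosed) (hι : ContMDiff (𝓡 3) (𝓡 7) ∞ ι) :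
    IsLinearizedDeformationMap φ ι hι (linearizedDeformation φ hι) := fun V =>
  ⟨exists_isDeformation hι V.2.1, fun _ hf x a =>
    hf.hasDerivAt_pullbackApply φ.isSmooth hφ x a⟩

/-- The linear map `V ↦ (⟨V, R⟩, (i_V φ)|_L)` on infinitesimal deformations. -/
noncomputable def kerToPair (hι : IsHarveyLawson φ ι) (o : smoothForms 3 L 3)
    (ho : ∀ x : L, o.1 x ≠ 0) :
    LinearMap.ker (linearizedDeformation φ hι.isSmoothEmbedding.contMDiff) →ₗ[ℝ]
      C^∞⟮𝓡 3, L; 𝓘(ℝ, ℝ), ℝ⟯ × closedForms 3 L 2 :=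
  ((normalComponentLinear hι o ho) ∘ₗ Submodule.subtype _).prod
    (LinearMap.codRestrict (closedForms 3 L 2)
      ((smoothForms 3 L 2).subtype ∘ₗ contractedFormLinear φ _ ∘ₗ Submodule.subtype _)
      fun V => ⟨V.1.2.1.isSmooth_contractedForm φ.isSmooth,
        isClosed_contractedForm_of_mem_ker V.2⟩)

/-- The correspondence already holds between all normal fields and all pairs; membership in the
kernel is precisely closedness of the second component. -/
theorem kerToPair_bijective (hι : IsHarveyLawson φ ι) (o : smoothForms 3 L 3)
    (ho : ∀ x : L, o.1 x ≠ 0) : Function.Bijective (kerToPair hι o ho) := by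
  constructor
  · intro V W hVW
    have h1 : normalComponent φ ι o.1 V.1.1 = normalComponent φ ι o.1 W.1.1 :=
      congrArg (fun q : C^∞⟮𝓡 3, L; 𝓘(ℝ, ℝ), ℝ⟯ × closedForms 3 L 2 => (q.1 : L → ℝ)) hVW
    have h2 : contractedForm φ.form ι V.1.1 = contractedForm φ.form ι W.1.1 :=
      congrArg (fun q : C^∞⟮𝓡 3, L; 𝓘(ℝ, ℝ), ℝ⟯ × closedForms 3 L 2 => q.2.1) hVW
    exact Subtype.ext (Subtype.ext
      (ext_of_contractedForm_of_normalComponent hι ho V.1.2.2 W.1.2.2 h2 h1))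
  · rintro ⟨h, η, hη, hηc⟩
    obtain ⟨V, hV, e1, e2⟩ := exists_normalField hι ho o.2 h.contMDiff hη
    have hk : (⟨V, hV⟩ : normalFields φ ι hι.isSmoothEmbedding.contMDiff) ∈
        LinearMap.ker (linearizedDeformation φ hι.isSmoothEmbedding.contMDiff) := by
      refine LinearMap.mem_ker.mpr (Subtype.ext ?_)
      change (contractedForm φ.form ι V).exteriorDeriv = 0
      rw [e2, FormField.exteriorDeriv_eq_zero_iff hη]
      exact hηc
    exact ⟨⟨⟨V, hV⟩, hk⟩, Prod.ext (DFunLike.coe_injective e1) (Subtype.ext e2)⟩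

end Linearization

theorem theorem1p1
    {M : Type*} [TopologicalSpace M] [T2Space M] [SecondCountableTopology M]
    [ChartedSpace (EuclideanSpace ℝ (Fin 7)) M] [IsManifold (𝓡 7) ∞ M]
    (φ : G2Structure M) (hφ : φ.form.IsClosed)
    {L : Type*} [TopologicalSpace L] [CompactSpace L] [Nonempty L]
    [ChartedSpace (EuclideanSpace ℝ (Fin 3)) L] [IsManifold (𝓡 3) ∞ L]
    (ι : L → M) (hι : IsHarveyLawson φ ι)
    (o : smoothForms 3 L 3) (ho : ∀ x : L, o.1 x ≠ 0) :
    ∃ D : normalFields φ ι hι.isSmoothEmbedding.contMDiff →ₗ[ℝ] smoothForms 3 L 3,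
      IsLinearizedDeformationMap φ ι hι.isSmoothEmbedding.contMDiff D ∧
      ¬ FiniteDimensional ℝ (LinearMap.ker D) ∧
      ∃ Φ : LinearMap.ker D ≃ₗ[ℝ] C^∞⟮𝓡 3, L; 𝓘(ℝ, ℝ), ℝ⟯ × closedForms 3 L 2,
        ∀ (V : LinearMap.ker D) (x : L),
          (∀ a : Fin 3 → TangentSpace (𝓡 3) x, IsOrientedOrthonormal φ ι o x a →
            (Φ V).1 x = φ.metric (ι x) (V.1.1 x) (hlNormal φ ι x a)) ∧
          (∀ b c : TangentSpace (𝓡 3) x,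
            (Φ V).2.1 x ![b, c] = φ.form (ι x)
              ![V.1.1 x, mfderiv (𝓡 3) (𝓡 7) ι x b, mfderiv (𝓡 3) (𝓡 7) ι x c]) := by
  -- `L` inherits the Hausdorff property from `M`; partitions of unity and bump functions need it.
  have : T2Space L := hι.isSmoothEmbedding.isEmbedding.t2Space
  let Φ := LinearEquiv.ofBijective (kerToPair hι o ho) (kerToPair_bijective hι o ho)
  refine ⟨linearizedDeformation φ hι.isSmoothEmbedding.contMDiff,
    isLinearizedDeformationMap_linearizedDeformation hφ _, fun hfin => ?_, Φ,
    fun V x => ⟨fun a ha => (ha.metric_hlNormal hι V.1.1).symm, fun b c =>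
      contractedForm_apply φ.form ι V.1.1 x b c⟩⟩
  -- A finite-dimensional kernel would map onto all smooth functions by `V ↦ ⟨V, R⟩`.
  refine not_finiteDimensional_contMDiffMap L ?_
  exact Module.Finite.of_surjective ((LinearMap.fst ℝ _ _) ∘ₗ Φ.toLinearMap)
    (Prod.fst_surjective.comp Φ.surjective)
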